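/- Conventions. A Liouville manifold $(M,\omega,L)$ is a connected symplectic manifold with a complete vector field $L$ (with flow $L^t$) such that $\omega=d\alpha$ for $\alpha=i_L\omega$, and which contains a closed connected hypersurface $P$ transversal to $L$ that bounds an open domain $U$ with compact closure such that $M=U\sqcup\bigcup_{t\ge 0}L^tP$. Such $P$ and $U$ are called starshaped. A point is allowed as $M$, with $P=\emptyset$. The core of $M$ is $\mathrm{Core}(M)=\bigcap_{t>0}L^{-t}(U)$. The ideal contact boundary of $M$ is the closed contact manifold represented by any starshaped hypersurface $P$ with the contact structure $\ker(\alpha|_{TP})$, cooriented by $\alpha|_{TP}$; its symplectization is $M_*=M\setminus\mathrm{Core}(M)$, on which $c\in\mathbb R_+$ acts by $L^{\log c}$. The $n$-stabilization of $M$ is $M\times\mathbb C^n$ with the form $\omega\oplus(dp\wedge dq)$ and the field $L\oplus\frac12(p\,\partial_p+q\,\partial_q)$, where $z=p+iq$. For a closed cooriented contact manifold $(P,\eta)$ let $\widetilde{\mathrm{Cont}}_0(P,\eta)$ be the universal cover of the identity component of its group of contactomorphisms (paths starting at the identity, up to homotopy with fixed end points). Write $\tilde f\succeq\tilde g$ if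 $\tilde f\tilde g^{-1}$ is represented by a path generated by a non-negative contact Hamiltonian. This relation is reflexive and transitive; $(P,\eta)$ is called orderable if it is a partial order, that is, if it is also antisymmetric. Theorem. Let $(M,\omega,L)$ be a Liouville manifold and let $n\ge 2$. Then the $n$-stabilization $M_{stab}=M\times\mathbb C^n$ is a Liouville manifold, and its ideal contact boundary is not orderable. Moreover, for $t\in\mathbb R$ let $$e_t(x,z)=(x,e^{2\pi i t}z),\qquad f_t(x,z_1,w)=(x,e^{2\pi i(n-1)t}z_1,e^{-2\pi i t}w),\quad w=(z_2,\dots,z_n).$$ Then there is a smooth path $a^{(s)}$, $s\in[0,1]$, of $\mathbb R_+$-equivariant symplectomorphisms of $M_{stab}\setminus\mathrm{Core}(M_{stab})$ with $a^{(0)}=\mathbf 1$ such that, with $a=a^{(1)}$, $$\varphi_t=e_{-t}\,f_{3t}\,a\,e_t\,a^{-1},\qquad t\in\mathbb R/\mathbb Z,$$ is a positive contractible loop of $\mathbb R_+$-equivariant symplectomorphisms of $M_{stab}\setminus\mathrm{Core}(M_{stab})$: it is based at the identity, it is generated by an everywhere positive $\mathbb R_+$-equivariant Hamiltonian, and it is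 homotopic to the constant loop through loops of $\mathbb R_+$-equivariant symplectomorphisms based at the identity. -/

import Mathlib

open scoped Manifold ContDiff
open Set

noncomputable section

universe u v w

/-! ## Differential forms of degree one and two -/

section Forms

variable {E : Type u} [NormedAddCommGroup E] [NormedSpace ℝ E]
  {H : Type v} [TopologicalSpace H] (I : ModelWithCorners ℝ E H)
  {M : Type w} [TopologicalSpace M] [ChartedSpace H M]

/-- A (not necessarily continuous) field of covectors on `M`. -/
abbrev CovectorField : Type _ := ∀ x : M, TangentSpace I x →ₗ[ℝ] ℝ

/-- A (not necessarily continuous) field of bilinear forms on the tangent spaces of `M`. -/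
abbrev BilinearField : Type _ :=
  ∀ x : M, TangentSpace I x →ₗ[ℝ] TangentSpace I x →ₗ[ℝ] ℝ

variable {I}

/-- A covector field is a smooth 1-form when it is smooth as a (fibrewise linear) function on the
tangent bundle. -/
def IsSmoothOneForm [IsManifold I 1 M] (α : CovectorField I (M := M)) : Prop :=
  ContMDiff I.tangent 𝓘(ℝ, ℝ) ∞ (fun p : TangentBundle I M => α p.1 p.2)

/-- The expression of the 1-form `α` in the preferred chart `φ` at `x₀`: this is
`(φ⁻¹)^* α`, evaluated at the point `y` of the model space on the vector `v`. -/
def chartForm (α : CovectorField I (M := M)) (x₀ : M) (y v : E) : ℝ :=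
  α ((extChartAt I x₀).symm y)
    (mfderivWithin 𝓘(ℝ, E) I (extChartAt I x₀).symm (range I) y v)

/-- `σ = dα`: around every point `x₀`, with `φ` the chart at `x₀` and `a = (φ⁻¹)^* α`,
`(φ⁻¹)^* σ (v, w) = D_v (a(w)) - D_w (a(v))` at the point `φ x₀`, for all constant vectors `v, w`. -/
def IsExteriorDerivative (α : CovectorField I (M := M)) (σ : BilinearField I (M := M)) : Prop :=
  ∀ (x₀ : M) (v w : E),
    σ ((extChartAt I x₀).symm (extChartAt I x₀ x₀))
        (mfderivWithin 𝓘(ℝ, E) I (extChartAt I x₀).symm (range I) (extChartAt I x₀ x₀) v)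
        (mfderivWithin 𝓘(ℝ, E) I (extChartAt I x₀).symm (range I) (extChartAt I x₀ x₀) w) =
      fderivWithin ℝ (fun y => chartForm α x₀ y w) (range I) (extChartAt I x₀ x₀) v -
      fderivWithin ℝ (fun y => chartForm α x₀ y v) (range I) (extChartAt I x₀ x₀) w

end Forms

/-! ## Liouville manifolds -/

section Liouville

variable {E : Type u} [NormedAddCommGroup E] [NormedSpace ℝ E]
  {H : Type v} [TopologicalSpace H] (I : ModelWithCorners ℝ E H)
  (M : Type w) [TopologicalSpace M] [ChartedSpace H M]

/-- The data of a Liouville manifold: the symplectic form `ω` (the field `symp`), the Liouville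
field `L` and its
flow. The conditions on these data are in `LiouvilleData.IsLiouville`. -/
structure LiouvilleData where
  /-- the symplectic form -/
  symp : BilinearField I (M := M)
  /-- the Liouville vector field -/
  L : ∀ x : M, TangentSpace I x
  /-- the flow of the Liouville vector field -/
  flow : ℝ → M → M

namespace LiouvilleData

variable {I M}

/-- The Liouville form `α = i_L ω`. -/
def α (D : LiouvilleData I M) : CovectorField I (M := M) := fun x => D.symp x (D.L x)

/-- `P` is a starshaped hypersurface bounding the starshaped domain `U`: `P` is a closed connected
hypersurface transversal to `L`, it bounds the open set `U` with compact closure, and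
`M = U ⊔ ⋃_{t ≥ 0} L^t P`. The empty hypersurface is allowed; this is the case of a point. -/
structure IsStarshaped (D : LiouvilleData I M) (P U : Set M) : Prop where
  isCompact : IsCompact P
  isPreconnected : IsPreconnected P
  /-- `P` is a smooth hypersurface, locally the regular zero set of a function, transversal to `L`-/
  transversal : ∀ x ∈ P, ∃ (V : Set M) (g : M → ℝ), IsOpen V ∧ x ∈ V ∧
    ContMDiffOn I 𝓘(ℝ, ℝ) ∞ g V ∧ P ∩ V = {y ∈ V | g y = 0} ∧
    (mfderiv I 𝓘(ℝ, ℝ) g x (D.L x) : ℝ) ≠ 0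
  isOpen_domain : IsOpen U
  isCompact_closure : IsCompact (closure U)
  frontier_eq : frontier U = P
  disjoint : Disjoint U (⋃ t ∈ Ici (0 : ℝ), D.flow t '' P)
  union_eq : U ∪ (⋃ t ∈ Ici (0 : ℝ), D.flow t '' P) = univ

/-- `(M, ω, L)` is a Liouville manifold: `M` is connected, `ω` is a symplectic form, `ω = dα` for
`α = i_L ω`, the vector field `L` is smooth and complete, and `M` contains a starshaped
hypersurface. -/
structure IsLiouville [IsManifold I 1 M] (D : LiouvilleData I M) : Prop where
  connected : ConnectedSpace M
  smooth_α : IsSmoothOneForm D.α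
  exact : IsExteriorDerivative D.α D.symp
  nondegenerate : ∀ (x : M) (v : TangentSpace I x), (∀ w, D.symp x v w = 0) → v = 0
  smooth_L : ContMDiff I I.tangent ∞ (fun x : M => (⟨x, D.L x⟩ : TangentBundle I M))
  smooth_flow : ContMDiff (𝓘(ℝ, ℝ).prod I) I ∞ (fun p : ℝ × M => D.flow p.1 p.2)
  flow_zero : ∀ x, D.flow 0 x = x
  flow_integral : ∀ x, IsMIntegralCurve (I := I) (fun t => D.flow t x) D.L
  exists_starshaped : ∃ P U : Set M, D.IsStarshaped P U

/-- The core `⋂_{t > 0} L^{-t} U` of a Liouville manifold, where `U` is a starshaped domain. -/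
def core (D : LiouvilleData I M) (U : Set M) : Set M :=
  {x | ∀ t : ℝ, 0 < t → D.flow t x ∈ U}

/-- The complement `M_*` of the core. With the action `c * x = L^{log c} x` of the positive reals
it is the symplectization of the ideal contact boundary. -/
def symplectization (D : LiouvilleData I M) (U : Set M) : Set M := (D.core U)ᶜ

end LiouvilleData

/-- The vector space `ℂⁿ`. -/
abbrev Cn (n : ℕ) : Type := EuclideanSpace ℂ (Fin n)

/-- The symplectic form `dp ∧ dq = ∑ dp_j ∧ dq_j` on `ℂⁿ`, where `z_j = p_j + i q_j`. -/
def stdSymplectic (n : ℕ) : Cn n →ₗ[ℝ] Cn n →ₗ[ℝ] ℝ :=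
  LinearMap.mk₂ ℝ (fun v w => ∑ j, ((v j).re * (w j).im - (v j).im * (w j).re))
    (by intro v v' w
        rw [← Finset.sum_add_distrib]
        exact Finset.sum_congr rfl fun j _ => by simp; ring)
    (by intro c v w
        rw [smul_eq_mul, Finset.mul_sum]
        exact Finset.sum_congr rfl fun j _ => by simp; ring)
    (by intro v w w'
        rw [← Finset.sum_add_distrib]
        exact Finset.sum_congr rfl fun j _ => by simp; ring)
    (by intro c v w
        rw [smul_eq_mul, Finset.mul_sum]
        exact Finset.sum_congr rfl fun j _ => by simp; ring)

namespace LiouvilleData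

variable {I M}

/-- The `n`-stabilization `(M × ℂⁿ, ω ⊕ (dp ∧ dq), L ⊕ ½ (p ∂/∂p + q ∂/∂q))`; the flow of the
second field is `z ↦ e^{t/2} z`. -/
def stabilization (D : LiouvilleData I M) (n : ℕ) :
    LiouvilleData (I.prod 𝓘(ℝ, Cn n)) (M × Cn n) where
  symp := fun p =>
    LinearMap.compl₁₂ (D.symp p.1) (LinearMap.fst ℝ (TangentSpace I p.1) (Cn n))
        (LinearMap.fst ℝ (TangentSpace I p.1) (Cn n)) +
      LinearMap.compl₁₂ (stdSymplectic n) (LinearMap.snd ℝ (TangentSpace I p.1) (Cn n))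
        (LinearMap.snd ℝ (TangentSpace I p.1) (Cn n))
  L := fun p => ((D.L p.1, (1 / 2 : ℝ) • p.2) : TangentSpace I p.1 × Cn n)
  flow := fun t p => (D.flow t p.1, Real.exp (t / 2) • p.2)

end LiouvilleData

end Liouville

/-! ## Contact isotopies and orderability -/

section Contact

variable {E : Type u} [NormedAddCommGroup E] [NormedSpace ℝ E]
  {H : Type v} [TopologicalSpace H] {I : ModelWithCorners ℝ E H}
  {Q : Type w} [TopologicalSpace Q] [ChartedSpace H Q]

/-- `Φ` is a smooth family, with parameter in `K`, of contactomorphisms of `(Q, ker β)`, and `Ψ` is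
the family of their inverses. -/
structure IsContactFamily (β : CovectorField I (M := Q))
    {T : Type*} [NormedAddCommGroup T] [NormedSpace ℝ T] (K : Set T) (Φ Ψ : T → Q → Q) : Prop where
  smooth : ContMDiffOn (𝓘(ℝ, T).prod I) I ∞ (fun p : T × Q => Φ p.1 p.2) (K ×ˢ univ)
  smooth_inv : ContMDiffOn (𝓘(ℝ, T).prod I) I ∞ (fun p : T × Q => Ψ p.1 p.2) (K ×ˢ univ)
  left_inv : ∀ t ∈ K, ∀ q, Ψ t (Φ t q) = q
  right_inv : ∀ t ∈ K, ∀ q, Φ t (Ψ t q) = q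
  contact : ∀ t ∈ K, ∀ (q : Q) (v : TangentSpace I q),
    β (Φ t q) (mfderiv I I (Φ t) q v) = 0 ↔ β q v = 0

section aux

variable {β : CovectorField I (M := Q)} {T : Type*} [NormedAddCommGroup T] [NormedSpace ℝ T]
  {K : Set T} {Φ Ψ Φ' Ψ' : T → Q → Q}

theorem slice_contMDiff (h : ContMDiffOn (𝓘(ℝ, T).prod I) I ∞
    (fun p : T × Q => Φ p.1 p.2) (K ×ˢ univ)) {t : T} (ht : t ∈ K) : ContMDiff I I ∞ (Φ t) := by
  have h1 : ContMDiff I (𝓘(ℝ, T).prod I) ∞ (fun q : Q => (t, q)) :=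
    contMDiff_const.prodMk contMDiff_id
  rw [← contMDiffOn_univ]
  exact h.comp (contMDiffOn_univ.2 h1) (fun q _ => ⟨ht, mem_univ _⟩)

theorem family_comp_smooth
    (h : ContMDiffOn (𝓘(ℝ, T).prod I) I ∞ (fun p : T × Q => Φ p.1 p.2) (K ×ˢ univ))
    (h' : ContMDiffOn (𝓘(ℝ, T).prod I) I ∞ (fun p : T × Q => Φ' p.1 p.2) (K ×ˢ univ)) :
    ContMDiffOn (𝓘(ℝ, T).prod I) I ∞ (fun p : T × Q => Φ p.1 (Φ' p.1 p.2)) (K ×ˢ univ) :=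
  h.comp (contMDiffOn_fst.prodMk h') (fun _ hp => ⟨hp.1, mem_univ _⟩)

theorem IsContactFamily.comp (h : IsContactFamily β K Φ Ψ) (h' : IsContactFamily β K Φ' Ψ') :
    IsContactFamily β K (fun t q => Φ t (Φ' t q)) (fun t q => Ψ' t (Ψ t q)) where
  smooth := family_comp_smooth h.smooth h'.smooth
  smooth_inv := family_comp_smooth h'.smooth_inv h.smooth_inv
  left_inv t ht q := by rw [h.left_inv t ht, h'.left_inv t ht]
  right_inv t ht q := by rw [h'.right_inv t ht, h.right_inv t ht]
  contact t ht q v := by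
    have e : mfderiv I I (fun q => Φ t (Φ' t q)) q =
        (mfderiv I I (Φ t) (Φ' t q)).comp (mfderiv I I (Φ' t) q) :=
      mfderiv_comp q ((slice_contMDiff h.smooth ht).mdifferentiableAt (by simp))
        ((slice_contMDiff h'.smooth ht).mdifferentiableAt (by simp))
    rw [e]
    exact (h.contact t ht _ _).trans (h'.contact t ht q v)

theorem IsContactFamily.symm (h : IsContactFamily β K Φ Ψ) : IsContactFamily β K Ψ Φ where
  smooth := h.smooth_inv
  smooth_inv := h.smooth
  left_inv := h.right_inv
  right_inv := h.left_inv
  contact t ht q v := by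
    have e : mfderiv I I (fun q => Φ t (Ψ t q)) q =
        (mfderiv I I (Φ t) (Ψ t q)).comp (mfderiv I I (Ψ t) q) :=
      mfderiv_comp q ((slice_contMDiff h.smooth ht).mdifferentiableAt (by simp))
        ((slice_contMDiff h.smooth_inv ht).mdifferentiableAt (by simp))
    have e' : (fun q => Φ t (Ψ t q)) = id := funext (h.right_inv t ht)
    rw [← h.contact t ht (Ψ t q) (mfderiv I I (Ψ t) q v)]
    have key : ∀ (f : Q → Q), f = id →
        (β (f q) (mfderiv I I f q v) = 0 ↔ β q v = 0) := by
      rintro f rfl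
      rw [mfderiv_id]
      rfl
    have := key _ e'
    rw [e] at this
    exact this

end aux

/-- A smooth path of contactomorphisms of `(Q, ker β)`, parametrized by `[0, 1]` and starting at
the identity (only the values for times in `[0, 1]` matter). -/
structure ContactPath (β : CovectorField I (M := Q)) where
  /-- the path -/
  toFun : ℝ → Q → Q
  /-- the path of the inverse contactomorphisms -/
  invFun : ℝ → Q → Q
  family : IsContactFamily β (Icc (0 : ℝ) 1) toFun invFun
  map_zero : ∀ q, toFun 0 q = q

namespace ContactPath

variable {β : CovectorField I (M := Q)}

/-- The path `t ↦ f_t ∘ g_t`. -/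
def mul (f g : ContactPath β) : ContactPath β where
  toFun t q := f.toFun t (g.toFun t q)
  invFun t q := g.invFun t (f.invFun t q)
  family := f.family.comp g.family
  map_zero q := by rw [g.map_zero, f.map_zero]

/-- The path `t ↦ (f_t)⁻¹`. -/
def inv (f : ContactPath β) : ContactPath β where
  toFun := f.invFun
  invFun := f.toFun
  family := f.family.symm
  map_zero q := by
    have h := f.family.left_inv 0 ⟨le_rfl, zero_le_one⟩ q
    rwa [f.map_zero] at h

/-- Smooth homotopy of paths of contactomorphisms with fixed end points. -/
def Homotopic (f g : ContactPath β) : Prop :=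
  ∃ F G : ℝ × ℝ → Q → Q,
    IsContactFamily β (Icc (0 : ℝ) 1 ×ˢ Icc (0 : ℝ) 1) F G ∧
    (∀ t ∈ Icc (0 : ℝ) 1, ∀ q, F (0, t) q = f.toFun t q) ∧
    (∀ t ∈ Icc (0 : ℝ) 1, ∀ q, F (1, t) q = g.toFun t q) ∧
    (∀ s ∈ Icc (0 : ℝ) 1, ∀ q, F (s, 0) q = q) ∧
    (∀ s ∈ Icc (0 : ℝ) 1, ∀ q, F (s, 1) q = f.toFun 1 q)

/-- The path is generated by a non-negative contact Hamiltonian: every point moves in the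
non-negative direction with respect to the contact structure. (The contact Hamiltonian, restricted
to the graph of `β`, is `β` of the velocity.) -/
def IsNonneg (f : ContactPath β) : Prop :=
  ∀ t ∈ Icc (0 : ℝ) 1, ∀ q,
    0 ≤ β (f.toFun t q)
      (mfderivWithin 𝓘(ℝ, ℝ) I (fun τ : ℝ => f.toFun τ q) (Icc (0 : ℝ) 1) t (1 : ℝ))

end ContactPath

/-- The universal cover of the identity component of the group of contactomorphisms of the closed
manifold `(Q, ker β)`: paths starting at the identity up to homotopy with fixed end points. -/
def ContUniversalCover (β : CovectorField I (M := Q)) : Type _ :=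
  Quot (ContactPath.Homotopic (β := β))

/-- The relation `a ⪰ b` on the universal cover: `a b⁻¹` is represented by a path generated by a
non-negative contact Hamiltonian. -/
def ContUniversalCover.Ge {β : CovectorField I (M := Q)} (a b : ContUniversalCover β) : Prop :=
  ∃ f g h : ContactPath β, Quot.mk _ f = a ∧ Quot.mk _ g = b ∧ h.IsNonneg ∧
    (Quot.mk _ h : ContUniversalCover β) = Quot.mk _ (f.mul g.inv)

/-- The closed contact manifold `(Q, ker β)`, cooriented by `β`, is orderable: the (reflexive and
transitive) relation `⪰` is a genuine partial order, that is, it is antisymmetric. -/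
def IsOrderable (β : CovectorField I (M := Q)) : Prop :=
  ∀ a b : ContUniversalCover β, a.Ge b → b.Ge a → a = b

end Contact

/-! ## The ideal contact boundary and its symplectization -/

section Boundary

variable {E : Type*} [NormedAddCommGroup E] [NormedSpace ℝ E]
  {H : Type*} [TopologicalSpace H] {I : ModelWithCorners ℝ E H}
  {M : Type*} [TopologicalSpace M] [ChartedSpace H M]

namespace LiouvilleData

/-- `ι` identifies the manifold `Q` with the smooth hypersurface `P` of `M`. -/
structure IsParametrization {F : Type*} [NormedAddCommGroup F] [NormedSpace ℝ F]
    {G : Type*} [TopologicalSpace G] (J : ModelWithCorners ℝ F G)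
    {Q : Type*} [TopologicalSpace Q] [ChartedSpace G Q] (I : ModelWithCorners ℝ E H)
    (ι : Q → M) (P : Set M) : Prop where
  smooth : ContMDiff J I ∞ ι
  injective : Function.Injective ι
  immersion : ∀ q, Function.Injective (mfderiv J I ι q)
  codimension : Module.finrank ℝ F + 1 = Module.finrank ℝ E
  range_eq : range ι = P

/-- The contact form `ι^* α` on a parametrized starshaped hypersurface. -/
def boundaryForm {F : Type*} [NormedAddCommGroup F] [NormedSpace ℝ F]
    {G : Type*} [TopologicalSpace G] (J : ModelWithCorners ℝ F G)
    {Q : Type*} [TopologicalSpace Q] [ChartedSpace G Q] (D : LiouvilleData I M) (ι : Q → M) :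
    CovectorField J (M := Q) :=
  fun q => (D.α (ι q)).comp (mfderiv J I ι q).toLinearMap

/-- `Φ` is a smooth family, with parameter in `K`, of `ℝ₊`-equivariant symplectomorphisms of the
subset `S` of `M`, and `Ψ` is the family of their inverses. The values outside `S` play no role. -/
structure IsEquivariantFamily (D : LiouvilleData I M) (S : Set M)
    {T : Type*} [NormedAddCommGroup T] [NormedSpace ℝ T] (K : Set T) (Φ Ψ : T → M → M) : Prop where
  smooth : ContMDiffOn (𝓘(ℝ, T).prod I) I ∞ (fun p : T × M => Φ p.1 p.2) (K ×ˢ S)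
  smooth_inv : ContMDiffOn (𝓘(ℝ, T).prod I) I ∞ (fun p : T × M => Ψ p.1 p.2) (K ×ˢ S)
  mapsTo : ∀ t ∈ K, MapsTo (Φ t) S S
  mapsTo_inv : ∀ t ∈ K, MapsTo (Ψ t) S S
  left_inv : ∀ t ∈ K, ∀ x ∈ S, Ψ t (Φ t x) = x
  right_inv : ∀ t ∈ K, ∀ x ∈ S, Φ t (Ψ t x) = x
  equivariant : ∀ t ∈ K, ∀ x ∈ S, ∀ r : ℝ, Φ t (D.flow r x) = D.flow r (Φ t x)
  symplectic : ∀ t ∈ K, ∀ x ∈ S, ∀ v w : TangentSpace I x,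
    D.symp (Φ t x) (mfderiv I I (Φ t) x v) (mfderiv I I (Φ t) x w) = D.symp x v w

/-- `φ` is a loop, with parameter `t ∈ ℝ/ℤ`, of `ℝ₊`-equivariant symplectomorphisms of `S`, based
at the identity, which is positive: the equivariant Hamiltonian generating it, namely the value of
`α` on the velocity, is positive. -/
structure IsPositiveLoop (D : LiouvilleData I M) (S : Set M) (φ : ℝ → M → M) : Prop where
  family : ∃ ψ : ℝ → M → M, D.IsEquivariantFamily S univ φ ψ
  map_zero : ∀ x ∈ S, φ 0 x = x
  periodic : ∀ t, ∀ x ∈ S, φ (t + 1) x = φ t x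
  positive : ∀ t, ∀ x ∈ S,
    0 < D.α (φ t x) (mfderiv 𝓘(ℝ, ℝ) I (fun τ : ℝ => φ τ x) t (1 : ℝ))

/-- The loop `φ` of `ℝ₊`-equivariant symplectomorphisms of `S` is contractible: it is smoothly
homotopic to the constant loop through loops of `ℝ₊`-equivariant symplectomorphisms based at the
identity. -/
def IsContractibleLoop (D : LiouvilleData I M) (S : Set M) (φ : ℝ → M → M) : Prop :=
  ∃ F G : ℝ × ℝ → M → M,
    D.IsEquivariantFamily S (Icc (0 : ℝ) 1 ×ˢ univ) F G ∧
    (∀ t, ∀ x ∈ S, F (0, t) x = x) ∧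
    (∀ t, ∀ x ∈ S, F (1, t) x = φ t x) ∧
    (∀ s ∈ Icc (0 : ℝ) 1, ∀ x ∈ S, F (s, 0) x = x) ∧
    (∀ s ∈ Icc (0 : ℝ) 1, ∀ t, ∀ x ∈ S, F (s, t + 1) x = F (s, t) x)

end LiouvilleData

/-- The rotation `(x, z) ↦ (x, e^{2πit} z)` of `M × ℂⁿ`. -/
def rotE {M : Type*} {n : ℕ} (t : ℝ) (p : M × Cn n) : M × Cn n :=
  (p.1, Complex.exp (2 * Real.pi * t * Complex.I) • p.2)

/-- The unitary loop `(x, z₁, w) ↦ (x, e^{2πi(n-1)t} z₁, e^{-2πit} w)` of `M × ℂⁿ`, where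
`z = (z₁, w)` and `w = (z₂, …, z_n)`. -/
def rotF {M : Type*} {n : ℕ} (t : ℝ) (p : M × Cn n) : M × Cn n :=
  (p.1, WithLp.toLp 2 fun j : Fin n =>
    if j.val = 0 then Complex.exp (2 * Real.pi * ((n : ℂ) - 1) * t * Complex.I) * p.2 j
    else Complex.exp (-(2 * Real.pi * t * Complex.I)) * p.2 j)

end Boundary

end

set_option linter.unusedSectionVars false

noncomputable section

/-! ## Smooth dependence of solutions of differential equations -/

section SmoothFlow

open Filter Topology

universe uu

variable {X : Type*} [TopologicalSpace X] [CompactSpace X]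
  {E F : Type uu} [NormedAddCommGroup E] [NormedSpace ℝ E]
  [NormedAddCommGroup F] [NormedSpace ℝ F]

/-! Put `n = k + 1` with `k ≥ 1` and split M × ℂⁿ as N × ℂ, where N = M × ℂᵏ has points y = (x, w)
and the last factor carries z₁. An equivariant symplectomorphism preserves both ω and L, hence the
Liouville form α. So α of the velocity, which is the Hamiltonian of an equivariant isotopy, is
additive along compositions (`α_curve`). The rotation e_t has Hamiltonian π|z|², and f_t has
π(k|z₁|² - |w|²). With p = e_t a⁻¹x, the Hamiltonian of φ_t at φ_t(x) is therefore π times |z(p)|² +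
(3k - 1)|z₁(ap)|² - 4|w(ap)|². For a = 1 this is negative wherever z₁ = 0 and w ≠ 0. The map a has
to be chosen so that z₁(p) and z₁(ap) are never both small compared with w(ap).

Fix a starshaped hypersurface of N, let τ be the time at which the Liouville flow leads from it to
y, and let G be its Reeb flow extended equivariantly. By compactness |w|² ≤ C e^τ off the core of N
(`exists_norm_sq_le`). The normalized coordinate ζ = e^{-τ/2} z₁ is constant along the Liouville
flow. A compactly supported area-preserving isotopy ψ_s of the plane moves the disc of radius 2√C
off itself, so that |ζ|² + 2|ψ₁(ζ)|² > 4C for every ζ (`exists_twist`). With λ the standard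
primitive of the area form and dT_s = λ - ψ_s^*λ, the map a^{(s)}(y, z₁) = (G_{T_s(ζ)} y, e^{τ/2}
ψ_s(ζ)) preserves α, because the Reeb flow contributes e^τ dT_s and the plane loses exactly that
amount (`α_twistMap`). Near the core of N, away from z₁ = 0, ζ leaves the support of ψ_s, so a^{(s)}
extends by the identity to the complement of the core of M × ℂⁿ. Since τ is preserved by a, the
displacement inequality gives positivity (`twistMap_estimate`).

The loop f_{3t} consists of diagonal matrices of determinant one and is contracted explicitly by
linear symplectic maps V(s, t) (`exists_isContractibleLinearLoop`). The maps e_{-t} V(s, t) a^{(s)}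
e_t (a^{(s)})⁻¹ then contract φ.

A positive contractible loop excludes orderability (`not_isOrderable_boundaryForm`). The piece of
the loop over [0, t₀] is ⪰ the identity. Its inverse is homotopic to the remaining piece, which is
non-negative too, so the identity is ⪰ the first piece. Antisymmetry would force φ_{t₀} to act
trivially on the boundary for all t₀ in (0, 1), contradicting its positive velocity.

The Reeb flow comes from a compactly supported Hamiltonian. It rests on smooth dependence for flows
(`exists_contDiffAt_curve`, `exists_global_flow`) and on Cartan's formula (`hasDerivAt_pullback`).
-/

/-- Pointwise application of a continuous family of operators, as a bounded operator. -/
def pointwiseApply : C(X, E →L[ℝ] F) →L[ℝ] (C(X, E) →L[ℝ] C(X, F)) :=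
  LinearMap.mkContinuous₂
    (LinearMap.mk₂ ℝ (fun (A : C(X, E →L[ℝ] F)) (η : C(X, E)) =>
        (⟨fun x => A x (η x), by fun_prop⟩ : C(X, F)))
      (by intros; ext; simp) (by intros; ext; simp) (by intros; ext; simp) (by intros; ext; simp))
    1 (by
      intro A η
      rw [ContinuousMap.norm_le _ (by positivity)]
      intro x
      simp only [LinearMap.mk₂_apply, ContinuousMap.coe_mk, one_mul]
      exact ((A x).le_opNorm _).trans
        (mul_le_mul (A.norm_coe_le_norm x) (η.norm_coe_le_norm x) (norm_nonneg _)
          (by positivity)))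

/-- In finite dimension the closed ball of radius `‖γ‖ + 1` is compact, so `fderiv ℝ f` is uniformly
continuous on it. The mean value inequality then bounds the Taylor remainder by `ε * ‖h x‖` with one
`δ` for all `x`. -/
theorem hasFDerivAt_postcomp [FiniteDimensional ℝ E] {f : E → F} (hf : ContDiff ℝ 1 f)
    (γ : C(X, E)) :
    HasFDerivAt (fun η : C(X, E) => (⟨fun x => f (η x), hf.continuous.comp η.continuous⟩ : C(X, F)))
      (pointwiseApply (⟨fun x => fderiv ℝ f (γ x),
        (hf.continuous_fderiv (by simp)).comp γ.continuous⟩ : C(X, E →L[ℝ] F))) γ := by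
  rw [hasFDerivAt_iff_isLittleO_nhds_zero, Asymptotics.isLittleO_iff]
  intro ε hε
  have hK : IsCompact (Metric.closedBall (0 : E) (‖γ‖ + 1)) := isCompact_closedBall _ _
  have huc := hK.uniformContinuousOn_of_continuous
    (hf.continuous_fderiv (by simp)).continuousOn
  rw [Metric.uniformContinuousOn_iff] at huc
  obtain ⟨δ, hδ, huc⟩ := huc ε hε
  filter_upwards [Metric.ball_mem_nhds (0 : C(X, E)) (lt_min hδ one_pos)] with h hh
  rw [mem_ball_zero_iff, lt_min_iff] at hh
  rw [ContinuousMap.norm_le _ (by positivity)]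
  intro x
  have hx : ‖h x‖ ≤ ‖h‖ := h.norm_coe_le_norm x
  have hγx : ‖γ x‖ ≤ ‖γ‖ := γ.norm_coe_le_norm x
  have key := (convex_segment (𝕜 := ℝ) (γ x) (γ x + h x)).norm_image_sub_le_of_norm_hasFDerivWithin_le'
    (f := f) (f' := fderiv ℝ f) (φ := fderiv ℝ f (γ x)) (C := ε)
    (fun y _ => (hf.differentiable (by simp) y).hasFDerivAt.hasFDerivWithinAt)
    (by
      intro y hy
      have hd : dist y (γ x) ≤ ‖h x‖ := by
        have := (convex_closedBall (γ x) ‖h x‖).segment_subset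
          (Metric.mem_closedBall_self (norm_nonneg _)) (by simp) hy
        simpa using this
      have hy' : ‖y‖ ≤ ‖γ‖ + 1 := by
        have : ‖y‖ ≤ ‖y - γ x‖ + ‖γ x‖ := by simpa using norm_add_le (y - γ x) (γ x)
        rw [← dist_eq_norm] at this
        linarith [hh.2]
      have := huc y (by simpa using hy') (γ x) (by simp; linarith) (by linarith [hh.1])
      rw [dist_eq_norm] at this
      exact this.le)
    (left_mem_segment ℝ _ _) (right_mem_segment ℝ _ _)
  simp only [add_sub_cancel_left] at key
  calc _ = ‖f (γ x + h x) - f (γ x) - (fderiv ℝ f (γ x)) (h x)‖ := rfl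
    _ ≤ ε * ‖h x‖ := key
    _ ≤ ε * ‖h‖ := by gcongr

/-- The derivative of postcomposition with `f` is postcomposition with `fderiv ℝ f`, followed by a
bounded operator. The induction changes the target to `E →L[ℝ] F`, so `F` is quantified inside it
and shares the universe of `E`. -/
theorem contDiff_postcomp [FiniteDimensional ℝ E] (n : ℕ) :
    ∀ {F : Type uu} [NormedAddCommGroup F] [NormedSpace ℝ F] {f : E → F} (hf : ContDiff ℝ n f),
    ContDiff ℝ n (fun η : C(X, E) =>
      (⟨fun x => f (η x), hf.continuous.comp η.continuous⟩ : C(X, F))) := by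
  induction n with
  | zero =>
    intro F _ _ f hf
    simp only [Nat.cast_zero, contDiff_zero]
    exact ContinuousMap.continuous_postcomp ⟨f, hf.continuous⟩
  | succ n ih =>
    intro F _ _ f hf
    have h1 : ContDiff ℝ 1 f := hf.of_le (by simp)
    have hd : ContDiff ℝ n (fderiv ℝ f) := (contDiff_succ_iff_fderiv.1 (by exact_mod_cast hf)).2.2
    push_cast
    rw [contDiff_succ_iff_hasFDerivAt]
    have hp : ContDiff ℝ n (fun A : C(X, E →L[ℝ] F) => pointwiseApply A) :=
      ContinuousLinearMap.contDiff _
    refine ⟨fun η => pointwiseApply ⟨fun x => fderiv ℝ f (η x), hd.continuous.comp η.continuous⟩,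
      hp.comp (ih hd), fun η => hasFDerivAt_postcomp h1 η⟩

/-- Curves live on `[-2, 2]` so that the time `1`, at which they are evaluated, is an interior
point. -/
theorem neg_two_le_two : (-2 : ℝ) ≤ 2 := by norm_num

/-- The primitive vanishing at `0` of a curve on `[-2, 2]`, as a bounded operator. -/
def primitiveOp [CompleteSpace E] : C(Icc (-2 : ℝ) 2, E) →L[ℝ] C(Icc (-2 : ℝ) 2, E) :=
  LinearMap.mkContinuous
    { toFun := fun γ => ⟨fun t => ∫ σ in (0 : ℝ)..t.1, γ (projIcc (-2) 2 neg_two_le_two σ),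
        (intervalIntegral.continuous_primitive
          (fun a b => (γ.continuous.comp continuous_projIcc).intervalIntegrable a b) 0).comp
          continuous_subtype_val⟩
      map_add' := by
        intro γ η
        ext t
        simp only [ContinuousMap.coe_mk, ContinuousMap.add_apply]
        exact intervalIntegral.integral_add
          ((γ.continuous.comp continuous_projIcc).intervalIntegrable _ _)
          ((η.continuous.comp continuous_projIcc).intervalIntegrable _ _)
      map_smul' := by
        intro c γ
        ext t
        simp [intervalIntegral.integral_smul] }
    2 (by
      intro γ
      rw [ContinuousMap.norm_le _ (by positivity)]
      intro t
      refine (intervalIntegral.norm_integral_le_of_norm_le_const (C := ‖γ‖)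
        fun σ _ => γ.norm_coe_le_norm _).trans ?_
      rw [sub_zero, mul_comm]
      exact mul_le_mul_of_nonneg_right (abs_le.2 t.2) (norm_nonneg _))

/-- The constant curves, as a bounded operator. -/
def constCurve : E →L[ℝ] C(X, E) :=
  LinearMap.mkContinuous
    { toFun := fun x => ContinuousMap.const X x
      map_add' := fun _ _ => rfl
      map_smul' := fun _ _ => rfl } 1 (by
    intro x
    rw [ContinuousMap.norm_le _ (by positivity)]
    intro t
    exact (one_mul ‖x‖).ge)

/-- Solutions of `γ' = ε f(γ)`, `γ(0) = x` on `[-2, 2]` exist for `(ε, x)` near `(0, x₀)` and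
depend smoothly on `(ε, x)`. -/
theorem exists_contDiffAt_curve [FiniteDimensional ℝ E] (n : ℕ) (hn : n ≠ 0) {f : E → E}
    (hf : ContDiff ℝ n f) (x₀ : E) :
    ∃ Γ : ℝ × E → C(Icc (-2 : ℝ) 2, E), ContDiffAt ℝ n Γ (0, x₀) ∧
      Γ (0, x₀) = constCurve x₀ ∧
      ∀ᶠ p in 𝓝 ((0 : ℝ), x₀), ∀ s : Icc (-2 : ℝ) 2,
        Γ p s = p.2 + p.1 • ∫ σ in (0 : ℝ)..s.1, f (Γ p (projIcc (-2) 2 neg_two_le_two σ)) := by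
  have : CompleteSpace E := FiniteDimensional.complete ℝ E
  let N : C(Icc (-2 : ℝ) 2, E) → C(Icc (-2 : ℝ) 2, E) := fun η =>
    ⟨fun x => f (η x), hf.continuous.comp η.continuous⟩
  have hN : ContDiff ℝ n N := contDiff_postcomp n hf
  -- A curve solves the integral equation η = x + ε ∫ f(η) exactly when the second component of `G`
  -- vanishes. Keeping the parameters as first component turns the implicit function theorem into
  -- the inverse function theorem.
  let G : (ℝ × E) × C(Icc (-2 : ℝ) 2, E) → (ℝ × E) × C(Icc (-2 : ℝ) 2, E) := fun q =>
    (q.1, q.2 - constCurve q.1.2 - q.1.1 • primitiveOp (N q.2))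
  have hG : ContDiff ℝ n G := by
    refine contDiff_fst.prodMk ((contDiff_snd.sub ((constCurve (E := E)).contDiff.comp
      (contDiff_snd.comp contDiff_fst))).sub ((contDiff_fst.comp contDiff_fst).smul
      ((primitiveOp (E := E)).contDiff.comp (hN.comp contDiff_snd))))
  let a : (ℝ × E) × C(Icc (-2 : ℝ) 2, E) := ((0, x₀), constCurve x₀)
  let c : C(Icc (-2 : ℝ) 2, E) := primitiveOp (N (constCurve x₀))
  let T : (ℝ × E) →L[ℝ] C(Icc (-2 : ℝ) 2, E) :=
    constCurve ∘L ContinuousLinearMap.snd ℝ ℝ E + (ContinuousLinearMap.fst ℝ ℝ E).smulRight c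
  -- At `ε = 0` the nonlinear term enters only through the variation of `ε`. The derivative is thus
  -- the triangular map (p, η) ↦ (p, η - T p), with explicit inverse.
  let e : ((ℝ × E) × C(Icc (-2 : ℝ) 2, E)) ≃L[ℝ] ((ℝ × E) × C(Icc (-2 : ℝ) 2, E)) :=
    ContinuousLinearEquiv.equivOfInverse
      ((ContinuousLinearMap.fst ℝ _ _).prod
        (ContinuousLinearMap.snd ℝ _ _ - T ∘L ContinuousLinearMap.fst ℝ _ _))
      ((ContinuousLinearMap.fst ℝ _ _).prod
        (ContinuousLinearMap.snd ℝ _ _ + T ∘L ContinuousLinearMap.fst ℝ _ _))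
      (fun q => by ext <;> simp) (fun q => by ext <;> simp)
  have hGd : HasFDerivAt G (e : _ →L[ℝ] _) a := by
    have h1 : HasFDerivAt (fun q : (ℝ × E) × C(Icc (-2 : ℝ) 2, E) => q.1.1)
        (ContinuousLinearMap.fst ℝ ℝ E ∘L ContinuousLinearMap.fst ℝ _ _) a :=
      HasFDerivAt.comp (g := Prod.fst) a hasFDerivAt_fst hasFDerivAt_fst
    have h2 : DifferentiableAt ℝ (fun q : (ℝ × E) × C(Icc (-2 : ℝ) 2, E) => primitiveOp (N q.2)) a :=
      (((primitiveOp (E := E)).contDiff.comp (hN.comp contDiff_snd)).differentiable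
        (by exact_mod_cast hn)) a
    have h3 := h1.smul h2.hasFDerivAt
    have h4 : HasFDerivAt (fun q : (ℝ × E) × C(Icc (-2 : ℝ) 2, E) => constCurve q.1.2)
        (constCurve ∘L ContinuousLinearMap.snd ℝ ℝ E ∘L ContinuousLinearMap.fst ℝ _ _) a :=
      ContinuousLinearMap.hasFDerivAt ((constCurve : E →L[ℝ] C(Icc (-2 : ℝ) 2, E)) ∘L
        ContinuousLinearMap.snd ℝ ℝ E ∘L
        ContinuousLinearMap.fst ℝ (ℝ × E) C(Icc (-2 : ℝ) 2, E))
    refine (hasFDerivAt_fst.prodMk ((hasFDerivAt_snd.sub h4).sub h3)).congr_fderiv ?_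
    refine ContinuousLinearMap.ext fun q => ?_
    simp [e, T, a, c, sub_sub]
  have hn1 : (n : WithTop ℕ∞) ≠ 0 := by exact_mod_cast hn
  have hGa : G a = ((0, x₀), 0) := by simp [G, a]
  let S := hG.contDiffAt.localInverse hGd hn1
  have hS : ContDiffAt ℝ n S ((0, x₀), 0) := by
    have := hG.contDiffAt.to_localInverse hGd hn1
    rwa [hGa] at this
  have hSa : S ((0, x₀), 0) = a := by
    have := hG.contDiffAt.localInverse_apply_image hGd hn1
    rwa [hGa] at this
  have hright : ∀ᶠ q in 𝓝 (((0 : ℝ), x₀), (0 : C(Icc (-2 : ℝ) 2, E))), G (S q) = q := by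
    have := (hG.contDiffAt (x := a).hasStrictFDerivAt' hGd hn1).eventually_right_inverse
    rwa [hGa] at this
  have hinc : ContinuousAt (fun p : ℝ × E => (p, (0 : C(Icc (-2 : ℝ) 2, E)))) (0, x₀) := by fun_prop
  refine ⟨fun p => (S (p, 0)).2, ?_, ?_, ?_⟩
  · exact contDiffAt_snd.comp _ (hS.comp (0, x₀) (contDiffAt_id.prodMk contDiffAt_const))
  · simp only [hSa]; rfl
  · filter_upwards [hinc.eventually hright] with p hp s
    have h1 : (S (p, 0)).1 = p := congrArg Prod.fst hp
    have h2 : (S (p, 0)).2 - constCurve (S (p, 0)).1.2 -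
        (S (p, 0)).1.1 • primitiveOp (N (S (p, 0)).2) = 0 := congrArg Prod.snd hp
    rw [h1, sub_sub, sub_eq_zero] at h2
    have h3 := congrArg (fun g : C(Icc (-2 : ℝ) 2, E) => g s) h2
    exact h3

end SmoothFlow

/-! ## Flows of vector fields on manifolds -/

section ManifoldFlow

open Filter Topology

universe uu

variable {E : Type uu} [NormedAddCommGroup E] [NormedSpace ℝ E]
  {H : Type*} [TopologicalSpace H] {I : ModelWithCorners ℝ E H}
  {M : Type*} [TopologicalSpace M] [ChartedSpace H M] [IsManifold I ∞ M]
  {E' : Type*} [NormedAddCommGroup E'] [NormedSpace ℝ E']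
  {H' : Type*} [TopologicalSpace H'] {I' : ModelWithCorners ℝ E' H'}
  {M' : Type*} [TopologicalSpace M'] [ChartedSpace H' M'] [IsManifold I' ∞ M']
  {F : Type*} [NormedAddCommGroup F] [NormedSpace ℝ F]

/-- The derivative of a smooth map along a smooth vector field is a smooth field along the map. -/
theorem contMDiffOn_mfderiv_section {f : M → M'} {s : Set M} (hs : IsOpen s)
    (hf : ContMDiffOn I I' ∞ f s) {v : ∀ x : M, TangentSpace I x}
    (hv : ContMDiffOn I I.tangent ∞ (fun x => (⟨x, v x⟩ : TangentBundle I M)) s) :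
    ContMDiffOn I I'.tangent ∞
      (fun x => (⟨f x, mfderiv I I' f x (v x)⟩ : TangentBundle I' M')) s := by
  have h1 := (hf.contMDiffOn_tangentMapWithin (m := ∞) le_rfl hs.uniqueMDiffOn).comp hv
    (fun x hx => hx)
  refine h1.congr fun x hx => ?_
  simp only [Function.comp_apply, tangentMapWithin, mfderivWithin_of_isOpen hs hx]

theorem contMDiffOn_mfderiv_apply {f : M → F} {s : Set M} (hs : IsOpen s)
    (hf : ContMDiffOn I 𝓘(ℝ, F) ∞ f s) {v : ∀ x : M, TangentSpace I x}
    (hv : ContMDiffOn I I.tangent ∞ (fun x => (⟨x, v x⟩ : TangentBundle I M)) s) :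
    ContMDiffOn I 𝓘(ℝ, F) ∞ (fun x => (mfderiv I 𝓘(ℝ, F) f x (v x) : F)) s :=
  (contMDiff_snd_tangentBundle_modelSpace F 𝓘(ℝ, F)).comp_contMDiffOn
    (contMDiffOn_mfderiv_section hs hf hv)

/-- The expression of a vector field in the preferred chart at `x₀`. -/
def chartField (v : ∀ x : M, TangentSpace I x) (x₀ : M) (y : E) : E :=
  mfderiv I 𝓘(ℝ, E) (extChartAt I x₀) ((extChartAt I x₀).symm y) (v ((extChartAt I x₀).symm y))

theorem contDiffOn_chartField [I.Boundaryless] {v : ∀ x : M, TangentSpace I x}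
    (hv : ContMDiff I I.tangent ∞ (fun x => (⟨x, v x⟩ : TangentBundle I M))) (x₀ : M) :
    ContDiffOn ℝ ∞ (chartField v x₀) (extChartAt I x₀).target := by
  rw [← contMDiffOn_iff_contDiffOn]
  have h1 := contMDiffOn_mfderiv_apply (isOpen_extChartAt_source (I := I) x₀)
    (contMDiffOn_extChartAt (x := x₀) (n := ∞) |>.mono (by rw [extChartAt_source])) hv.contMDiffOn
  exact h1.comp (contMDiffOn_extChartAt_symm x₀) fun y hy => (extChartAt I x₀).map_target hy

theorem mfderiv_extChartAt_symm_chartField [I.Boundaryless] (v : ∀ x : M, TangentSpace I x)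
    (x₀ : M) {y : E} (hy : y ∈ (extChartAt I x₀).target) :
    mfderiv 𝓘(ℝ, E) I (extChartAt I x₀).symm y (chartField (E := E) v x₀ y) =
      v ((extChartAt I x₀).symm y) := by
  have h := mfderivWithin_extChartAt_symm_comp_mfderiv_extChartAt (I := I) hy
  rw [I.range_eq_univ, mfderivWithin_univ] at h
  exact congrArg (fun A => A (v ((extChartAt I x₀).symm y))) h

/-- Curves of the rescaled vector field `t v` on `(-2, 2)` exist for small `t`, near any point,
and their values at time `1` depend smoothly on `t` and on the starting point. -/
theorem exists_local_curves [FiniteDimensional ℝ E] [I.Boundaryless]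
    {v : ∀ x : M, TangentSpace I x}
    (hv : ContMDiff I I.tangent ∞ (fun x => (⟨x, v x⟩ : TangentBundle I M))) (x₀ : M)
    (n : ℕ) (hn : n ≠ 0) :
    ∃ c : ℝ × M → ℝ → M,
      ContMDiffAt (𝓘(ℝ, ℝ).prod I) I n (fun p => c p 1) (0, x₀) ∧
      ∀ᶠ p in 𝓝 ((0 : ℝ), x₀), c p 0 = p.2 ∧
        IsMIntegralCurveOn (I := I) (c p) (p.1 • v) (Ioo (-2) 2) := by
  have : CompleteSpace E := FiniteDimensional.complete ℝ E
  let e := extChartAt I x₀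
  let y₀ := e x₀
  have hy₀ : y₀ ∈ e.target := (extChartAt I x₀).map_source (mem_extChartAt_source x₀)
  have ho : IsOpen e.target := isOpen_extChartAt_target x₀
  obtain ⟨r, hr, hball⟩ := Metric.isOpen_iff.1 ho y₀ hy₀
  -- The chart expression of the field is defined only on the target of the chart; the cut-off
  -- extends it to all of `E` and leaves it unchanged within distance `r / 4` of `y₀`.
  let χ : ContDiffBump y₀ := ⟨r / 4, r / 2, by positivity, by linarith⟩
  let f : E → E := fun y => χ y • chartField v x₀ y
  have hf : ContDiff ℝ n f := by
    refine contDiff_iff_contDiffAt.2 fun y => ?_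
    by_cases hy : y ∈ e.target
    · exact χ.contDiff.contDiffAt.smul
        ((((contDiffOn_chartField hv x₀).contDiffAt (ho.mem_nhds hy))).of_le
          (by exact_mod_cast le_top))
    · have hy' : y ∉ tsupport χ := by
        intro h
        rw [χ.tsupport_eq] at h
        exact hy (hball ((Metric.closedBall_subset_ball (by change r / 2 < r; linarith)) h))
      have h0 : f =ᶠ[𝓝 y] fun _ => 0 := by
        filter_upwards [(isClosed_tsupport χ).isOpen_compl.mem_nhds hy'] with z hz
        simp [f, image_eq_zero_of_notMem_tsupport hz]
      exact contDiffAt_const.congr_of_eventuallyEq h0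
  obtain ⟨Γ, hΓ, hΓ0, hΓe⟩ := exists_contDiffAt_curve n hn hf y₀
  have h0mem : (0 : ℝ) ∈ Icc (-2 : ℝ) 2 := by norm_num
  have h1mem : (1 : ℝ) ∈ Icc (-2 : ℝ) 2 := by norm_num
  let c : ℝ × M → ℝ → M := fun p s => e.symm (Γ (p.1, e p.2) (projIcc (-2) 2 neg_two_le_two s))
  have hcont : ContinuousAt (fun p : ℝ × M => ((p.1, e p.2) : ℝ × E)) (0, x₀) :=
    continuousAt_fst.prodMk (ContinuousAt.comp (g := e) (f := Prod.snd) (x := ((0 : ℝ), x₀))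
      (continuousAt_extChartAt x₀) continuousAt_snd)
  refine ⟨c, ?_, ?_⟩
  · have h1 : ContMDiffAt (𝓘(ℝ, ℝ).prod I) (𝓘(ℝ, ℝ × E)) n (fun p : ℝ × M => (p.1, e p.2))
        (0, x₀) := by
      exact contMDiffAt_fst.prodMk_space ((contMDiffAt_extChartAt (x := x₀)).comp
        (0, x₀) contMDiffAt_snd)
    have hev : ContDiffAt ℝ n (fun q : ℝ × E => Γ q ⟨1, h1mem⟩) (0, y₀) := by
      have : ContDiff ℝ n (fun g : C(Icc (-2 : ℝ) 2, E) => g ⟨1, h1mem⟩) :=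
        ContinuousLinearMap.contDiff
          (ContinuousMap.evalCLM ℝ (⟨1, h1mem⟩ : Icc (-2 : ℝ) 2) : C(Icc (-2 : ℝ) 2, E) →L[ℝ] E)
      exact this.contDiffAt.comp _ hΓ
    have h2 : ContMDiffAt (𝓘(ℝ, ℝ).prod I) 𝓘(ℝ, E) n
        (fun p : ℝ × M => Γ (p.1, e p.2) ⟨1, h1mem⟩) (0, x₀) :=
      ContMDiffAt.comp (g := fun q : ℝ × E => Γ q ⟨1, h1mem⟩) (0, x₀) hev.contMDiffAt h1
    have h3 : ContMDiffAt 𝓘(ℝ, E) I n e.symm (Γ (0, e x₀) ⟨1, h1mem⟩) := by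
      have : Γ (0, e x₀) ⟨1, h1mem⟩ = y₀ := by
        change Γ (0, y₀) _ = y₀
        rw [hΓ0]; rfl
      rw [this]
      exact ((contMDiffOn_extChartAt_symm (n := ∞) x₀).contMDiffAt (ho.mem_nhds hy₀)).of_le
        (by exact_mod_cast le_top)
    have h4 := h3.comp (0, x₀) h2
    refine h4.congr_of_eventuallyEq (Eventually.of_forall fun p => ?_)
    simp only [c, Function.comp_apply]
    rw [projIcc_of_mem _ h1mem]
  -- For parameters close to (0, y₀) the whole curve is uniformly close to the constant curve. It
  -- therefore stays where `χ = 1` and solves the original equation.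
  · have hnear : ∀ᶠ q in 𝓝 ((0 : ℝ), y₀), ‖Γ q - constCurve y₀‖ < r / 4 := by
      have hc : ContinuousAt (fun q => ‖Γ q - constCurve y₀‖) ((0 : ℝ), y₀) :=
        (hΓ.continuousAt.sub continuousAt_const).norm
      have : ‖Γ (0, y₀) - constCurve y₀‖ < r / 4 := by rw [hΓ0, sub_self, norm_zero]; linarith
      exact hc.eventually_lt continuousAt_const this
    have hsrc : ∀ᶠ p : ℝ × M in 𝓝 (0, x₀), p.2 ∈ e.source :=
      continuousAt_snd.eventually ((isOpen_extChartAt_source x₀).mem_nhds (mem_extChartAt_source x₀))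
    filter_upwards [hcont.eventually hΓe, hcont.eventually hnear, hsrc] with p hp hpn hps
    have hin : ∀ s, Γ (p.1, e p.2) s ∈ Metric.ball y₀ (r / 4) := by
      intro s
      rw [mem_ball_iff_norm]
      exact ((Γ (p.1, e p.2) - constCurve y₀).norm_coe_le_norm s).trans_lt hpn
    have htgt : ∀ s, Γ (p.1, e p.2) s ∈ e.target := fun s =>
      hball (Metric.ball_subset_ball (by linarith) (hin s))
    constructor
    · simp only [c]
      rw [hp]
      rw [projIcc_of_mem _ h0mem]
      simp only [intervalIntegral.integral_same, smul_zero, add_zero]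
      exact e.left_inv hps
    · intro s hs
      have hs' : s ∈ Icc (-2 : ℝ) 2 := ⟨hs.1.le, hs.2.le⟩
      let g : ℝ → E := fun s => Γ (p.1, e p.2) (projIcc (-2) 2 neg_two_le_two s)
      have hgc : Continuous g := (Γ (p.1, e p.2)).continuous.comp continuous_projIcc
      have hgd : HasDerivAt g (p.1 • f (g s)) s := by
        have hi : HasDerivAt (fun s => ∫ σ in (0 : ℝ)..s, f (g σ)) (f (g s)) s :=
          intervalIntegral.integral_hasDerivAt_right
            ((hf.continuous.comp hgc).intervalIntegrable _ _)
            ((hf.continuous.comp hgc).stronglyMeasurableAtFilter _ _)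
            (hf.continuous.comp hgc).continuousAt
        have hi2 := (hi.const_smul p.1).const_add (e p.2)
        refine hi2.congr_of_eventuallyEq ?_
        filter_upwards [Ioo_mem_nhds hs.1 hs.2] with σ hσ
        have hσ' : σ ∈ Icc (-2 : ℝ) 2 := ⟨hσ.1.le, hσ.2.le⟩
        simp only [g]
        rw [hp, projIcc_of_mem _ hσ']
        rfl
      have hgt : g s ∈ e.target := htgt _
      have hfg : f (g s) = chartField v x₀ (g s) := by
        have : χ (g s) = 1 := χ.one_of_mem_closedBall (Metric.ball_subset_closedBall (hin _))
        simp only [f, this, one_smul]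
      rw [hfg] at hgd
      have hsm : MDifferentiableAt 𝓘(ℝ, E) I e.symm (g s) :=
        ((contMDiffOn_extChartAt_symm (n := ∞) x₀).contMDiffAt
          (ho.mem_nhds hgt)).mdifferentiableAt (by simp)
      have hcomp := hsm.hasMFDerivAt.comp s hgd.hasFDerivAt.hasMFDerivAt
      refine (HasMFDerivAt.congr_mfderiv hcomp ?_).hasMFDerivWithinAt
      refine ContinuousLinearMap.ext_ring ?_
      have hk := mfderiv_extChartAt_symm_chartField v x₀ hgt
      change mfderiv 𝓘(ℝ, E) I e.symm (g s) ((1 : ℝ) • (p.1 • chartField v x₀ (g s))) =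
        (1 : ℝ) • (p.1 • v (e.symm (g s)))
      rw [one_smul, one_smul]
      exact ((mfderiv 𝓘(ℝ, E) I e.symm (g s)).map_smul p.1 _).trans (congrArg (p.1 • ·) hk)

end ManifoldFlow

/-! ### Global flows of compactly supported vector fields. -/

section ManifoldFlow

open Filter Topology

universe uu

variable {E : Type uu} [NormedAddCommGroup E] [NormedSpace ℝ E]
  {H : Type*} [TopologicalSpace H] {I : ModelWithCorners ℝ E H}
  {M : Type*} [TopologicalSpace M] [ChartedSpace H M] [IsManifold I ∞ M]

/-- The group law for a family of global integral curves. -/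
theorem flow_add_of_isMIntegralCurve [I.Boundaryless] [T2Space M] {v : ∀ x : M, TangentSpace I x}
    (hv : ContMDiff I I.tangent ∞ (fun x => (⟨x, v x⟩ : TangentBundle I M))) {φ : ℝ → M → M}
    (h0 : ∀ x, φ 0 x = x) (hφ : ∀ x, IsMIntegralCurve (I := I) (fun t => φ t x) v)
    (s t : ℝ) (x : M) : φ (s + t) x = φ s (φ t x) := by
  have h1 := (hφ x).comp_add t
  have := isMIntegralCurve_Ioo_eq_of_contMDiff_boundaryless (I := I) (t₀ := 0)
    (hv.of_le (by simp)) h1 (hφ (φ t x)) (by simp [h0])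
  exact congrFun this s

/-- The property passes to subsets and finite unions, so compactness reduces it to a neighbourhood
of a point. There, a curve of `(δ / 2) • v` on `(-2, 2)`, run at speed `(δ / 2)⁻¹`, is a curve of
`v` on `(-δ, δ)`. -/
theorem exists_uniform_integralCurves [FiniteDimensional ℝ E] [I.Boundaryless]
    {v : ∀ x : M, TangentSpace I x}
    (hv : ContMDiff I I.tangent ∞ (fun x => (⟨x, v x⟩ : TangentBundle I M)))
    {K : Set M} (hK : IsCompact K) :
    ∃ ε > (0 : ℝ), ∀ x ∈ K, ∃ γ : ℝ → M, γ 0 = x ∧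
      IsMIntegralCurveOn (I := I) γ v (Ioo (-ε) ε) := by
  refine hK.induction_on (p := fun s => ∃ ε > (0 : ℝ), ∀ x ∈ s, ∃ γ : ℝ → M, γ 0 = x ∧
      IsMIntegralCurveOn (I := I) γ v (Ioo (-ε) ε)) ⟨1, one_pos, by simp⟩ ?_ ?_ ?_
  · rintro s t hst ⟨ε, hε, h⟩
    exact ⟨ε, hε, fun x hx => h x (hst hx)⟩
  · rintro s t ⟨ε, hε, h⟩ ⟨δ, hδ, h'⟩
    refine ⟨min ε δ, lt_min hε hδ, ?_⟩
    rintro x (hx | hx)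
    · obtain ⟨γ, h0, hγ⟩ := h x hx
      exact ⟨γ, h0, hγ.mono (Ioo_subset_Ioo (neg_le_neg (min_le_left _ _)) (min_le_left _ _))⟩
    · obtain ⟨γ, h0, hγ⟩ := h' x hx
      exact ⟨γ, h0, hγ.mono (Ioo_subset_Ioo (neg_le_neg (min_le_right _ _)) (min_le_right _ _))⟩
  · intro x₀ _
    obtain ⟨c, -, hc⟩ := exists_local_curves hv x₀ 1 one_ne_zero
    rw [nhds_prod_eq, eventually_prod_iff] at hc
    obtain ⟨p, hp, q, hq, hc⟩ := hc
    obtain ⟨δ, hδ, hpδ⟩ := Metric.eventually_nhds_iff.1 hp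
    have hδp : p (δ / 2) := hpδ (by simp [abs_of_pos hδ, hδ])
    refine ⟨_, mem_nhdsWithin_of_mem_nhds hq, δ / 2, by positivity, fun x hx => ?_⟩
    obtain ⟨h1, h2⟩ := hc hδp hx
    refine ⟨c (δ / 2, x) ∘ (· * (δ / 2)⁻¹), by simp [h1], ?_⟩
    have h3 := h2.comp_mul (δ / 2)⁻¹
    rw [smul_smul, inv_mul_cancel₀ (by positivity), one_smul] at h3
    refine h3.mono fun t ht => ?_
    have : (0 : ℝ) < δ / 2 := by positivity
    constructor
    · have := ht.1
      change -2 < t * (δ / 2)⁻¹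
      rw [← div_eq_mul_inv, lt_div_iff₀ (by positivity)]
      linarith
    · have := ht.2
      change t * (δ / 2)⁻¹ < 2
      rw [← div_eq_mul_inv, div_lt_iff₀ (by positivity)]
      linarith

/-- A smooth compactly supported vector field has a smooth global flow. -/
theorem exists_global_flow [FiniteDimensional ℝ E] [I.Boundaryless] [T2Space M]
    {v : ∀ x : M, TangentSpace I x}
    (hv : ContMDiff I I.tangent ∞ (fun x => (⟨x, v x⟩ : TangentBundle I M)))
    {K : Set M} (hK : IsCompact K) (hvK : ∀ x ∉ K, v x = 0) :
    ∃ φ : ℝ → M → M, ContMDiff (𝓘(ℝ, ℝ).prod I) I ∞ (fun p : ℝ × M => φ p.1 p.2) ∧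
      (∀ x, φ 0 x = x) ∧ ∀ x, IsMIntegralCurve (I := I) (fun t => φ t x) v := by
  have hv1 : ContMDiff I I.tangent 1 (fun x => (⟨x, v x⟩ : TangentBundle I M)) :=
    hv.of_le (by simp)
  have hex : ∀ x : M, ∃ γ : ℝ → M, γ 0 = x ∧ IsMIntegralCurve (I := I) γ v := by
    obtain ⟨ε, hε, h⟩ := exists_uniform_integralCurves hv hK
    refine exists_isMIntegralCurve_of_isMIntegralCurveOn hv1 hε fun x => ?_
    by_cases hx : x ∈ K
    · exact h x hx
    · exact ⟨fun _ => x, rfl, (isMIntegralCurve_const (hvK x hx)).isMIntegralCurveOn _⟩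
  choose γ hγ0 hγ using hex
  let φ : ℝ → M → M := fun t x => γ x t
  have hadd := flow_add_of_isMIntegralCurve hv (φ := φ) hγ0 hγ
  refine ⟨φ, ?_, hγ0, hγ⟩
  have hout : ∀ x ∉ K, ∀ t, φ t x = x := fun x hx t =>
    congrFun (isMIntegralCurve_Ioo_eq_of_contMDiff_boundaryless (I := I) (t₀ := 0)
      hv1 (hγ x) (isMIntegralCurve_const (hvK x hx)) (hγ0 x)) t
  refine contMDiff_infty.2 fun n => ?_
  -- The inverse function theorem requires at least one derivative; order `0` follows from order
  -- `1`.
  suffices hpos : ∀ n : ℕ, n ≠ 0 →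
      ContMDiff (𝓘(ℝ, ℝ).prod I) I n (fun p : ℝ × M => φ p.1 p.2) from
    (hpos (n + 1) (by simp)).of_le (by simp)
  clear n
  intro n hn
  have hK' : ∃ ε > (0 : ℝ), ∀ x ∈ K, ∀ t : ℝ, |t| < ε →
      ContMDiffAt (𝓘(ℝ, ℝ).prod I) I n (fun p : ℝ × M => φ p.1 p.2) (t, x) := by
    refine hK.induction_on (p := fun s => ∃ ε > (0 : ℝ), ∀ x ∈ s, ∀ t : ℝ, |t| < ε →
      ContMDiffAt (𝓘(ℝ, ℝ).prod I) I n (fun p : ℝ × M => φ p.1 p.2) (t, x))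
      ⟨1, one_pos, by simp⟩ ?_ ?_ ?_
    · rintro s t hst ⟨ε, hε, h⟩
      exact ⟨ε, hε, fun x hx => h x (hst hx)⟩
    · rintro s t ⟨ε, hε, h⟩ ⟨δ, hδ, h'⟩
      refine ⟨min ε δ, lt_min hε hδ, ?_⟩
      rintro x (hx | hx) r hr
      · exact h x hx r (hr.trans_le (min_le_left _ _))
      · exact h' x hx r (hr.trans_le (min_le_right _ _))
    · intro x₀ _
      obtain ⟨c, hc1, hc⟩ := exists_local_curves hv x₀ n hn
      -- By uniqueness, the flow of `v` at time `t` is the time `1` value of the integral curve of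
      -- `t • v`, and that value is known to depend smoothly on `t` and the starting point.
      have heq : ∀ᶠ p in 𝓝 ((0 : ℝ), x₀), φ p.1 p.2 = c p 1 := by
        filter_upwards [hc] with p hp
        have h1 := ((hγ p.2).comp_mul p.1).isMIntegralCurveOn (Ioo (-2) 2)
        have h2 := isMIntegralCurveOn_Ioo_eqOn_of_contMDiff_boundaryless (I := I) (t₀ := 0)
          (by norm_num) (v := p.1 • v) ?_ h1 hp.2 (by simp [hp.1, hγ0])
        · simpa [φ] using h2 (by norm_num : (1 : ℝ) ∈ Ioo (-2 : ℝ) 2)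
        · exact hv1.const_smul_section
      have hs : ContMDiffAt (𝓘(ℝ, ℝ).prod I) I n (fun p : ℝ × M => φ p.1 p.2) (0, x₀) :=
        hc1.congr_of_eventuallyEq heq
      have hev := (contMDiffAt_iff_contMDiffAt_nhds (by simp)).1 hs
      rw [nhds_prod_eq, eventually_prod_iff] at hev
      obtain ⟨p, hp, q, hq, hev⟩ := hev
      obtain ⟨δ, hδ, hpδ⟩ := Metric.eventually_nhds_iff.1 hp
      exact ⟨_, mem_nhdsWithin_of_mem_nhds hq, δ, hδ, fun x hx t ht =>
        hev (hpδ (by simpa using ht)) hx⟩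
  obtain ⟨ε, hε, hsm⟩ := hK'
  have hsm' : ∀ x : M, ∀ t : ℝ, |t| < ε →
      ContMDiffAt (𝓘(ℝ, ℝ).prod I) I n (fun p : ℝ × M => φ p.1 p.2) (t, x) := by
    intro x t ht
    by_cases hx : x ∈ K
    · exact hsm x hx t ht
    · have : (fun p : ℝ × M => φ p.1 p.2) =ᶠ[𝓝 (t, x)] Prod.snd := by
        filter_upwards [continuousAt_snd.eventually (hK.isClosed.isOpen_compl.mem_nhds hx)]
          with p hp
        exact hout p.2 hp p.1
      exact contMDiffAt_snd.congr_of_eventuallyEq this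
  -- Since φ_t = φ_{t/2} ∘ φ_{t/2}, regularity for `|t| < ε` spreads to `|t| < 2 ^ k * ε`.
  have hdouble : ∀ k : ℕ, ∀ x : M, ∀ t : ℝ, |t| < 2 ^ k * ε →
      ContMDiffAt (𝓘(ℝ, ℝ).prod I) I n (fun p : ℝ × M => φ p.1 p.2) (t, x) := by
    intro k
    induction k with
    | zero => simpa using hsm'
    | succ k ih =>
      intro x t ht
      have ht' : |t / 2| < 2 ^ k * ε := by
        rw [abs_div, abs_two, div_lt_iff₀ (by norm_num)]
        calc |t| < 2 ^ (k + 1) * ε := ht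
          _ = _ := by ring
      have heq : (fun p : ℝ × M => φ p.1 p.2) = fun p => φ (p.1 / 2) (φ (p.1 / 2) p.2) := by
        funext p
        rw [← hadd, add_halves]
      rw [heq]
      have hhalf : ContMDiffAt (𝓘(ℝ, ℝ).prod I) 𝓘(ℝ, ℝ) n (fun p : ℝ × M => p.1 / 2) (t, x) := by
        have : ContMDiff 𝓘(ℝ, ℝ) 𝓘(ℝ, ℝ) n (fun t : ℝ => t / 2) :=
          (contDiff_id.div_const 2).contMDiff
        exact this.contMDiffAt.comp (t, x) contMDiffAt_fst
      have h1 : ContMDiffAt (𝓘(ℝ, ℝ).prod I) I n (fun p : ℝ × M => φ (p.1 / 2) p.2) (t, x) :=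
        ContMDiffAt.comp (g := fun p : ℝ × M => φ p.1 p.2) (t, x) (ih x _ ht')
          (hhalf.prodMk contMDiffAt_snd)
      exact ContMDiffAt.comp (g := fun p : ℝ × M => φ p.1 p.2) (t, x) (ih _ _ ht')
        (hhalf.prodMk h1)
  intro p
  obtain ⟨k, hk⟩ := pow_unbounded_of_one_lt (|p.1| / ε) (one_lt_two (α := ℝ))
  exact hdouble k p.2 p.1 (by rwa [div_lt_iff₀ hε] at hk)

end ManifoldFlow

/-! ## The inverse function theorem and differential forms on manifolds -/

section ManifoldTools

open Filter Topology

variable {E : Type*} [NormedAddCommGroup E] [NormedSpace ℝ E]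
  {H : Type*} [TopologicalSpace H] {I : ModelWithCorners ℝ E H}
  {M : Type*} [TopologicalSpace M] [ChartedSpace H M] [IsManifold I ∞ M]
  {E' : Type*} [NormedAddCommGroup E'] [NormedSpace ℝ E']
  {H' : Type*} [TopologicalSpace H'] {I' : ModelWithCorners ℝ E' H'}
  {M' : Type*} [TopologicalSpace M'] [ChartedSpace H' M'] [IsManifold I' ∞ M']
  {F : Type*} [NormedAddCommGroup F] [NormedSpace ℝ F]

/-- The inverse function theorem: a smooth map with injective derivative between manifolds of the
same dimension has a smooth local section. -/
theorem exists_local_section [FiniteDimensional ℝ E] [FiniteDimensional ℝ E'] [I.Boundaryless]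
    [I'.Boundaryless] {f : M → M'} {x : M} (hf : ContMDiffAt I I' ∞ f x)
    (hinj : Function.Injective (mfderiv I I' f x))
    (hdim : Module.finrank ℝ E = Module.finrank ℝ E') :
    ∃ σ : M' → M, ContMDiffAt I' I ∞ σ (f x) ∧ σ (f x) = x ∧ ∀ᶠ y in 𝓝 (f x), f (σ y) = y := by
  have : CompleteSpace E := FiniteDimensional.complete ℝ E
  let e := extChartAt I x
  let e' := extChartAt I' (f x)
  let g : E → E' := e' ∘ f ∘ e.symm
  have hgs : ContDiffAt ℝ ∞ g (e x) := by
    have := (contMDiffAt_iff.1 hf).2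
    rwa [I.range_eq_univ, contDiffWithinAt_univ] at this
  have hder : (mfderiv I I' f x : E →L[ℝ] E') = fderiv ℝ g (e x) := by
    rw [(hf.mdifferentiableAt (by simp)).mfderiv, I.range_eq_univ, fderivWithin_univ]
    rfl
  have hinj' : Function.Injective (fderiv ℝ g (e x)) := by rw [← hder]; exact hinj
  let T : E ≃L[ℝ] E' := (LinearEquiv.ofInjectiveOfFinrankEq (fderiv ℝ g (e x)).toLinearMap hinj'
    hdim).toContinuousLinearEquiv
  have hT : HasFDerivAt g (T : E →L[ℝ] E') (e x) := by
    have : (T : E →L[ℝ] E') = fderiv ℝ g (e x) := by ext v; rfl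
    rw [this]
    exact (hgs.differentiableAt (by simp)).hasFDerivAt
  have hge : g (e x) = e' (f x) := by simp [g, e, e']
  let S := hgs.localInverse hT (by simp)
  have hS : ContDiffAt ℝ ∞ S (e' (f x)) := by
    rw [← hge]; exact hgs.to_localInverse hT (by simp)
  have hSx : S (e' (f x)) = e x := by
    rw [← hge]; exact hgs.localInverse_apply_image hT (by simp)
  have hright : ∀ᶠ y in 𝓝 (e' (f x)), g (S y) = y := by
    rw [← hge]
    exact (hgs.hasStrictFDerivAt' hT (by simp)).eventually_right_inverse
  have he' : ContMDiffAt I' 𝓘(ℝ, E') ∞ e' (f x) := contMDiffAt_extChartAt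
  have hS1 : ContMDiffAt I' 𝓘(ℝ, E) ∞ (S ∘ e') (f x) := hS.contMDiffAt.comp (f x) he'
  have htgt : e.target ∈ 𝓝 (e x) :=
    (isOpen_extChartAt_target x).mem_nhds (e.map_source (mem_extChartAt_source x))
  have hsymm : ContMDiffAt 𝓘(ℝ, E) I ∞ e.symm ((S ∘ e') (f x)) := by
    rw [Function.comp_apply, hSx]
    exact (contMDiffOn_extChartAt_symm x).contMDiffAt htgt
  have hσ : ContMDiffAt I' I ∞ (e.symm ∘ S ∘ e') (f x) := hsymm.comp (f x) hS1
  have hσx : (e.symm ∘ S ∘ e') (f x) = x := by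
    simp only [Function.comp_apply, hSx]; exact e.left_inv (mem_extChartAt_source x)
  refine ⟨e.symm ∘ S ∘ e', hσ, hσx, ?_⟩
  have h1 : ∀ᶠ y in 𝓝 (f x), g (S (e' y)) = e' y := he'.continuousAt.eventually hright
  have h2 : ∀ᶠ y in 𝓝 (f x), y ∈ e'.source := extChartAt_source_mem_nhds (f x)
  have h3 : ∀ᶠ y in 𝓝 (f x), f ((e.symm ∘ S ∘ e') y) ∈ e'.source := by
    have hc : ContinuousAt (f ∘ (e.symm ∘ S ∘ e')) (f x) := by
      refine ContinuousAt.comp ?_ hσ.continuousAt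
      rw [hσx]; exact hf.continuousAt
    refine hc.eventually ?_
    rw [Function.comp_apply, hσx]
    exact extChartAt_source_mem_nhds (f x)
  filter_upwards [h1, h2, h3] with y hy1 hy2 hy3
  exact e'.injOn hy3 hy2 hy1

section Forms

variable {α : CovectorField I (M := M)} {σ : BilinearField I (M := M)}

/-- The value of a smooth 1-form on a smooth field along a smooth map is smooth. -/
theorem IsSmoothOneForm.contMDiffOn_apply (hα : IsSmoothOneForm α) {f : M' → M}
    {u : ∀ x : M', TangentSpace I (f x)} {s : Set M'}
    (hu : ContMDiffOn I' I.tangent ∞ (fun x => (⟨f x, u x⟩ : TangentBundle I M)) s) :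
    ContMDiffOn I' 𝓘(ℝ, ℝ) ∞ (fun x => α (f x) (u x)) s :=
  ContMDiff.comp_contMDiffOn (g := fun p : TangentBundle I M => α p.1 p.2) hα hu

variable [I.Boundaryless]

theorem contDiffOn_chartForm (hα : IsSmoothOneForm α) (x₀ : M) (w : E) :
    ContDiffOn ℝ ∞ (fun y => chartForm α x₀ y w) (extChartAt I x₀).target := by
  rw [← contMDiffOn_iff_contDiffOn]
  have h1 : ContMDiffOn 𝓘(ℝ, E) 𝓘(ℝ, E).tangent ∞
      (fun y : E => (⟨y, w⟩ : TangentBundle 𝓘(ℝ, E) E)) (extChartAt I x₀).target :=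
    contMDiffOn_vectorSpace_iff_contDiffOn.2 contDiffOn_const
  have h2 := contMDiffOn_mfderiv_section (isOpen_extChartAt_target (I := I) x₀)
    (contMDiffOn_extChartAt_symm x₀) h1
  refine (hα.contMDiffOn_apply h2).congr fun y _ => ?_
  simp only [chartForm]
  rw [I.range_eq_univ, mfderivWithin_univ]

/-- The expression of a 1-form in a chart as a field of continuous linear forms. -/
def chartCovector [FiniteDimensional ℝ E] (α : CovectorField I (M := M)) (x₀ : M) (y : E) :
    E →L[ℝ] ℝ :=
  LinearMap.toContinuousLinearMap ((α ((extChartAt I x₀).symm y)).comp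
    (mfderivWithin 𝓘(ℝ, E) I (extChartAt I x₀).symm (range I) y).toLinearMap)

theorem contDiffOn_chartCovector [FiniteDimensional ℝ E] (hα : IsSmoothOneForm α) (x₀ : M) :
    ContDiffOn ℝ ∞ (chartCovector α x₀) (extChartAt I x₀).target :=
  contDiffOn_clm_apply.2 fun w => contDiffOn_chartForm hα x₀ w

omit [I.Boundaryless] in
theorem chartForm_extChartAt (x₀ : M) {x : M} (hx : x ∈ (extChartAt I x₀).source)
    (u : TangentSpace I x) :
    chartForm α x₀ (extChartAt I x₀ x) (mfderiv I 𝓘(ℝ, E) (extChartAt I x₀) x u) = α x u := by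
  have h := mfderivWithin_extChartAt_symm_comp_mfderiv_extChartAt' (I := I) hx
  have h' : (mfderivWithin 𝓘(ℝ, E) I (extChartAt I x₀).symm (range I) (extChartAt I x₀ x))
      (mfderiv I 𝓘(ℝ, E) (extChartAt I x₀) x u) = u := congrArg (fun A => A u) h
  unfold chartForm
  -- The two base points are only propositionally equal, while both tangent spaces are `E` by
  -- definition. Generalizing the base point and substituting avoids a transport; the auxiliary
  -- statements `key` below often serve the same purpose.
  have key : ∀ x', x' = x → ∀ u' : E, u' = u → α x' u' = α x u := by
    rintro _ rfl _ rfl; rfl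
  exact key _ ((extChartAt I x₀).left_inv hx) _ h'

/-- At the centre of its preferred chart the derivative of the inverse chart is the identity, so
tangent vectors at `x₀` may be read as the constant vectors of the definition. -/
theorem IsExteriorDerivative.eq_fderiv_chartForm (hσ : IsExteriorDerivative α σ) (x₀ : M)
    (v w : TangentSpace I x₀) :
    σ x₀ v w = fderiv ℝ (fun y => chartForm α x₀ y w) (extChartAt I x₀ x₀) v -
      fderiv ℝ (fun y => chartForm α x₀ y v) (extChartAt I x₀ x₀) w := by
  have h := hσ x₀ v w
  rw [mfderivWithin_range_extChartAt_symm] at h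
  simp only [I.range_eq_univ, fderivWithin_univ] at h
  rw [← h]
  have key : ∀ x', x' = x₀ → σ x₀ v w = σ x' (v : E) (w : E) := by
    rintro _ rfl; rfl
  exact key _ ((extChartAt I x₀).left_inv (mem_extChartAt_source x₀))

/-- The exterior derivative commutes with the pull-back to a vector space. -/
theorem IsExteriorDerivative.pullback_apply [FiniteDimensional ℝ E] (hα : IsSmoothOneForm α)
    (hσ : IsExteriorDerivative α σ) {Φ : F → M} {y₀ : F} (hΦ : ContMDiffAt 𝓘(ℝ, F) I ∞ Φ y₀)
    (v w : F) :
    DifferentiableAt ℝ (fun y => α (Φ y) (mfderiv 𝓘(ℝ, F) I Φ y w)) y₀ ∧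
    fderiv ℝ (fun y => α (Φ y) (mfderiv 𝓘(ℝ, F) I Φ y w)) y₀ v -
      fderiv ℝ (fun y => α (Φ y) (mfderiv 𝓘(ℝ, F) I Φ y v)) y₀ w =
      σ (Φ y₀) (mfderiv 𝓘(ℝ, F) I Φ y₀ v) (mfderiv 𝓘(ℝ, F) I Φ y₀ w) := by
  let e := extChartAt I (Φ y₀)
  let Ψ : F → E := fun y => e (Φ y)
  let A := chartCovector α (Φ y₀)
  have hΨ : ContDiffAt ℝ ∞ Ψ y₀ :=
    (ContMDiffAt.comp y₀ (contMDiffAt_extChartAt (x := Φ y₀)) hΦ).contDiffAt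
  have hA : ContDiffAt ℝ ∞ A (Ψ y₀) := (contDiffOn_chartCovector hα (Φ y₀)).contDiffAt
    ((isOpen_extChartAt_target _).mem_nhds (e.map_source (mem_extChartAt_source _)))
  have hev : ∀ᶠ y in 𝓝 y₀, Φ y ∈ e.source ∧ MDifferentiableAt 𝓘(ℝ, F) I Φ y := by
    refine (hΦ.continuousAt.eventually (extChartAt_source_mem_nhds (Φ y₀))).and ?_
    have h1 : ContMDiffAt 𝓘(ℝ, F) I 1 Φ y₀ := hΦ.of_le (by simp)
    filter_upwards [(contMDiffAt_iff_contMDiffAt_nhds (by simp)).1 h1] with y hy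
    exact hy.mdifferentiableAt (by simp)
  have hDΨ : ∀ y, Φ y ∈ e.source → MDifferentiableAt 𝓘(ℝ, F) I Φ y → ∀ u : F,
      fderiv ℝ Ψ y u = mfderiv I 𝓘(ℝ, E) e (Φ y) (mfderiv 𝓘(ℝ, F) I Φ y u) := by
    intro y hy hd u
    have h1 : MDifferentiableAt I 𝓘(ℝ, E) e (Φ y) :=
      mdifferentiableAt_extChartAt (by rwa [← extChartAt_source (I := I)])
    have := mfderiv_comp y h1 hd
    rw [← mfderiv_eq_fderiv]
    exact congrArg (fun B => B u) this
  have hb : ∀ u : F, (fun y => α (Φ y) (mfderiv 𝓘(ℝ, F) I Φ y u)) =ᶠ[𝓝 y₀]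
      fun y => A (Ψ y) (fderiv ℝ Ψ y u) := by
    intro u
    filter_upwards [hev] with y hy
    rw [hDΨ y hy.1 hy.2 u]
    exact (chartForm_extChartAt (Φ y₀) hy.1 _).symm
  have hd2 : DifferentiableAt ℝ (fderiv ℝ Ψ) y₀ :=
    (hΨ.fderiv_right (m := 1) (by norm_cast)).differentiableAt (by simp)
  have hAd : HasFDerivAt A (fderiv ℝ A (Ψ y₀)) (Ψ y₀) :=
    (hA.differentiableAt (by simp)).hasFDerivAt
  have hΨd : HasFDerivAt Ψ (fderiv ℝ Ψ y₀) y₀ := (hΨ.differentiableAt (by simp)).hasFDerivAt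
  have hder : ∀ u : F, HasFDerivAt (fun y => A (Ψ y) (fderiv ℝ Ψ y u))
      ((A (Ψ y₀)).comp ((fderiv ℝ (fderiv ℝ Ψ) y₀).flip u) +
        ((fderiv ℝ A (Ψ y₀)).comp (fderiv ℝ Ψ y₀)).flip (fderiv ℝ Ψ y₀ u)) y₀ := by
    intro u
    have h1 : HasFDerivAt (fun y => fderiv ℝ Ψ y u) ((fderiv ℝ (fderiv ℝ Ψ) y₀).flip u) y₀ := by
      have := hd2.hasFDerivAt.clm_apply (hasFDerivAt_const u y₀)
      simpa using this
    exact (hAd.comp y₀ hΨd).clm_apply h1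
  have hfd : ∀ u u' : F, fderiv ℝ (fun y => α (Φ y) (mfderiv 𝓘(ℝ, F) I Φ y u)) y₀ u' =
      A (Ψ y₀) (fderiv ℝ (fderiv ℝ Ψ) y₀ u' u) +
        fderiv ℝ A (Ψ y₀) (fderiv ℝ Ψ y₀ u') (fderiv ℝ Ψ y₀ u) := by
    intro u u'
    rw [(hb u).fderiv_eq, (hder u).fderiv]
    rfl
  refine ⟨((hder w).differentiableAt).congr_of_eventuallyEq (hb w), ?_⟩
  -- The terms containing the second derivative of `Ψ` cancel by symmetry. Only the antisymmetrized
  -- derivative of the covector field `A` survives.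
  rw [hfd, hfd, (hΨ.isSymmSndFDerivAt (by
    rw [minSmoothness_of_isRCLikeNormedField]; exact ENat.LEInfty.out)) v w,
    add_sub_add_left_eq_sub]
  have hcenter : ∀ u : F, fderiv ℝ Ψ y₀ u = mfderiv 𝓘(ℝ, F) I Φ y₀ u := by
    intro u
    rw [hDΨ y₀ hev.self_of_nhds.1 hev.self_of_nhds.2 u, mfderiv_extChartAt_self]
    rfl
  rw [hσ.eq_fderiv_chartForm]
  have hAw : ∀ u u' : E, fderiv ℝ (fun y => chartForm α (Φ y₀) y u) (Ψ y₀) u' =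
      fderiv ℝ A (Ψ y₀) u' u := by
    intro u u'
    have := hAd.clm_apply (hasFDerivAt_const u (Ψ y₀))
    change fderiv ℝ (fun y => A y u) (Ψ y₀) u' = _
    rw [this.fderiv]
    simp
  rw [← hcenter v, ← hcenter w]
  exact congrArg₂ (· - ·) (hAw _ _).symm (hAw _ _).symm

/-- **Cartan's formula**: the derivative in time of the pull-back of a 1-form under a smooth family
of maps. -/
theorem IsExteriorDerivative.hasDerivAt_pullback [FiniteDimensional ℝ E] [I'.Boundaryless]
    (hα : IsSmoothOneForm α)
    (hσ : IsExteriorDerivative α σ) {φ : ℝ → M' → M} {t₀ : ℝ} {x₀ : M'}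
    (hφ : ContMDiffAt (𝓘(ℝ, ℝ).prod I') I ∞ (fun p : ℝ × M' => φ p.1 p.2) (t₀, x₀))
    (v : TangentSpace I' x₀) {l : TangentSpace I' x₀ →L[ℝ] ℝ}
    (hl : HasMFDerivAt I' 𝓘(ℝ, ℝ)
      (fun x => α (φ t₀ x) (mfderiv 𝓘(ℝ, ℝ) I (fun t => φ t x) t₀ (1 : ℝ))) x₀ l) :
    HasDerivAt (fun t => α (φ t x₀) (mfderiv I' I (φ t) x₀ v))
      (σ (φ t₀ x₀) (mfderiv 𝓘(ℝ, ℝ) I (fun t => φ t x₀) t₀ (1 : ℝ)) (mfderiv I' I (φ t₀) x₀ v) +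
        l v) t₀ := by
  let e := extChartAt I' x₀
  let y₀ := e x₀
  have hy₀ : e.symm y₀ = x₀ := e.left_inv (mem_extChartAt_source x₀)
  have hmem : y₀ ∈ e.target := e.map_source (mem_extChartAt_source x₀)
  have ho : IsOpen e.target := isOpen_extChartAt_target x₀
  -- Time and space are merged into one map from a vector space. Cartan's formula is then the
  -- identity d(Φ^*α) = Φ^*σ evaluated on the constant vectors (1, 0) and (0, v).
  let Φ : ℝ × E' → M := fun p => φ p.1 (e.symm p.2)
  have hes : ∀ y ∈ e.target, ContMDiffAt 𝓘(ℝ, E') I' ∞ e.symm y := fun y hy =>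
    (contMDiffOn_extChartAt_symm x₀).contMDiffAt (ho.mem_nhds hy)
  have hpair : ContMDiffAt 𝓘(ℝ, ℝ × E') (𝓘(ℝ, ℝ).prod I') ∞
      (fun p : ℝ × E' => (p.1, e.symm p.2)) (t₀, y₀) := by
    refine ContMDiffAt.prodMk contDiffAt_fst.contMDiffAt ?_
    exact ContMDiffAt.comp (t₀, y₀) (hes y₀ hmem) contDiffAt_snd.contMDiffAt
  have hφ' : ContMDiffAt (𝓘(ℝ, ℝ).prod I') I ∞ (fun p : ℝ × M' => φ p.1 p.2)
      ((t₀, y₀).1, e.symm (t₀, y₀).2) := by simpa only [hy₀] using hφ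
  have hΦ : ContMDiffAt 𝓘(ℝ, ℝ × E') I ∞ Φ (t₀, y₀) :=
    ContMDiffAt.comp (g := fun p : ℝ × M' => φ p.1 p.2) (t₀, y₀) hφ' hpair
  have hgood : ∀ᶠ p in 𝓝 (t₀, y₀), p.2 ∈ e.target ∧
      MDifferentiableAt (𝓘(ℝ, ℝ).prod I') I (fun p : ℝ × M' => φ p.1 p.2) (p.1, e.symm p.2) := by
    refine (continuousAt_snd.eventually (ho.mem_nhds hmem)).and ?_
    have h1 : ContMDiffAt (𝓘(ℝ, ℝ).prod I') I 1 (fun p : ℝ × M' => φ p.1 p.2)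
      ((t₀, y₀).1, e.symm (t₀, y₀).2) := hφ'.of_le (by simp)
    have h2 := (contMDiffAt_iff_contMDiffAt_nhds (by simp)).1 h1
    filter_upwards [hpair.continuousAt.eventually h2] with p hp
    exact hp.mdifferentiableAt (by simp)
  have hslice : ∀ p : ℝ × E', p.2 ∈ e.target →
      MDifferentiableAt (𝓘(ℝ, ℝ).prod I') I (fun p : ℝ × M' => φ p.1 p.2) (p.1, e.symm p.2) →
      (∀ u : E', mfderiv 𝓘(ℝ, ℝ × E') I Φ p ((0, u) : ℝ × E') =
        mfderiv I' I (φ p.1) (e.symm p.2) (mfderiv 𝓘(ℝ, E') I' e.symm p.2 u)) ∧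
      mfderiv 𝓘(ℝ, ℝ × E') I Φ p ((1, 0) : ℝ × E') =
        mfderiv 𝓘(ℝ, ℝ) I (fun t => φ t (e.symm p.2)) p.1 (1 : ℝ) := by
    rintro ⟨t, y⟩ hy hd
    have hesd : MDifferentiableAt 𝓘(ℝ, E') I' e.symm y := (hes y hy).mdifferentiableAt (by simp)
    have hpd : MDifferentiableAt 𝓘(ℝ, ℝ × E') (𝓘(ℝ, ℝ).prod I')
        (fun p : ℝ × E' => (p.1, e.symm p.2)) (t, y) := by
      refine MDifferentiableAt.prodMk differentiableAt_fst.mdifferentiableAt ?_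
      exact MDifferentiableAt.comp (I' := 𝓘(ℝ, E')) (t, y) hesd
        differentiableAt_snd.mdifferentiableAt
    have hΦd : MDifferentiableAt 𝓘(ℝ, ℝ × E') I Φ (t, y) :=
      MDifferentiableAt.comp (g := fun p : ℝ × M' => φ p.1 p.2) (t, y) hd hpd
    constructor
    · intro u
      have hi : HasFDerivAt (fun y' : E' => ((t, y') : ℝ × E')) (ContinuousLinearMap.inr ℝ ℝ E') y :=
        hasFDerivAt_prodMk_right t y
      have h1 : HasMFDerivAt 𝓘(ℝ, E') I (Φ ∘ fun y' : E' => (t, y')) y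
          ((mfderiv 𝓘(ℝ, ℝ × E') I Φ (t, y)).comp (ContinuousLinearMap.inr ℝ ℝ E')) :=
        HasMFDerivAt.comp y hΦd.hasMFDerivAt hi.hasMFDerivAt
      have hφt : MDifferentiableAt I' I (φ t) (e.symm y) := by
        have h3 : MDifferentiableAt I' (𝓘(ℝ, ℝ).prod I') (fun x : M' => (t, x)) (e.symm y) :=
          mdifferentiableAt_const.prodMk mdifferentiableAt_id
        exact MDifferentiableAt.comp (g := fun p : ℝ × M' => φ p.1 p.2) (e.symm y) hd h3
      have h2 : HasMFDerivAt 𝓘(ℝ, E') I (φ t ∘ e.symm) y _ :=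
        HasMFDerivAt.comp y hφt.hasMFDerivAt hesd.hasMFDerivAt
      exact congrArg (fun B => B u) (hasMFDerivAt_unique h1 h2)
    · have hi : HasFDerivAt (fun t' : ℝ => ((t', y) : ℝ × E')) (ContinuousLinearMap.inl ℝ ℝ E') t :=
        hasFDerivAt_prodMk_left t y
      have h1 : HasMFDerivAt 𝓘(ℝ, ℝ) I (Φ ∘ fun t' : ℝ => (t', y)) t
          ((mfderiv 𝓘(ℝ, ℝ × E') I Φ (t, y)).comp (ContinuousLinearMap.inl ℝ ℝ E')) :=
        HasMFDerivAt.comp t hΦd.hasMFDerivAt hi.hasMFDerivAt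
      exact (congrArg (fun B => B (1 : ℝ)) h1.mfderiv).symm
  have hcen : mfderiv 𝓘(ℝ, E') I' e.symm y₀ = ContinuousLinearMap.id ℝ E' := by
    have := mfderivWithin_range_extChartAt_symm (I := I') (x := x₀)
    rwa [I'.range_eq_univ, mfderivWithin_univ] at this
  have hvx : ∀ t, α (φ t (e.symm y₀)) (mfderiv I' I (φ t) (e.symm y₀) (v : E')) =
      α (φ t x₀) (mfderiv I' I (φ t) x₀ v) := by
    intro t
    have key : ∀ x', x' = x₀ → α (φ t x') (mfderiv I' I (φ t) x' (v : E')) =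
        α (φ t x₀) (mfderiv I' I (φ t) x₀ v) := by rintro _ rfl; rfl
    exact key _ hy₀
  obtain ⟨hd1, hform⟩ := hσ.pullback_apply hα hΦ ((1, 0) : ℝ × E') ((0, v) : ℝ × E')
  obtain ⟨hd2, -⟩ := hσ.pullback_apply hα hΦ ((0, v) : ℝ × E') ((1, 0) : ℝ × E')
  have hline : HasDerivAt (fun t : ℝ => ((t, y₀) : ℝ × E')) ((1, 0) : ℝ × E') t₀ :=
    (hasDerivAt_id t₀).prodMk (hasDerivAt_const t₀ y₀)
  have hmain := hd1.hasFDerivAt.comp_hasDerivAt t₀ hline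
  have hl' : fderiv ℝ (fun y => α (Φ y) (mfderiv 𝓘(ℝ, ℝ × E') I Φ y ((1, 0) : ℝ × E')))
      (t₀, y₀) ((0, v) : ℝ × E') = l v := by
    have hi : HasFDerivAt (fun y' : E' => ((t₀, y') : ℝ × E')) (ContinuousLinearMap.inr ℝ ℝ E') y₀ :=
      hasFDerivAt_prodMk_right t₀ y₀
    have h1 := hd2.hasFDerivAt.comp y₀ hi
    have hesd : MDifferentiableAt 𝓘(ℝ, E') I' e.symm y₀ :=
      (hes y₀ hmem).mdifferentiableAt (by simp)
    have hl2 : HasMFDerivAt I' 𝓘(ℝ, ℝ)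
        (fun x => α (φ t₀ x) (mfderiv 𝓘(ℝ, ℝ) I (fun t => φ t x) t₀ (1 : ℝ))) (e.symm y₀) l := by
      have key : ∀ x', x' = x₀ → HasMFDerivAt I' 𝓘(ℝ, ℝ)
        (fun x => α (φ t₀ x) (mfderiv 𝓘(ℝ, ℝ) I (fun t => φ t x) t₀ (1 : ℝ))) x'
          (l : E' →L[ℝ] ℝ) := by
        rintro _ rfl; exact hl
      exact key _ hy₀
    have h2 := (HasMFDerivAt.comp y₀ hl2 hesd.hasMFDerivAt).hasFDerivAt
    rw [hcen] at h2
    have h3 : (fun y' : E' => (fun y => α (Φ y) (mfderiv 𝓘(ℝ, ℝ × E') I Φ y ((1, 0) : ℝ × E')))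
        (t₀, y')) =ᶠ[𝓝 y₀] ((fun x => α (φ t₀ x)
          (mfderiv 𝓘(ℝ, ℝ) I (fun t => φ t x) t₀ (1 : ℝ))) ∘ e.symm) := by
      have hc : ContinuousAt (fun y' : E' => ((t₀, y') : ℝ × E')) y₀ := by fun_prop
      filter_upwards [hc.eventually hgood] with y hy
      exact congrArg (α (φ t₀ (e.symm y))) (hslice (t₀, y) hy.1 hy.2).2
    have h4 := (h1.unique (h2.congr_of_eventuallyEq h3))
    exact congrArg (fun B : E' →L[ℝ] ℝ => B v) h4
  have hval : σ (φ t₀ x₀) (mfderiv 𝓘(ℝ, ℝ) I (fun t => φ t x₀) t₀ (1 : ℝ))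
      (mfderiv I' I (φ t₀) x₀ v) = σ (Φ (t₀, y₀)) (mfderiv 𝓘(ℝ, ℝ × E') I Φ (t₀, y₀)
        ((1, 0) : ℝ × E')) (mfderiv 𝓘(ℝ, ℝ × E') I Φ (t₀, y₀) ((0, v) : ℝ × E')) := by
    have h1 := hslice (t₀, y₀) hgood.self_of_nhds.1 hgood.self_of_nhds.2
    rw [h1.1 v, h1.2]
    change _ = σ (φ t₀ (e.symm y₀)) (mfderiv 𝓘(ℝ, ℝ) I (fun t => φ t (e.symm y₀)) t₀ (1 : ℝ))
      (mfderiv I' I (φ t₀) (e.symm y₀) (mfderiv 𝓘(ℝ, E') I' e.symm y₀ v))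
    rw [hcen]
    have key : ∀ x', x' = x₀ → σ (φ t₀ x₀) (mfderiv 𝓘(ℝ, ℝ) I (fun t => φ t x₀) t₀ (1 : ℝ))
        (mfderiv I' I (φ t₀) x₀ v) = σ (φ t₀ x')
        (mfderiv 𝓘(ℝ, ℝ) I (fun t => φ t x') t₀ (1 : ℝ)) (mfderiv I' I (φ t₀) x' (v : E')) := by
      rintro _ rfl; rfl
    exact key _ hy₀
  rw [hval, ← hform, hl', sub_add_cancel]
  refine hmain.congr_of_eventuallyEq ?_
  have hc : ContinuousAt (fun t : ℝ => ((t, y₀) : ℝ × E')) t₀ := by fun_prop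
  filter_upwards [hc.eventually hgood] with t ht
  have h1 := (hslice (t, y₀) ht.1 ht.2).1 v
  rw [hcen] at h1
  rw [← hvx t]
  exact congrArg (α (φ t (e.symm y₀))) h1.symm

/-- A smooth map that preserves 1-forms preserves their exterior derivatives. -/
theorem IsExteriorDerivative.eq_of_pullback_eq [FiniteDimensional ℝ E] [I'.Boundaryless]
    {α' : CovectorField I' (M := M')} {σ' : BilinearField I' (M := M')}
    (hα : IsSmoothOneForm α) (hσ : IsExteriorDerivative α σ) (hσ' : IsExteriorDerivative α' σ')
    {f : M' → M} {x₀ : M'} (hf : ContMDiffAt I' I ∞ f x₀)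
    (h : ∀ᶠ x in 𝓝 x₀, ∀ v : TangentSpace I' x, α (f x) (mfderiv I' I f x v) = α' x v)
    (v w : TangentSpace I' x₀) :
    σ (f x₀) (mfderiv I' I f x₀ v) (mfderiv I' I f x₀ w) = σ' x₀ v w := by
  let e := extChartAt I' x₀
  let y₀ := e x₀
  have hy₀ : e.symm y₀ = x₀ := e.left_inv (mem_extChartAt_source x₀)
  have hmem : y₀ ∈ e.target := e.map_source (mem_extChartAt_source x₀)
  have ho : IsOpen e.target := isOpen_extChartAt_target x₀
  have hes : ∀ y ∈ e.target, ContMDiffAt 𝓘(ℝ, E') I' ∞ e.symm y := fun y hy =>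
    (contMDiffOn_extChartAt_symm x₀).contMDiffAt (ho.mem_nhds hy)
  have hΦ : ContMDiffAt 𝓘(ℝ, E') I ∞ (f ∘ e.symm) y₀ := by
    refine ContMDiffAt.comp y₀ ?_ (hes y₀ hmem)
    rwa [hy₀]
  have hchain : ∀ y ∈ e.target, MDifferentiableAt I' I f (e.symm y) → ∀ u : E',
      mfderiv 𝓘(ℝ, E') I (f ∘ e.symm) y u =
        mfderiv I' I f (e.symm y) (mfderiv 𝓘(ℝ, E') I' e.symm y u) := by
    intro y hy hd u
    exact congrArg (fun B => B u) (mfderiv_comp y hd ((hes y hy).mdifferentiableAt (by simp)))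
  have hcen : mfderiv 𝓘(ℝ, E') I' e.symm y₀ = ContinuousLinearMap.id ℝ E' := by
    have := mfderivWithin_range_extChartAt_symm (I := I') (x := x₀)
    rwa [I'.range_eq_univ, mfderivWithin_univ] at this
  have hev : ∀ᶠ y in 𝓝 y₀, y ∈ e.target ∧ MDifferentiableAt I' I f (e.symm y) ∧
      ∀ v : TangentSpace I' (e.symm y), α (f (e.symm y)) (mfderiv I' I f (e.symm y) v) =
        α' (e.symm y) v := by
    refine Filter.Eventually.and (ho.mem_nhds hmem) ?_
    have h1 : ContMDiffAt I' I 1 f x₀ := hf.of_le (by simp)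
    have h2 := ((contMDiffAt_iff_contMDiffAt_nhds (by simp)).1 h1).and h
    rw [← hy₀] at h2
    filter_upwards [(hes y₀ hmem).continuousAt.eventually h2] with y hy
    exact ⟨hy.1.mdifferentiableAt (by simp), hy.2⟩
  have hb : ∀ u : E', (fun y => α ((f ∘ e.symm) y) (mfderiv 𝓘(ℝ, E') I (f ∘ e.symm) y u)) =ᶠ[𝓝 y₀]
      fun y => chartForm α' x₀ y u := by
    intro u
    filter_upwards [hev] with y hy
    rw [hchain y hy.1 hy.2.1]
    refine (hy.2.2 _).trans ?_
    simp only [chartForm]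
    rw [I'.range_eq_univ, mfderivWithin_univ]
  have hform := (hσ.pullback_apply hα hΦ (v : E') (w : E')).2
  rw [(hb v).fderiv_eq, (hb w).fderiv_eq, hchain y₀ hmem hev.self_of_nhds.2.1 v,
    hchain y₀ hmem hev.self_of_nhds.2.1 w, hcen] at hform
  rw [hσ'.eq_fderiv_chartForm x₀ v w]
  have key : ∀ x', x' = x₀ → σ (f x₀) (mfderiv I' I f x₀ v) (mfderiv I' I f x₀ w) =
      σ (f x') (mfderiv I' I f x' (v : E')) (mfderiv I' I f x' (w : E')) := by
    rintro _ rfl; rfl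
  exact (key _ hy₀).trans hform.symm

end Forms

end ManifoldTools

/-! ## Liouville flows and starshaped hypersurfaces -/

section LiouvilleBasics

open Filter Topology

variable {E : Type*} [NormedAddCommGroup E] [NormedSpace ℝ E] [FiniteDimensional ℝ E]
  {H : Type*} [TopologicalSpace H] {I : ModelWithCorners ℝ E H} [I.Boundaryless]
  {M : Type*} [TopologicalSpace M] [T2Space M] [ChartedSpace H M] [IsManifold I ∞ M]
  {D : LiouvilleData I M}

theorem hasDerivAt_comp_curve {F : Type*} [NormedAddCommGroup F] [NormedSpace ℝ F] {g : M → F}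
    {γ : ℝ → M} {t : ℝ} {w : TangentSpace I (γ t)} (hg : MDifferentiableAt I 𝓘(ℝ, F) g (γ t))
    (hγ : HasMFDerivAt 𝓘(ℝ, ℝ) I γ t ((1 : ℝ →L[ℝ] ℝ).smulRight w)) :
    HasDerivAt (fun s => g (γ s)) (mfderiv I 𝓘(ℝ, F) g (γ t) w : F) t := by
  obtain ⟨B, hB, hB1⟩ : ∃ B : ℝ →L[ℝ] F, HasFDerivAt (fun s => g (γ s)) B t ∧
      B 1 = (mfderiv I 𝓘(ℝ, F) g (γ t) ((1 : ℝ) • w) : F) :=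
    ⟨_, (hg.hasMFDerivAt.comp t hγ).hasFDerivAt, rfl⟩
  rw [one_smul] at hB1
  exact hB1 ▸ hB.hasDerivAt

namespace LiouvilleData

/-- The time `t` for which `L^{-t} x` lies on the hypersurface `P`. -/
def hitTime (D : LiouvilleData I M) (P : Set M) (x : M) : ℝ :=
  Classical.epsilon fun t => D.flow (-t) x ∈ P

namespace IsLiouville

variable (hD : D.IsLiouville)
include hD

theorem flow_add (s t : ℝ) (x : M) : D.flow (s + t) x = D.flow s (D.flow t x) :=
  flow_add_of_isMIntegralCurve hD.smooth_L hD.flow_zero hD.flow_integral s t x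

theorem flow_neg_flow (t : ℝ) (x : M) : D.flow (-t) (D.flow t x) = x := by
  rw [← hD.flow_add, neg_add_cancel, hD.flow_zero]

theorem flow_flow_neg (t : ℝ) (x : M) : D.flow t (D.flow (-t) x) = x := by
  rw [← hD.flow_add, add_neg_cancel, hD.flow_zero]

theorem contMDiff_flow (t : ℝ) : ContMDiff I I ∞ (D.flow t) :=
  hD.smooth_flow.comp (contMDiff_const.prodMk contMDiff_id : ContMDiff I (𝓘(ℝ, ℝ).prod I) ∞
    fun x : M => (t, x))

theorem contMDiff_flow_orbit (x : M) : ContMDiff 𝓘(ℝ, ℝ) I ∞ (fun t => D.flow t x) :=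
  hD.smooth_flow.comp (contMDiff_id.prodMk contMDiff_const : ContMDiff 𝓘(ℝ, ℝ) (𝓘(ℝ, ℝ).prod I) ∞
    fun t : ℝ => (t, x))

theorem mfderiv_flow_orbit (t : ℝ) (x : M) :
    mfderiv 𝓘(ℝ, ℝ) I (fun t => D.flow t x) t (1 : ℝ) = D.L (D.flow t x) := by
  rw [(hD.flow_integral x t).mfderiv]
  exact one_smul ℝ _

theorem α_L (x : M) : D.α x (D.L x) = 0 := by
  have := hD.exact.eq_fderiv_chartForm x (D.L x) (D.L x)
  rw [sub_self] at this
  exact this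

/-- The flow of the Liouville field rescales the Liouville form. -/
theorem pullback_flow (t : ℝ) (x : M) (v : TangentSpace I x) :
    D.α (D.flow t x) (mfderiv I I (D.flow t) x v) = Real.exp t * D.α x v := by
  -- In Cartan's formula i_L ω = α and α(L) = 0, so the pulled back form satisfies u' = u.
  have hder : ∀ t, HasDerivAt (fun t => D.α (D.flow t x) (mfderiv I I (D.flow t) x v))
      (D.α (D.flow t x) (mfderiv I I (D.flow t) x v)) t := by
    intro t
    have h0 : (fun y => D.α (D.flow t y) (mfderiv 𝓘(ℝ, ℝ) I (fun t => D.flow t y) t (1 : ℝ))) =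
        fun _ => (0 : ℝ) := by
      funext y
      rw [hD.mfderiv_flow_orbit, hD.α_L]
    have hl : HasMFDerivAt I 𝓘(ℝ, ℝ)
        (fun y => D.α (D.flow t y) (mfderiv 𝓘(ℝ, ℝ) I (fun t => D.flow t y) t (1 : ℝ))) x
        (0 : TangentSpace I x →L[ℝ] ℝ) := by
      rw [h0]; exact hasMFDerivAt_const _ _
    have := hD.exact.hasDerivAt_pullback hD.smooth_α (φ := D.flow) (t₀ := t) (x₀ := x)
      hD.smooth_flow.contMDiffAt v hl
    rw [hD.mfderiv_flow_orbit] at this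
    exact this.congr_deriv (add_zero _)
  have hconst : ∀ t, HasDerivAt (fun t => Real.exp (-t) *
      D.α (D.flow t x) (mfderiv I I (D.flow t) x v)) 0 t := by
    intro t
    have h1 : HasDerivAt (fun t : ℝ => Real.exp (-t)) (-Real.exp (-t)) t := by
      simpa using (hasDerivAt_neg t).exp
    exact (h1.mul (hder t)).congr_deriv (by ring)
  have hcc := is_const_of_deriv_eq_zero (fun t => (hconst t).differentiableAt)
    (fun t => (hconst t).deriv) t 0
  have h0 : D.α (D.flow 0 x) (mfderiv I I (D.flow 0) x v) = D.α x v := by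
    have key : ∀ f : M → M, f = id → D.α (f x) (mfderiv I I f x v) = D.α x v := by
      rintro _ rfl; rw [mfderiv_id]; rfl
    exact key _ (funext hD.flow_zero)
  simp only [neg_zero, Real.exp_zero, one_mul, h0] at hcc
  rw [← hcc, ← mul_assoc, ← Real.exp_add, add_neg_cancel, Real.exp_zero, one_mul]

theorem symp_skew (x : M) (v w : TangentSpace I x) : D.symp x v w = -D.symp x w v := by
  rw [hD.exact.eq_fderiv_chartForm x v w, hD.exact.eq_fderiv_chartForm x w v, neg_sub]

section Starshaped

variable {P U : Set M} (h : D.IsStarshaped P U)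
include h

omit hD in
theorem mem_or_exists (x : M) : x ∈ U ∨ ∃ t ≥ (0 : ℝ), ∃ p ∈ P, D.flow t p = x := by
  have hx : x ∈ U ∪ ⋃ t ∈ Ici (0 : ℝ), D.flow t '' P := by rw [h.union_eq]; trivial
  rcases hx with hx | hx
  · exact Or.inl hx
  · simp only [mem_iUnion] at hx
    obtain ⟨t, ht, p, hp, e⟩ := hx
    exact Or.inr ⟨t, ht, p, hp, e⟩

omit hD in
theorem flow_notMem {p : M} (hp : p ∈ P) {t : ℝ} (ht : 0 ≤ t) : D.flow t p ∉ U := fun hU =>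
  h.disjoint.le_bot ⟨hU, mem_biUnion (x := t) ht ⟨p, hp, rfl⟩⟩

theorem flow_neg_mem {x : M} (hx : x ∈ U) {t : ℝ} (ht : 0 ≤ t) : D.flow (-t) x ∈ U := by
  rcases mem_or_exists h (D.flow (-t) x) with h1 | ⟨s, hs, p, hp, e⟩
  · exact h1
  · exfalso
    have : D.flow (t + s) p = x := by rw [hD.flow_add, e, hD.flow_flow_neg]
    exact flow_notMem h hp (add_nonneg ht hs) (this ▸ hx)

omit hD in
theorem closure_eq : closure U = U ∪ P := by
  rw [closure_eq_self_union_frontier, h.frontier_eq]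

/-- By transversality a local defining function of `P` has non-zero derivative along the orbit of
`p`, hence no further zero nearby. -/
theorem eventually_flow_notMem_hypersurface {p : M} (hp : p ∈ P) :
    ∀ᶠ t in 𝓝[≠] (0 : ℝ), D.flow t p ∉ P := by
  obtain ⟨V, g, hVo, hpV, hg, hPV, hgL⟩ := h.transversal p hp
  have horb := hD.flow_integral p 0
  have hga : MDifferentiableAt I 𝓘(ℝ, ℝ) g (D.flow 0 p) := by
    rw [hD.flow_zero]
    exact (hg.contMDiffAt (hVo.mem_nhds hpV)).mdifferentiableAt (by simp)
  have hd : HasDerivAt (g ∘ fun t => D.flow t p) (mfderiv I 𝓘(ℝ, ℝ) g p (D.L p)) 0 := by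
    have h1 := hasDerivAt_comp_curve hga horb
    refine h1.congr_deriv ?_
    have key : ∀ x', x' = p → (mfderiv I 𝓘(ℝ, ℝ) g x' (D.L x') : ℝ) =
        mfderiv I 𝓘(ℝ, ℝ) g p (D.L p) := by
      rintro _ rfl; rfl
    exact key _ (hD.flow_zero p)
  have h2 := hd.eventually_ne (c := 0) hgL
  have h3 : ∀ᶠ t in 𝓝[≠] (0 : ℝ), D.flow t p ∈ V :=
    nhdsWithin_le_nhds (((hD.contMDiff_flow_orbit p).continuous.continuousAt).eventually
      (hVo.mem_nhds (by change D.flow 0 p ∈ V; rwa [hD.flow_zero])))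
  filter_upwards [h2, h3] with t ht1 ht2 ht3
  exact ht1 (hPV.le ⟨ht3, ht2⟩).2

/-- A short time back, the orbit is off `P` by transversality but still in `closure U`, since `U` is
invariant under the backward flow; it is thus in `U`, and remains there for all earlier times. -/
theorem flow_neg_mem_of_mem_hypersurface {p : M} (hp : p ∈ P) {t : ℝ} (ht : 0 < t) :
    D.flow (-t) p ∈ U := by
  have h1 := eventually_nhdsWithin_iff.1 (hD.eventually_flow_notMem_hypersurface h hp)
  obtain ⟨δ, hδ, h1⟩ := Metric.eventually_nhds_iff.1 h1
  let ε := min (δ / 2) t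
  have hε : 0 < ε := lt_min (by positivity) ht
  have hεδ : ε < δ := (min_le_left _ _).trans_lt (by linarith)
  have h2 : D.flow (-ε) p ∉ P := h1 (by simpa [abs_of_pos hε] using hεδ) (by simpa using hε.ne')
  have h3 : D.flow (-ε) p ∈ closure U :=
    map_mem_closure (hD.contMDiff_flow (-ε)).continuous
      (frontier_subset_closure (h.frontier_eq.ge hp)) fun x hx => hD.flow_neg_mem h hx hε.le
  rw [closure_eq h] at h3
  have h4 := hD.flow_neg_mem h (h3.resolve_right h2) (sub_nonneg.2 (min_le_right (δ / 2) t))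
  rwa [← hD.flow_add, show -(t - ε) + -ε = -t by ring] at h4

/-- Backward from `P` the flow enters `U`, forward it never does. A Liouville trajectory therefore
meets `P` at most once, and this makes `hitTime` unambiguous. -/
theorem eq_zero_of_flow_mem_hypersurface {p : M} (hp : p ∈ P) {t : ℝ} (ht : D.flow t p ∈ P) :
    t = 0 := by
  rcases lt_trichotomy t 0 with h1 | h1 | h1
  · have := hD.flow_neg_mem_of_mem_hypersurface h hp (neg_pos.2 h1)
    rw [neg_neg] at this
    exact absurd this (by simpa [hD.flow_zero] using flow_notMem h ht le_rfl)
  · exact h1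
  · have := hD.flow_neg_mem_of_mem_hypersurface h ht h1
    rw [hD.flow_neg_flow] at this
    exact absurd this (by simpa [hD.flow_zero] using flow_notMem h hp le_rfl)

/-- This identifies the symplectization with the union of the trajectories through `P`: a point
outside the core leaves `U` at some positive time, and everything outside `U` lies on a forward
trajectory from `P`. -/
theorem notMem_core_iff {x : M} : x ∉ D.core U ↔ ∃ t, D.flow (-t) x ∈ P := by
  constructor
  · intro hx
    simp only [core, mem_ofPred_eq, not_forall] at hx
    obtain ⟨t, ht, hx⟩ := hx
    rcases mem_or_exists h (D.flow t x) with h1 | ⟨s, hs, p, hp, e⟩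
    · exact absurd h1 hx
    · refine ⟨s - t, ?_⟩
      rw [neg_sub, sub_eq_add_neg, add_comm, hD.flow_add, ← e, hD.flow_neg_flow]
      exact hp
  · rintro ⟨t, ht⟩ hx
    have h1 := hx (|t| + 1) (by positivity)
    have : D.flow (|t| + 1) x = D.flow (|t| + 1 + t) (D.flow (-t) x) := by
      rw [← hD.flow_add]; congr 1; ring
    rw [this] at h1
    exact flow_notMem h ht (by linarith [neg_abs_le t]) h1

theorem flow_hitTime_mem {x : M} (hx : x ∉ D.core U) : D.flow (-D.hitTime P x) x ∈ P :=
  Classical.epsilon_spec (p := fun t => D.flow (-t) x ∈ P) ((hD.notMem_core_iff h).1 hx)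

theorem hitTime_eq {x : M} {t : ℝ} (ht : D.flow (-t) x ∈ P) : D.hitTime P x = t := by
  have h1 := hD.flow_hitTime_mem h ((hD.notMem_core_iff h).2 ⟨t, ht⟩)
  have h2 : D.flow (t - D.hitTime P x) (D.flow (-t) x) ∈ P := by
    rw [← hD.flow_add, show t - D.hitTime P x + -t = -D.hitTime P x by ring]
    exact h1
  linarith [hD.eq_zero_of_flow_mem_hypersurface h ht h2]

theorem flow_mem_core_iff (t : ℝ) {x : M} : D.flow t x ∈ D.core U ↔ x ∈ D.core U := by
  rw [← not_iff_not, hD.notMem_core_iff h, hD.notMem_core_iff h]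
  constructor
  · rintro ⟨s, hs⟩
    refine ⟨s - t, ?_⟩
    rw [← hD.flow_add] at hs
    rwa [neg_sub, sub_eq_neg_add]
  · rintro ⟨s, hs⟩
    refine ⟨s + t, ?_⟩
    rwa [← hD.flow_add, show -(s + t) + t = -s by ring]

theorem hitTime_flow (t : ℝ) {x : M} (hx : x ∉ D.core U) :
    D.hitTime P (D.flow t x) = D.hitTime P x + t := by
  apply hD.hitTime_eq h
  rw [← hD.flow_add, show -(D.hitTime P x + t) + t = -D.hitTime P x by ring]
  exact hD.flow_hitTime_mem h hx

theorem hitTime_of_mem {p : M} (hp : p ∈ P) : D.hitTime P p = 0 :=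
  hD.hitTime_eq h (by rwa [neg_zero, hD.flow_zero])

theorem notMem_core_of_mem {p : M} (hp : p ∈ P) : p ∉ D.core U :=
  (hD.notMem_core_iff h).2 ⟨0, by rwa [neg_zero, hD.flow_zero]⟩

/-- The core is an invariant set; written with the closure of `U` and all real times it becomes an
intersection of closed sets, as needed in `isClosed_core`. -/
theorem mem_core_iff_closure {x : M} : x ∈ D.core U ↔ ∀ t, D.flow t x ∈ closure U := by
  constructor
  · intro hx t
    by_contra hc
    have h1 : D.flow t x ∉ D.core U := fun hc' => by
      have := hc' 1 one_pos
      have h2 := hD.flow_neg_mem h this zero_le_one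
      rw [hD.flow_neg_flow] at h2
      exact hc (subset_closure h2)
    exact h1 ((hD.flow_mem_core_iff h t).2 hx)
  · intro hx
    by_contra hc
    have h1 := hD.flow_hitTime_mem h hc
    have h2 := hx (1 - D.hitTime P x)
    rw [sub_eq_add_neg, hD.flow_add, closure_eq h] at h2
    rcases h2 with h2 | h2
    · exact flow_notMem h h1 zero_le_one h2
    · exact one_ne_zero (hD.eq_zero_of_flow_mem_hypersurface h h1 h2)

theorem isClosed_core : IsClosed (D.core U) := by
  have : D.core U = ⋂ t : ℝ, D.flow t ⁻¹' closure U := by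
    ext x
    rw [hD.mem_core_iff_closure h, mem_iInter]
    rfl
  rw [this]
  exact isClosed_iInter fun t => isClosed_closure.preimage (hD.contMDiff_flow t).continuous

theorem isOpen_symplectization : IsOpen (D.symplectization U) :=
  (hD.isClosed_core h).isOpen_compl

theorem core_subset : D.core U ⊆ U := by
  intro x hx
  rcases mem_or_exists h x with h1 | ⟨s, hs, p, hp, e⟩
  · exact h1
  · refine absurd ((hD.notMem_core_iff h).2 ⟨s, ?_⟩) (not_not.2 hx)
    rw [← e, hD.flow_neg_flow]
    exact hp

theorem mem_domain_iff {x : M} (hx : x ∉ D.core U) : x ∈ U ↔ D.hitTime P x < 0 := by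
  have h1 := hD.flow_hitTime_mem h hx
  constructor
  · intro hU
    by_contra! hc
    have := flow_notMem h h1 hc
    rw [hD.flow_flow_neg] at this
    exact this hU
  · intro ht
    have := hD.flow_neg_mem_of_mem_hypersurface h h1 (neg_pos.2 ht)
    rwa [neg_neg, hD.flow_flow_neg] at this

/-- The core consists of the points whose forward orbits are relatively compact. -/
theorem mem_core_iff_exists_compact {x : M} :
    x ∈ D.core U ↔ ∃ K : Set M, IsCompact K ∧ ∀ t > (0 : ℝ), D.flow t x ∈ K := by
  constructor
  · intro hx
    exact ⟨closure U, h.isCompact_closure, fun t _ => (hD.mem_core_iff_closure h).1 hx t⟩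
  · rintro ⟨K, hK, hx⟩
    by_contra hc
    -- The increasing open sets L^n(U) exhaust `M`, so one of them contains `K` and bounds the
    -- hitting time on `K \ Core`. Along the forward orbit of `x` the hitting time grows without
    -- bound.
    have hcov : K ⊆ ⋃ n : ℕ, D.flow (-(n : ℝ)) ⁻¹' U := by
      intro y _
      rw [mem_iUnion]
      by_cases hy : y ∈ D.core U
      · exact ⟨0, hD.core_subset h ((hD.flow_mem_core_iff h _).2 hy)⟩
      · obtain ⟨n, hn⟩ := exists_nat_gt (D.hitTime P y)
        refine ⟨n, ?_⟩
        rw [mem_preimage, hD.mem_domain_iff h ((hD.flow_mem_core_iff h _).not.2 hy),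
          hD.hitTime_flow h _ hy]
        linarith
    have hmono : Monotone fun n : ℕ => D.flow (-(n : ℝ)) ⁻¹' U := by
      intro m n hmn y hy
      have := hD.flow_neg_mem h hy (sub_nonneg.2 (Nat.cast_le (α := ℝ).2 hmn))
      rw [← hD.flow_add] at this
      rw [mem_preimage]
      convert this using 2
      ring
    obtain ⟨n, hn⟩ := hK.elim_directed_cover _
      (fun n => h.isOpen_domain.preimage (hD.contMDiff_flow _).continuous) hcov hmono.directed_le
    obtain ⟨N, hN⟩ := exists_nat_gt (n - D.hitTime P x)
    have h1 := hn (hx (max N 1) (by positivity))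
    have hc1 := (hD.flow_mem_core_iff h (max (N : ℝ) 1)).not.2 hc
    rw [mem_preimage, hD.mem_domain_iff h ((hD.flow_mem_core_iff h _).not.2 hc1),
      hD.hitTime_flow h _ hc1, hD.hitTime_flow h _ hc] at h1
    linarith [le_max_left (N : ℝ) 1]

/-- This is the implicit function theorem for g(L^{-t}x) = 0, with `g` a defining function of `P`.
Transversality makes the derivative of (t, x) ↦ (g(L^{-t}x), x) injective, and uniqueness of the
hitting time identifies the local solution with `hitTime`. -/
theorem contMDiffAt_hitTime {x₀ : M} (hx₀ : x₀ ∉ D.core U) :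
    ContMDiffAt I 𝓘(ℝ, ℝ) ∞ (D.hitTime P) x₀ := by
  let τ := D.hitTime P x₀
  have hp := hD.flow_hitTime_mem h hx₀
  obtain ⟨V, g, hVo, hpV, hg, hPV, hgL⟩ := h.transversal _ hp
  let k : ℝ × M → M := fun q => D.flow (-q.1) q.2
  have hk : ContMDiff (𝓘(ℝ, ℝ).prod I) I ∞ k := by
    have : ContMDiff (𝓘(ℝ, ℝ).prod I) (𝓘(ℝ, ℝ).prod I) ∞ (fun q : ℝ × M => (-q.1, q.2)) :=
      (contDiff_neg.contMDiff.comp contMDiff_fst).prodMk contMDiff_snd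
    exact hD.smooth_flow.comp this
  have hga : ContMDiffAt I 𝓘(ℝ, ℝ) ∞ g (k (τ, x₀)) := hg.contMDiffAt (hVo.mem_nhds hpV)
  let f : ℝ × M → ℝ × M := fun q => (g (k q), q.2)
  have hf1 : ContMDiffAt (𝓘(ℝ, ℝ).prod I) 𝓘(ℝ, ℝ) ∞ (fun q => g (k q)) (τ, x₀) :=
    hga.comp (τ, x₀) hk.contMDiffAt
  have hf : ContMDiffAt (𝓘(ℝ, ℝ).prod I) (𝓘(ℝ, ℝ).prod I) ∞ f (τ, x₀) :=
    hf1.prodMk contMDiffAt_snd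
  have hfx : f (τ, x₀) = (0, x₀) := by
    have : g (k (τ, x₀)) = 0 := (hPV.le ⟨hp, hpV⟩).2
    simp [f, this]
  have hder : mfderiv (𝓘(ℝ, ℝ).prod I) 𝓘(ℝ, ℝ) (fun q => g (k q)) (τ, x₀) ((1, 0) : ℝ × E) =
      -mfderiv I 𝓘(ℝ, ℝ) g (k (τ, x₀)) (D.L (k (τ, x₀))) := by
    have h1 : HasMFDerivAt 𝓘(ℝ, ℝ) (𝓘(ℝ, ℝ).prod I) (fun t : ℝ => (t, x₀)) τ
        (ContinuousLinearMap.inl ℝ ℝ E) :=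
      (hasMFDerivAt_id τ).prodMk (hasMFDerivAt_const x₀ τ)
    have h2 := HasMFDerivAt.comp τ (hf1.mdifferentiableAt (by simp)).hasMFDerivAt h1
    have h3 : HasMFDerivAt 𝓘(ℝ, ℝ) I (fun t : ℝ => D.flow (-t) x₀) τ
        (-((1 : ℝ →L[ℝ] ℝ).smulRight (D.L (k (τ, x₀))) : ℝ →L[ℝ] E) : ℝ →L[ℝ] E) := by
      have h4 : HasMFDerivAt 𝓘(ℝ, ℝ) 𝓘(ℝ, ℝ) (fun t : ℝ => -t) τ
        (-(ContinuousLinearMap.id ℝ ℝ)) := (hasFDerivAt_id τ).neg.hasMFDerivAt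
      have h5 := HasMFDerivAt.comp τ (hD.flow_integral x₀ (-τ)) h4
      refine HasMFDerivAt.congr_mfderiv h5 ?_
      refine ContinuousLinearMap.ext_ring ?_
      change (-(1 : ℝ)) • D.L (k (τ, x₀)) = -((1 : ℝ) • D.L (k (τ, x₀)))
      rw [neg_smul]
    have h6 := HasMFDerivAt.comp τ (hga.mdifferentiableAt (by simp)).hasMFDerivAt h3
    have h7 := congrArg (fun B : ℝ →L[ℝ] ℝ => B 1) (hasMFDerivAt_unique h2 h6)
    refine Eq.trans h7 ?_
    change mfderiv I 𝓘(ℝ, ℝ) g (k (τ, x₀)) (-((1 : ℝ) • D.L (k (τ, x₀)))) = _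
    rw [one_smul]
    exact (mfderiv I 𝓘(ℝ, ℝ) g (k (τ, x₀))).map_neg _
  have hinj : Function.Injective (mfderiv (𝓘(ℝ, ℝ).prod I) (𝓘(ℝ, ℝ).prod I) f (τ, x₀)) := by
    refine (injective_iff_map_eq_zero
      (mfderiv (𝓘(ℝ, ℝ).prod I) (𝓘(ℝ, ℝ).prod I) f (τ, x₀) : (ℝ × E) →L[ℝ] (ℝ × E))).2 ?_
    rintro ⟨s, v⟩ hsv
    have hprod := mfderiv_prodMk (hf1.mdifferentiableAt (by simp))
      (mdifferentiableAt_snd (I := 𝓘(ℝ, ℝ)) (I' := I) (x := (τ, x₀)))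
    have hsv' := congrArg (fun B : (ℝ × E) →L[ℝ] (ℝ × E) => B (s, v)) hprod
    have hz := hsv'.symm.trans hsv
    have hv : v = 0 := by
      have := congrArg Prod.snd hz
      rw [mfderiv_snd] at this
      exact this
    subst hv
    have hs : mfderiv (𝓘(ℝ, ℝ).prod I) 𝓘(ℝ, ℝ) (fun q => g (k q)) (τ, x₀) ((s, 0) : ℝ × E) = 0 :=
      congrArg Prod.fst hz
    have hs2 : ((s, 0) : ℝ × E) = s • ((1, 0) : ℝ × E) := by simp
    rw [hs2] at hs
    have hs3 := ((mfderiv (𝓘(ℝ, ℝ).prod I) 𝓘(ℝ, ℝ) (fun q => g (k q)) (τ, x₀)).map_smul s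
      ((1, 0) : ℝ × E)).symm.trans hs
    rw [hder] at hs3
    have hs4 : s = 0 := (smul_eq_zero.1 hs3).resolve_right (neg_ne_zero.2 hgL)
    rw [hs4]; rfl
  obtain ⟨σ, hσ, hσx, hσr⟩ := exists_local_section hf hinj rfl
  rw [hfx] at hσ hσx hσr
  have hin : ContMDiffAt I (𝓘(ℝ, ℝ).prod I) ∞ (fun x : M => ((0 : ℝ), x)) x₀ :=
    contMDiffAt_const.prodMk contMDiffAt_id
  have hT : ContMDiffAt I 𝓘(ℝ, ℝ) ∞ (fun x => (σ (0, x)).1) x₀ :=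
    contMDiffAt_fst.comp x₀ (ContMDiffAt.comp x₀ hσ hin)
  refine hT.congr_of_eventuallyEq ?_
  have h1 : ∀ᶠ x in 𝓝 x₀, k (σ (0, x)) ∈ V := by
    have hc : ContinuousAt (fun x => k (σ (0, x))) x₀ :=
      hk.continuous.continuousAt.comp (ContMDiffAt.comp x₀ hσ hin).continuousAt
    refine hc.eventually (hVo.mem_nhds ?_)
    change k (σ (0, x₀)) ∈ V
    rw [hσx]
    exact hpV
  filter_upwards [h1, hin.continuousAt.eventually hσr] with x hx1 hx2
  have h2 : g (k (σ (0, x))) = 0 := congrArg Prod.fst hx2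
  have h3 : (σ (0, x)).2 = x := congrArg Prod.snd hx2
  have h4 : k (σ (0, x)) ∈ P := (hPV.ge ⟨hx1, h2⟩).1
  apply hD.hitTime_eq h
  simp only [k] at h4
  rwa [h3] at h4

end Starshaped

end IsLiouville

end LiouvilleData

end LiouvilleBasics

/-! ## Hamiltonian vector fields and the Reeb flow -/

section Reeb

open Filter Topology

section FamilyComp

variable {E : Type*} [NormedAddCommGroup E] [NormedSpace ℝ E]
  {H : Type*} [TopologicalSpace H] {I : ModelWithCorners ℝ E H}
  {M : Type*} [TopologicalSpace M] [ChartedSpace H M]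
  {E' : Type*} [NormedAddCommGroup E'] [NormedSpace ℝ E']
  {H' : Type*} [TopologicalSpace H'] {I' : ModelWithCorners ℝ E' H'}
  {M' : Type*} [TopologicalSpace M'] [ChartedSpace H' M']
  {E'' : Type*} [NormedAddCommGroup E''] [NormedSpace ℝ E'']
  {H'' : Type*} [TopologicalSpace H''] {I'' : ModelWithCorners ℝ E'' H''}
  {M'' : Type*} [TopologicalSpace M''] [ChartedSpace H'' M'']

/-- The chain rule for `q ↦ φ_{s(q)}(u(q))`. -/
theorem mfderiv_family_comp {φ : ℝ → M → M'} {s : M'' → ℝ} {u : M'' → M} {q : M''}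
    (hφ : MDifferentiableAt (𝓘(ℝ, ℝ).prod I) I' (fun p : ℝ × M => φ p.1 p.2) (s q, u q))
    (hs : MDifferentiableAt I'' 𝓘(ℝ, ℝ) s q) (hu : MDifferentiableAt I'' I u q)
    {v : TangentSpace I'' q} {a : ℝ} (ha : mfderiv I'' 𝓘(ℝ, ℝ) s q v = a) :
    mfderiv I'' I' (fun q => φ (s q) (u q)) q v =
      a • mfderiv 𝓘(ℝ, ℝ) I' (fun t => φ t (u q)) (s q) (1 : ℝ) +
        mfderiv I I' (φ (s q)) (u q) (mfderiv I'' I u q v) := by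
  let Φ : ℝ × M → M' := fun p => φ p.1 p.2
  let B : ℝ × E →L[ℝ] E' := mfderiv (𝓘(ℝ, ℝ).prod I) I' Φ (s q, u q)
  subst ha
  let a : ℝ := mfderiv I'' 𝓘(ℝ, ℝ) s q v
  let w : E := mfderiv I'' I u q v
  have h1 : mfderiv I'' I' (fun q => φ (s q) (u q)) q v = B (a, w) := by
    have := HasMFDerivAt.comp q hφ.hasMFDerivAt (hs.hasMFDerivAt.prodMk hu.hasMFDerivAt)
    exact congrArg (fun A => A v) this.mfderiv
  have h2 : mfderiv 𝓘(ℝ, ℝ) I' (fun t => φ t (u q)) (s q) (1 : ℝ) = B (1, 0) := by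
    have h3 : HasMFDerivAt 𝓘(ℝ, ℝ) (𝓘(ℝ, ℝ).prod I) (fun t : ℝ => (t, u q)) (s q)
        (ContinuousLinearMap.inl ℝ ℝ E) :=
      (hasMFDerivAt_id (s q)).prodMk (hasMFDerivAt_const (u q) (s q))
    exact congrArg (fun A : ℝ →L[ℝ] E' => A (1 : ℝ))
      (HasMFDerivAt.comp (s q) hφ.hasMFDerivAt h3).mfderiv
  have h4 : mfderiv I I' (φ (s q)) (u q) (mfderiv I'' I u q v) = B (0, w) := by
    have h3 : HasMFDerivAt I (𝓘(ℝ, ℝ).prod I) (fun y : M => (s q, y)) (u q)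
        (ContinuousLinearMap.inr ℝ ℝ E) :=
      (hasMFDerivAt_const (s q) (u q)).prodMk (hasMFDerivAt_id (u q))
    exact congrArg (fun A : E →L[ℝ] E' => A w)
      (HasMFDerivAt.comp (u q) hφ.hasMFDerivAt h3).mfderiv
  rw [h1, h2, h4]
  have h5 : ((a, w) : ℝ × E) = a • ((1, 0) : ℝ × E) + (0, w) := by simp
  rw [h5]
  exact (B.map_add _ _).trans (congrArg (· + B (0, w)) (B.map_smul a _))

end FamilyComp

variable {E : Type*} [NormedAddCommGroup E] [NormedSpace ℝ E] [FiniteDimensional ℝ E]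
  {H : Type*} [TopologicalSpace H] {I : ModelWithCorners ℝ E H} [I.Boundaryless]
  {M : Type*} [TopologicalSpace M] [T2Space M] [ChartedSpace H M] [IsManifold I ∞ M]
  {D : LiouvilleData I M}
  {E' : Type*} [NormedAddCommGroup E'] [NormedSpace ℝ E']
  {H' : Type*} [TopologicalSpace H'] {I' : ModelWithCorners ℝ E' H'}
  {Q : Type*} [TopologicalSpace Q] [ChartedSpace H' Q]

theorem exists_equiv_mfderiv_extChartAt_symm (x₀ : M) {y : E} (hy : y ∈ (extChartAt I x₀).target) :
    ∃ B : E ≃L[ℝ] E, ∀ u : E, mfderiv 𝓘(ℝ, E) I (extChartAt I x₀).symm y u = B u := by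
  have hbij := isInvertible_mfderivWithin_extChartAt_symm (I := I) hy
  rw [I.range_eq_univ, mfderivWithin_univ] at hbij
  obtain ⟨B, hB⟩ := hbij
  exact ⟨B, fun u => by rw [← hB]; rfl⟩

namespace LiouvilleData

namespace IsLiouville

variable (hD : D.IsLiouville)
include hD

/-- Pull-back of the Liouville form under `q ↦ L^{s(q)} (u(q))`. -/
theorem α_flow_comp {s : Q → ℝ} {u : Q → M} {q : Q}
    (hs : MDifferentiableAt I' 𝓘(ℝ, ℝ) s q) (hu : MDifferentiableAt I' I u q)
    (v : TangentSpace I' q) :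
    D.α (D.flow (s q) (u q)) (mfderiv I' I (fun q => D.flow (s q) (u q)) q v) =
      Real.exp (s q) * D.α (u q) (mfderiv I' I u q v) := by
  rw [mfderiv_family_comp (hD.smooth_flow.mdifferentiableAt (by simp)) hs hu rfl,
    hD.mfderiv_flow_orbit]
  refine ((D.α (D.flow (s q) (u q))).map_add _ _).trans ?_
  rw [hD.pullback_flow]
  refine (congrArg (· + _) ((D.α (D.flow (s q) (u q))).map_smul _ _)).trans ?_
  rw [hD.α_L]
  exact (congrArg (· + _) (smul_zero _)).trans (zero_add _)

/-- The Hamiltonian vector field of a smooth function exists and is smooth. -/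
theorem exists_hamiltonianField {K : M → ℝ} (hK : ContMDiff I 𝓘(ℝ, ℝ) ∞ K) :
    ∃ X : ∀ x : M, TangentSpace I x,
      ContMDiff I I.tangent ∞ (fun x => (⟨x, X x⟩ : TangentBundle I M)) ∧
      ∀ x w, D.symp x (X x) w = -(mfderiv I 𝓘(ℝ, ℝ) K x w : ℝ) := by
  have : CompleteSpace E := FiniteDimensional.complete ℝ E
  have hex : ∀ x : M, ∃ v : TangentSpace I x, ∀ w, D.symp x v w =
      -(mfderiv I 𝓘(ℝ, ℝ) K x w : ℝ) := by
    intro x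
    let T : E →ₗ[ℝ] (Module.Dual ℝ E) := D.symp x
    have hT : Function.Injective T := by
      refine (injective_iff_map_eq_zero T).2 fun v hv => hD.nondegenerate x v fun w => ?_
      exact congrArg (fun l : Module.Dual ℝ E => l w) hv
    have hsurj : Function.Surjective T :=
      (LinearMap.injective_iff_surjective_of_finrank_eq_finrank
        (Subspace.dual_finrank_eq (K := ℝ) (V := E)).symm).1 hT
    obtain ⟨v, hv⟩ := hsurj (-(mfderiv I 𝓘(ℝ, ℝ) K x : E →L[ℝ] ℝ).toLinearMap)
    exact ⟨v, fun w => congrArg (fun l : Module.Dual ℝ E => l w) hv⟩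
  choose X hX using hex
  refine ⟨X, ?_, hX⟩
  intro x₀
  let e := extChartAt I x₀
  have ho : IsOpen e.target := isOpen_extChartAt_target x₀
  let A : E → E →L[ℝ] ℝ := chartCovector D.α x₀
  have hA : ContDiffOn ℝ ∞ A e.target := contDiffOn_chartCovector hD.smooth_α x₀
  have hA' : ContDiffOn ℝ ∞ (fderiv ℝ A) e.target :=
    hA.fderiv_of_isOpen ho (by simp)
  -- The smoothness of the symplectic form is recovered from that of α: in the chart it is the
  -- antisymmetrized derivative of the covector field `A`.
  let Ω : E → E →L[ℝ] E →L[ℝ] ℝ := fun y => fderiv ℝ A y - (fderiv ℝ A y).flip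
  have hΩ : ContDiffOn ℝ ∞ Ω e.target :=
    contDiffOn_clm_apply.2 fun v => contDiffOn_clm_apply.2 fun w =>
      ((hA'.clm_apply contDiffOn_const).clm_apply contDiffOn_const).sub
        ((hA'.clm_apply (contDiffOn_const (c := w))).clm_apply (contDiffOn_const (c := v)))
  have hes : ContMDiffOn 𝓘(ℝ, E) I ∞ e.symm e.target := contMDiffOn_extChartAt_symm x₀
  have hΩs : ∀ y ∈ e.target, ∀ v w : E, Ω y v w = D.symp (e.symm y)
      (mfderiv 𝓘(ℝ, E) I e.symm y v) (mfderiv 𝓘(ℝ, E) I e.symm y w) := by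
    intro y hy v w
    have h1 := (hD.exact.pullback_apply hD.smooth_α (hes.contMDiffAt (ho.mem_nhds hy)) v w).2
    rw [← h1]
    have h2 : ∀ u : E, (fun z => D.α (e.symm z) (mfderiv 𝓘(ℝ, E) I e.symm z u)) =
        fun z => A z u := by
      intro u
      funext z
      change _ = chartForm D.α x₀ z u
      simp only [chartForm]
      rw [I.range_eq_univ, mfderivWithin_univ]
    have h3 : ∀ u u' : E, fderiv ℝ (fun z => A z u) y u' = fderiv ℝ A y u' u := by
      intro u u'
      have := ((hA.contDiffAt (ho.mem_nhds hy)).differentiableAt (by simp)).hasFDerivAt.clm_apply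
        (hasFDerivAt_const u y)
      rw [this.fderiv]
      simp
    rw [h2, h2, h3, h3]
    rfl
  have hinv : ∀ y ∈ e.target, (Ω y).IsInvertible := by
    intro y hy
    obtain ⟨B, hB⟩ := exists_equiv_mfderiv_extChartAt_symm (I := I) x₀ hy
    have hB2 : ∀ v w : E, Ω y v w = D.symp (e.symm y) (B v : E) (B w : E) := fun v w =>
      (hΩs y hy v w).trans (congrArg₂ (fun a b : E => D.symp (e.symm y) a b) (hB v) (hB w))
    have hinj : Function.Injective (Ω y) := by
      refine (injective_iff_map_eq_zero (Ω y)).2 fun v hv => ?_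
      have h0 : B v = 0 := by
        refine hD.nondegenerate (e.symm y) (B v) fun (w : E) => ?_
        refine (congrArg (fun c : E => D.symp (e.symm y) (B v : E) c)
          (B.apply_symm_apply w)).symm.trans ((hB2 v (B.symm w)).symm.trans ?_)
        rw [hv]
        rfl
      exact B.map_eq_zero_iff.1 h0
    have hdim : Module.finrank ℝ E = Module.finrank ℝ (E →L[ℝ] ℝ) := by
      rw [← (LinearMap.toContinuousLinearMap (𝕜 := ℝ) (E := E) (F' := ℝ)).finrank_eq]
      exact (Subspace.dual_finrank_eq (K := ℝ) (V := E)).symm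
    refine ⟨(LinearEquiv.ofInjectiveOfFinrankEq (Ω y).toLinearMap hinj
      hdim).toContinuousLinearEquiv, ?_⟩
    ext v w
    rfl
  let κ : E → ℝ := K ∘ e.symm
  have hκ : ContDiffOn ℝ ∞ κ e.target :=
    contMDiffOn_iff_contDiffOn.1 (hK.comp_contMDiffOn hes)
  have hκ' : ContDiffOn ℝ ∞ (fderiv ℝ κ) e.target := hκ.fderiv_of_isOpen ho (by simp)
  -- Inversion of operators is smooth, so `Y` is smooth; by nondegeneracy it must be the chart
  -- expression of the pointwise solution `X`.
  let Y : E → E := fun y => (Ω y).inverse (-fderiv ℝ κ y)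
  have hY : ContDiffOn ℝ ∞ Y e.target := by
    intro y hy
    have h1 : ContDiffAt ℝ ∞ (fun z => (Ω z).inverse) y :=
      ContDiffAt.comp y (hinv y hy).contDiffAt_map_inverse (hΩ.contDiffAt (ho.mem_nhds hy))
    exact (h1.clm_apply (hκ'.contDiffAt (ho.mem_nhds hy)).neg).contDiffWithinAt
  have hsec := contMDiffOn_mfderiv_section ho hes (v := fun y => Y y)
    (contMDiffOn_vectorSpace_iff_contDiffOn.2 hY)
  have hec : ContMDiffOn I 𝓘(ℝ, E) ∞ e e.source := by
    rw [extChartAt_source]; exact contMDiffOn_extChartAt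
  have hcomp := hsec.comp hec fun x hx => e.map_source hx
  have hXY : ∀ x ∈ e.source, X x = mfderiv 𝓘(ℝ, E) I e.symm (e x) (Y (e x)) := by
    intro x hx
    have hy : e x ∈ e.target := e.map_source hx
    obtain ⟨B, hB⟩ := exists_equiv_mfderiv_extChartAt_symm (I := I) x₀ hy
    have hB2 : ∀ v w : E, Ω (e x) v w = D.symp (e.symm (e x)) (B v : E) (B w : E) := fun v w =>
      (hΩs (e x) hy v w).trans
        (congrArg₂ (fun a b : E => D.symp (e.symm (e x)) a b) (hB v) (hB w))
    have hwd : ∀ x', x' = x → (X x : E) = (X x' : E) := by rintro _ rfl; rfl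
    have hxx : e.symm (e x) = x := e.left_inv hx
    refine (hwd _ hxx).trans ?_
    refine Eq.trans ?_ (hB (Y (e x))).symm
    have h1 : Ω (e x) (Y (e x)) = -fderiv ℝ κ (e x) := by
      obtain ⟨C, hC⟩ := hinv (e x) hy
      simp only [Y, ← hC, ContinuousLinearMap.inverse_equiv]
      exact C.apply_symm_apply _
    have h3 : ∀ w : E, fderiv ℝ κ (e x) (B.symm w) =
        mfderiv I 𝓘(ℝ, ℝ) K (e.symm (e x)) w := by
      intro w
      have hd := mfderiv_comp (e x) (hK.mdifferentiableAt (by simp))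
        ((hes.contMDiffAt (ho.mem_nhds hy)).mdifferentiableAt (by simp))
      rw [← mfderiv_eq_fderiv]
      refine (congrArg (fun A => A (B.symm w)) hd).trans ?_
      exact congrArg (mfderiv I 𝓘(ℝ, ℝ) K (e.symm (e x)))
        ((hB (B.symm w)).trans (B.apply_symm_apply w))
    refine sub_eq_zero.1 (hD.nondegenerate (e.symm (e x))
      (X (e.symm (e x)) - (show TangentSpace I (e.symm (e x)) from B (Y (e x)))) fun (w : E) => ?_)
    refine (LinearMap.map_sub₂ (D.symp (e.symm (e x))) _ _ w).trans (sub_eq_zero.2 ?_)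
    refine (hX (e.symm (e x)) w).trans (Eq.trans ?_ ((hB2 (Y (e x)) (B.symm w)).trans
      (congrArg (fun c : E => D.symp (e.symm (e x)) (B (Y (e x)) : E) c)
        (B.apply_symm_apply w))))
    rw [h1]
    exact congrArg Neg.neg (h3 w).symm
  have hat : ContMDiffAt I I.tangent ∞ (fun x => (⟨e.symm (e x),
      mfderiv 𝓘(ℝ, E) I e.symm (e x) (Y (e x))⟩ : TangentBundle I M)) x₀ :=
    hcomp.contMDiffAt (extChartAt_source_mem_nhds x₀)
  refine hat.congr_of_eventuallyEq ?_
  filter_upwards [extChartAt_source_mem_nhds (I := I) x₀] with x hx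
  rw [hXY x hx]
  have key : ∀ x', x' = x → ∀ u : E, (⟨x, u⟩ : TangentBundle I M) = ⟨x', u⟩ := by
    rintro _ rfl _; rfl
  exact key _ (e.left_inv hx) _

end IsLiouville

end LiouvilleData

end Reeb

/-! ### The Reeb flow of a starshaped hypersurface. -/

section ReebFlow

open Filter Topology

variable {E : Type*} [NormedAddCommGroup E] [NormedSpace ℝ E] [FiniteDimensional ℝ E]
  {H : Type*} [TopologicalSpace H] {I : ModelWithCorners ℝ E H} [I.Boundaryless]
  {M : Type*} [TopologicalSpace M] [T2Space M] [ChartedSpace H M] [IsManifold I ∞ M]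
  {D : LiouvilleData I M}

namespace LiouvilleData

/-- A smooth function of a real variable with support in `[-1, 1]` which is the exponential
function on `[-1/2, 1/2]`. -/
def bumpExp (s : ℝ) : ℝ :=
  (⟨1 / 2, 1, by norm_num, by norm_num⟩ : ContDiffBump (0 : ℝ)) s * Real.exp s

theorem contDiff_bumpExp : ContDiff ℝ ∞ bumpExp :=
  (ContDiffBump.contDiff _).mul Real.contDiff_exp

theorem bumpExp_of_abs_le {s : ℝ} (hs : |s| ≤ 1 / 2) : bumpExp s = Real.exp s := by
  rw [bumpExp, ContDiffBump.one_of_mem_closedBall, one_mul]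
  simpa using hs

theorem bumpExp_of_le_abs {s : ℝ} (hs : 1 ≤ |s|) : bumpExp s = 0 := by
  rw [bumpExp, ContDiffBump.zero_of_le_dist, zero_mul]
  simpa using hs

open Classical in
/-- A compactly supported Hamiltonian which agrees with the radial coordinate near the starshaped
hypersurface. -/
def cutoffRadius (D : LiouvilleData I M) (P U : Set M) (x : M) : ℝ :=
  if x ∈ D.core U then 0 else bumpExp (D.hitTime P x)

/-- `G` is the Reeb flow of the starshaped hypersurface `P`, extended equivariantly to the
symplectization. -/
structure IsReebFlow (D : LiouvilleData I M) (P U : Set M) (G : ℝ → M → M) : Prop where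
  smooth : ContMDiffOn (𝓘(ℝ, ℝ).prod I) I ∞ (fun p : ℝ × M => G p.1 p.2)
    (univ ×ˢ D.symplectization U)
  mapsTo : ∀ t, ∀ x ∈ D.symplectization U, G t x ∈ D.symplectization U
  zero : ∀ x ∈ D.symplectization U, G 0 x = x
  add : ∀ s t, ∀ x ∈ D.symplectization U, G (s + t) x = G s (G t x)
  hitTime : ∀ t, ∀ x ∈ D.symplectization U, D.hitTime P (G t x) = D.hitTime P x
  flow : ∀ t r, ∀ x ∈ D.symplectization U, G t (D.flow r x) = D.flow r (G t x)
  pullback : ∀ t, ∀ x ∈ D.symplectization U, ∀ v : TangentSpace I x,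
    D.α (G t x) (mfderiv I I (G t) x v) = D.α x v
  α_velocity : ∀ t, ∀ x ∈ D.symplectization U,
    D.α (G t x) (mfderiv 𝓘(ℝ, ℝ) I (fun t => G t x) t (1 : ℝ)) = Real.exp (D.hitTime P x)

namespace IsLiouville

variable (hD : D.IsLiouville) {P U : Set M} (h : D.IsStarshaped P U)
include hD h

theorem contMDiffOn_hitTime : ContMDiffOn I 𝓘(ℝ, ℝ) ∞ (D.hitTime P) (D.symplectization U) :=
  fun _ hx => (hD.contMDiffAt_hitTime h hx).contMDiffWithinAt

theorem cutoffRadius_eventuallyEq {x : M} (hx : x ∉ D.core U) :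
    D.cutoffRadius P U =ᶠ[𝓝 x] fun y => bumpExp (D.hitTime P y) := by
  filter_upwards [(hD.isOpen_symplectization h).mem_nhds hx] with y hy
  exact if_neg hy

/-- The only issue is at the core. The open set L^{-1}(U) contains the core, and off the core its
points have hitting time below `-1`, where `bumpExp` vanishes. -/
theorem contMDiff_cutoffRadius : ContMDiff I 𝓘(ℝ, ℝ) ∞ (D.cutoffRadius P U) := by
  intro x
  by_cases hx : x ∈ D.core U
  · have ho : IsOpen (D.flow 1 ⁻¹' U) := h.isOpen_domain.preimage (hD.contMDiff_flow 1).continuous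
    have : D.cutoffRadius P U =ᶠ[𝓝 x] fun _ => (0 : ℝ) := by
      filter_upwards [ho.mem_nhds (hx 1 one_pos)] with y hy
      by_cases hyc : y ∈ D.core U
      · exact if_pos hyc
      · refine (if_neg hyc).trans (bumpExp_of_le_abs ?_)
        have h1 := (hD.mem_domain_iff h (mt (hD.flow_mem_core_iff h 1).1 hyc)).1 hy
        rw [hD.hitTime_flow h 1 hyc] at h1
        rw [abs_of_neg (by linarith)]
        linarith
    exact contMDiffAt_const.congr_of_eventuallyEq this
  · exact ((contDiff_bumpExp.contMDiff).contMDiffAt.comp x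
      (hD.contMDiffAt_hitTime h hx)).congr_of_eventuallyEq (hD.cutoffRadius_eventuallyEq h hx)

/-- Beyond L^1(closure U) the hitting time is at least `1`. Hence the Hamiltonian field has compact
support and a global flow. -/
theorem cutoffRadius_eventuallyEq_zero {x : M} (hx : x ∉ D.flow 1 '' closure U) :
    D.cutoffRadius P U =ᶠ[𝓝 x] fun _ => (0 : ℝ) := by
  have ho : IsOpen (D.flow (-1) ⁻¹' (closure U)ᶜ) :=
    isClosed_closure.isOpen_compl.preimage (hD.contMDiff_flow (-1)).continuous
  have hx' : D.flow (-1) x ∉ closure U := fun hc => hx ⟨_, hc, hD.flow_flow_neg 1 x⟩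
  filter_upwards [ho.mem_nhds hx'] with y hy
  have hy' : D.flow (-1) y ∉ U := fun hc => hy (subset_closure hc)
  have hyc' : D.flow (-1) y ∉ D.core U := fun hc => hy' (hD.core_subset h hc)
  have hyc : y ∉ D.core U := mt (hD.flow_mem_core_iff h (-1)).2 hyc'
  refine (if_neg hyc).trans (bumpExp_of_le_abs ?_)
  have h1 := mt (hD.mem_domain_iff h hyc').2 hy'
  rw [hD.hitTime_flow h (-1) hyc] at h1
  exact (by linarith : (1 : ℝ) ≤ D.hitTime P y).trans (le_abs_self _)

theorem eventually_abs_hitTime {p : M} (hp : p ∈ P) :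
    ∀ᶠ y in 𝓝 p, y ∉ D.core U ∧ |D.hitTime P y| < 1 / 2 := by
  have hpc := hD.notMem_core_of_mem h hp
  have h1 : ContinuousAt (D.hitTime P) p := (hD.contMDiffAt_hitTime h hpc).continuousAt
  have h2 : ∀ᶠ y in 𝓝 p, |D.hitTime P y| < 1 / 2 :=
    (continuous_abs.continuousAt.comp h1).eventually_lt continuousAt_const
      (by simp [hD.hitTime_of_mem h hp])
  exact ((hD.isOpen_symplectization h).eventually_mem hpc).and h2

/-- Here α(X) = ω(L, X) = dK(L) with K = `cutoffRadius`. Near `P` one has K = e^τ, and τ increases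
at unit speed along L, so dK(L) = K. -/
theorem α_hamiltonianField {X : ∀ x : M, TangentSpace I x}
    (hX : ∀ x w, D.symp x (X x) w = -(mfderiv I 𝓘(ℝ, ℝ) (D.cutoffRadius P U) x w : ℝ)) {y : M}
    (hy : y ∉ D.core U) (hy' : |D.hitTime P y| < 1 / 2) :
    D.α y (X y) = Real.exp (D.hitTime P y) := by
  change D.symp y (D.L y) (X y) = _
  refine (hD.symp_skew _ _ _).trans ((congrArg Neg.neg (hX y (D.L y))).trans
    ((neg_neg (mfderiv I 𝓘(ℝ, ℝ) (D.cutoffRadius P U) y (D.L y) : ℝ)).trans ?_))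
  have h1 := hasDerivAt_comp_curve (t := 0)
    ((hD.contMDiff_cutoffRadius h).mdifferentiableAt (by simp)) (hD.flow_integral y 0)
  have h2 : (fun s => D.cutoffRadius P U (D.flow s y)) =ᶠ[𝓝 0]
      fun s => Real.exp (D.hitTime P y + s) := by
    have : ∀ᶠ s in 𝓝 (0 : ℝ), |D.hitTime P y + s| < 1 / 2 :=
      (by fun_prop : ContinuousAt (fun s => |D.hitTime P y + s|) 0).eventually_lt
        continuousAt_const (by simpa using hy')
    filter_upwards [this] with s hs
    refine (if_neg (mt (hD.flow_mem_core_iff h s).1 hy)).trans ?_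
    rw [hD.hitTime_flow h s hy, bumpExp_of_abs_le hs.le]
  have h3 : HasDerivAt (fun s => Real.exp (D.hitTime P y + s)) (Real.exp (D.hitTime P y + 0)) 0 := by
    simpa using ((hasDerivAt_id (0 : ℝ)).const_add (D.hitTime P y)).exp
  have h4 := h1.unique (h3.congr_of_eventuallyEq h2)
  rw [add_zero] at h4
  have key : ∀ y', y' = y → (mfderiv I 𝓘(ℝ, ℝ) (D.cutoffRadius P U) y' (D.L y') : ℝ) =
      mfderiv I 𝓘(ℝ, ℝ) (D.cutoffRadius P U) y (D.L y) := by
    rintro _ rfl; rfl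
  exact (key _ (hD.flow_zero y)).symm.trans h4

/-- Near a starshaped hypersurface there is a flow which preserves it and restricts to its Reeb
flow. -/
theorem exists_flow_hypersurface :
    ∃ φ : ℝ → M → M, ContMDiff (𝓘(ℝ, ℝ).prod I) I ∞ (fun p : ℝ × M => φ p.1 p.2) ∧
      (∀ x, φ 0 x = x) ∧ (∀ s t x, φ (s + t) x = φ s (φ t x)) ∧
      (∀ t, ∀ p ∈ P, φ t p ∈ P) ∧
      (∀ t, ∀ p ∈ P, ∀ v : TangentSpace I p, D.α (φ t p) (mfderiv I I (φ t) p v) = D.α p v) ∧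
      ∀ t, ∀ p ∈ P, D.α (φ t p) (mfderiv 𝓘(ℝ, ℝ) I (fun t => φ t p) t (1 : ℝ)) = 1 := by
  let K := D.cutoffRadius P U
  have hK : ContMDiff I 𝓘(ℝ, ℝ) ∞ K := hD.contMDiff_cutoffRadius h
  have hKd : ∀ x, MDifferentiableAt I 𝓘(ℝ, ℝ) K x := fun x => hK.mdifferentiableAt (by simp)
  obtain ⟨X, hXs, hX⟩ := hD.exists_hamiltonianField hK
  have hcpt : IsCompact (D.flow 1 '' closure U) :=
    h.isCompact_closure.image (hD.contMDiff_flow 1).continuous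
  have hX0 : ∀ x ∉ D.flow 1 '' closure U, X x = 0 := by
    intro x hx
    refine hD.nondegenerate x _ fun w => ?_
    rw [hX, (hD.cutoffRadius_eventuallyEq_zero h hx).mfderiv_eq, mfderiv_const]
    exact neg_zero
  obtain ⟨φ, hφ, hφ0, hφi⟩ := exists_global_flow hXs hcpt hX0
  have hKφ : ∀ t x, K (φ t x) = K x := by
    intro t x
    have hder : ∀ t, HasDerivAt (fun s => K (φ s x)) 0 t := by
      intro t
      have h1 := hasDerivAt_comp_curve (hKd _) (hφi x t)
      have h2 : (mfderiv I 𝓘(ℝ, ℝ) K (φ t x) (X (φ t x)) : ℝ) = 0 := by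
        have h3 := self_eq_neg.1 (hD.symp_skew (φ t x) (X (φ t x)) (X (φ t x)))
        exact neg_eq_zero.1 ((hX (φ t x) (X (φ t x))).symm.trans h3)
      rwa [h2] at h1
    have := is_const_of_deriv_eq_zero (fun t => (hder t).differentiableAt)
      (fun t => (hder t).deriv) t 0
    rwa [hφ0] at this
  have hvel : ∀ t x, mfderiv 𝓘(ℝ, ℝ) I (fun t => φ t x) t (1 : ℝ) = X (φ t x) := fun t x => by
    rw [(hφi x t).mfderiv]
    exact one_smul ℝ _
  have hφt : ∀ t, ContMDiff I I ∞ (φ t) := fun t =>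
    hφ.comp (contMDiff_const.prodMk contMDiff_id : ContMDiff I (𝓘(ℝ, ℝ).prod I) ∞
      fun x : M => (t, x))
  have hφx : ∀ x, Continuous (fun t => φ t x) := fun x =>
    hφ.continuous.comp (by fun_prop : Continuous fun t : ℝ => (t, x))
  have hKP : ∀ y, y ∉ D.core U → |D.hitTime P y| < 1 / 2 → K y = Real.exp (D.hitTime P y) :=
    fun y h1 h2 => (if_neg h1).trans (bumpExp_of_abs_le h2.le)
  -- The Hamiltonian K is conserved and determines τ near `P`. So the set of times at which the
  -- orbit lies on `P` is open as well as closed, hence all of ℝ.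
  have hP : ∀ t, ∀ p ∈ P, φ t p ∈ P := by
    intro t p hp
    have hcl : IsClosed {t | φ t p ∈ P} := h.isCompact.isClosed.preimage (hφx p)
    have hop : IsOpen {t | φ t p ∈ P} := by
      rw [isOpen_iff_mem_nhds]
      intro t ht
      filter_upwards [(hφx p).continuousAt.eventually (hD.eventually_abs_hitTime h ht)] with s hs
      have h1 := hKP _ hs.1 hs.2
      rw [hKφ, hKP p (hD.notMem_core_of_mem h hp) (by simp [hD.hitTime_of_mem h hp])] at h1
      have h2 := Real.exp_injective h1
      rw [hD.hitTime_of_mem h hp] at h2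
      have h3 := hD.flow_hitTime_mem h hs.1
      rwa [← h2, neg_zero, hD.flow_zero] at h3
    have := IsClopen.eq_univ ⟨hcl, hop⟩ ⟨0, by simpa [hφ0] using hp⟩
    exact this.symm.subset (mem_univ t)
  refine ⟨φ, hφ, hφ0, flow_add_of_isMIntegralCurve hXs hφ0 hφi, hP, ?_, ?_⟩
  · intro t p hp v
    have hder : ∀ t, HasDerivAt (fun t => D.α (φ t p) (mfderiv I I (φ t) p v)) 0 t := by
      intro t
      -- In a whole neighbourhood of `p` one has α(X) ∘ φ_t = K ∘ φ_t = K, so the two terms of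
      -- Cartan's formula are -dK(dφ_t v) and dK(v). Their sum is zero by conservation of K.
      have hev : (fun x => D.α (φ t x) (mfderiv 𝓘(ℝ, ℝ) I (fun t => φ t x) t (1 : ℝ))) =ᶠ[𝓝 p]
          K := by
        filter_upwards [(hφt t).continuous.continuousAt.eventually
          (hD.eventually_abs_hitTime h (hP t p hp))] with x hx
        rw [hvel, hD.α_hamiltonianField h hX hx.1 hx.2, ← hKφ t x, hKP _ hx.1 hx.2]
      have h1 := hD.exact.hasDerivAt_pullback hD.smooth_α (φ := φ) (t₀ := t) (x₀ := p)
        hφ.contMDiffAt v ((hKd p).hasMFDerivAt.congr_of_eventuallyEq hev)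
      rw [hvel, hX] at h1
      have h2 : (mfderiv I 𝓘(ℝ, ℝ) K (φ t p) (mfderiv I I (φ t) p v) : ℝ) =
          mfderiv I 𝓘(ℝ, ℝ) K p v := by
        have h3 : K ∘ φ t = K := funext (hKφ t)
        have h4 := mfderiv_comp p (hKd (φ t p)) ((hφt t).mdifferentiableAt (by simp))
        have key : ∀ k : M → ℝ, k = K → ∀ A : E →L[ℝ] ℝ, (mfderiv I 𝓘(ℝ, ℝ) k p : E →L[ℝ] ℝ) = A →
            A v = (mfderiv I 𝓘(ℝ, ℝ) K p : E →L[ℝ] ℝ) v := by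
          rintro _ rfl _ rfl; rfl
        exact key _ h3 _ h4
      exact h1.congr_deriv (neg_add_eq_zero.2 h2)
    have := is_const_of_deriv_eq_zero (fun t => (hder t).differentiableAt)
      (fun t => (hder t).deriv) t 0
    refine this.trans ?_
    have key : ∀ f : M → M, f = id → D.α (f p) (mfderiv I I f p v) = D.α p v := by
      rintro _ rfl
      rw [mfderiv_id]
      rfl
    exact key _ (funext hφ0)
  · intro t p hp
    rw [hvel, hD.α_hamiltonianField h hX (hD.notMem_core_of_mem h (hP t p hp))
      (by simp [hD.hitTime_of_mem h (hP t p hp)]), hD.hitTime_of_mem h (hP t p hp), Real.exp_zero]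

/-- The flow on `P` is conjugated by the Liouville flow: G_t = L^τ ∘ φ_t ∘ L^{-τ}. Equivariance and
conservation of τ are then built in. The statements on α follow from those on `P`, because L^τ
multiplies α by e^τ and the variation of τ contributes only a multiple of α(L) = 0. -/
theorem exists_reebFlow : ∃ G : ℝ → M → M, D.IsReebFlow P U G := by
  obtain ⟨φ, hφ, hφ0, hφa, hφP, hφα, hφv⟩ := hD.exists_flow_hypersurface h
  let τ := D.hitTime P
  have hS := hD.isOpen_symplectization h
  let pr : M → M := fun x => D.flow (-τ x) x
  have hpr : ∀ x ∈ D.symplectization U, pr x ∈ P := fun x hx => hD.flow_hitTime_mem h hx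
  have hprP : ∀ r, ∀ p ∈ P, pr (D.flow r p) = p := by
    intro r p hp
    simp only [pr, τ]
    rw [hD.hitTime_flow h r (hD.notMem_core_of_mem h hp), hD.hitTime_of_mem h hp, zero_add,
      hD.flow_neg_flow]
  have hτs := hD.contMDiffOn_hitTime h
  have hprs : ContMDiffOn I I ∞ pr (D.symplectization U) :=
    hD.smooth_flow.comp_contMDiffOn ((contDiff_neg.contMDiff.comp_contMDiffOn hτs).prodMk contMDiffOn_id)
  let G : ℝ → M → M := fun t x => D.flow (τ x) (φ t (pr x))
  have hτG : ∀ t, ∀ x ∈ D.symplectization U, τ (G t x) = τ x := by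
    intro t x hx
    have h1 := hφP t _ (hpr x hx)
    simp only [G, τ]
    rw [hD.hitTime_flow h _ (hD.notMem_core_of_mem h h1), hD.hitTime_of_mem h h1, zero_add]
  have hprG : ∀ t, ∀ x ∈ D.symplectization U, pr (G t x) = φ t (pr x) := fun t x hx =>
    hprP _ _ (hφP t _ (hpr x hx))
  have hφt : ∀ t, ContMDiff I I ∞ (φ t) := fun t =>
    hφ.comp (contMDiff_const.prodMk contMDiff_id : ContMDiff I (𝓘(ℝ, ℝ).prod I) ∞
      fun x : M => (t, x))
  refine ⟨G, ?_, ?_, ?_, ?_, hτG, ?_, ?_, ?_⟩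
  · have h2 : ContMDiffOn (𝓘(ℝ, ℝ).prod I) I ∞ (fun p : ℝ × M => p.2)
        (univ ×ˢ D.symplectization U) := contMDiffOn_snd
    have hm : MapsTo (fun p : ℝ × M => p.2) (univ ×ˢ D.symplectization U)
        (D.symplectization U) := fun p hp => hp.2
    exact hD.smooth_flow.comp_contMDiffOn ((hτs.comp h2 hm).prodMk
      (hφ.comp_contMDiffOn (contMDiffOn_fst.prodMk (hprs.comp h2 hm))))
  · intro t x hx
    exact mt (hD.flow_mem_core_iff h _).1 (hD.notMem_core_of_mem h (hφP t _ (hpr x hx)))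
  · intro x hx
    change D.flow (τ x) (φ 0 (pr x)) = x
    rw [hφ0]
    exact hD.flow_flow_neg _ _
  · intro s t x hx
    change D.flow (τ x) (φ (s + t) (pr x)) = D.flow (τ (G t x)) (φ s (pr (G t x)))
    rw [hτG t x hx, hprG t x hx, hφa]
  · intro t r x hx
    have h1 : τ (D.flow r x) = r + τ x := by rw [add_comm]; exact hD.hitTime_flow h r hx
    have h2 : pr (D.flow r x) = pr x := by
      change D.flow (-τ (D.flow r x)) (D.flow r x) = D.flow (-τ x) x
      rw [h1, ← hD.flow_add]
      congr 1
      ring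
    change D.flow (τ (D.flow r x)) (φ t (pr (D.flow r x))) = D.flow r (D.flow (τ x) (φ t (pr x)))
    rw [h1, h2, hD.flow_add]
  · intro t x hx
    have hτd : MDifferentiableAt I 𝓘(ℝ, ℝ) τ x :=
      (hD.contMDiffAt_hitTime h hx).mdifferentiableAt (by simp)
    have hprd : MDifferentiableAt I I pr x :=
      (hprs.contMDiffAt (hS.mem_nhds hx)).mdifferentiableAt (by simp)
    intro v
    have hφd : MDifferentiableAt I I (φ t) (pr x) := (hφt t).mdifferentiableAt (by simp)
    have h1 := hD.α_flow_comp hτd (hφd.comp x hprd) v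
    have h2 := hD.α_flow_comp hτd hprd v
    refine h1.trans (Eq.trans ?_ (h2.symm.trans ?_))
    · refine congrArg (Real.exp (τ x) * ·) ?_
      refine Eq.trans ?_ (hφα t _ (hpr x hx) (mfderiv I I pr x v))
      have h3 := mfderiv_comp x hφd hprd
      exact congrArg (fun A : E →L[ℝ] E => D.α (φ t (pr x)) (A v)) h3
    · have key : ∀ f : M → M, f = id → D.α (f x) (mfderiv I I f x v) = D.α x v := by
        rintro _ rfl
        rw [mfderiv_id]
        rfl
      exact key _ (funext fun y => hD.flow_flow_neg _ y)
  · intro t x hx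
    have h1 : MDifferentiableAt 𝓘(ℝ, ℝ) I (fun t => φ t (pr x)) t :=
      (hφ.comp (contMDiff_id.prodMk contMDiff_const : ContMDiff 𝓘(ℝ, ℝ) (𝓘(ℝ, ℝ).prod I) ∞
        fun t : ℝ => (t, pr x))).mdifferentiableAt (by simp)
    have h2 := hD.α_flow_comp (s := fun _ : ℝ => τ x) (q := t) mdifferentiableAt_const h1 (1 : ℝ)
    refine h2.trans ?_
    have h3 := hφv t _ (hpr x hx)
    exact (congrArg (Real.exp (τ x) * ·) h3).trans (mul_one _)

end IsLiouville

end LiouvilleData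

end ReebFlow

/-! ### The Liouville structure of the stabilization. -/

section Stabilization

open Filter Topology

variable {E : Type*} [NormedAddCommGroup E] [NormedSpace ℝ E] [FiniteDimensional ℝ E]
  {H : Type*} [TopologicalSpace H] {I : ModelWithCorners ℝ E H} [I.Boundaryless]
  {M : Type*} [TopologicalSpace M] [T2Space M] [ChartedSpace H M] [IsManifold I ∞ M]
  {D : LiouvilleData I M} {n : ℕ}

theorem stdSymplectic_apply (v w : Cn n) :
    stdSymplectic n v w = ∑ j, ((v j).re * (w j).im - (v j).im * (w j).re) := rfl

theorem stdSymplectic_skew (v w : Cn n) : stdSymplectic n v w = -stdSymplectic n w v := by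
  rw [stdSymplectic_apply, stdSymplectic_apply, ← Finset.sum_neg_distrib]
  exact Finset.sum_congr rfl fun j _ => by ring

theorem stdSymplectic_eq_inner (v w : Cn n) :
    stdSymplectic n v w = (inner ℂ v w : ℂ).im := by
  rw [stdSymplectic_apply, PiLp.inner_apply, Complex.im_sum]
  refine Finset.sum_congr rfl fun j _ => ?_
  simp
  ring

/-- Used twice: it yields nondegeneracy, and it gives the Hamiltonians of the unitary rotations. -/
theorem stdSymplectic_I_smul (v : Cn n) : stdSymplectic n v (Complex.I • v) = ‖v‖ ^ 2 := by
  rw [stdSymplectic_eq_inner, inner_smul_right, inner_self_eq_norm_sq_to_K]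
  have h : (Complex.I * ((‖v‖ : ℂ) ^ 2)).im = ‖v‖ ^ 2 := by
    rw [← Complex.ofReal_pow, Complex.I_mul_im, Complex.ofReal_re]
  exact h

theorem stdSymplectic_nondegenerate {v : Cn n} (hv : ∀ w, stdSymplectic n v w = 0) : v = 0 := by
  have := (stdSymplectic_I_smul v).symm.trans (hv _)
  simpa using this

theorem contDiff_stdSymplectic {F : Type*} [NormedAddCommGroup F] [NormedSpace ℝ F]
    {f g : F → Cn n} {s : Set F} (hf : ContDiffOn ℝ ∞ f s) (hg : ContDiffOn ℝ ∞ g s) :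
    ContDiffOn ℝ ∞ (fun x => stdSymplectic n (f x) (g x)) s := by
  simp only [stdSymplectic_eq_inner]
  exact Complex.imCLM.contDiff.comp_contDiffOn
    ((hf.inner ℂ hg).restrict_scalars ℝ)

namespace LiouvilleData

theorem stabilization_α (p : M × Cn n) (w : TangentSpace (I.prod 𝓘(ℝ, Cn n)) p) :
    (D.stabilization n).α p w =
      D.α p.1 (w : E × Cn n).1 + 1 / 2 * stdSymplectic n p.2 (w : E × Cn n).2 := by
  change D.symp p.1 (D.L p.1) _ + stdSymplectic n ((1 / 2 : ℝ) • p.2) _ = _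
  rw [map_smul]
  rfl

theorem stabilization_symp (p : M × Cn n) (v w : TangentSpace (I.prod 𝓘(ℝ, Cn n)) p) :
    (D.stabilization n).symp p v w =
      D.symp p.1 (v : E × Cn n).1 (w : E × Cn n).1 +
        stdSymplectic n (v : E × Cn n).2 (w : E × Cn n).2 := rfl

theorem stabilization_flow (t : ℝ) (p : M × Cn n) :
    (D.stabilization n).flow t p = (D.flow t p.1, Real.exp (t / 2) • p.2) := rfl

namespace IsLiouville

variable (hD : D.IsLiouville)
include hD

theorem smooth_α_stabilization : IsSmoothOneForm (D.stabilization n).α := by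
  have h1 : ContMDiff (I.prod 𝓘(ℝ, Cn n)).tangent (I.tangent.prod 𝓘(ℝ, Cn n).tangent) ∞
      (equivTangentBundleProd I M 𝓘(ℝ, Cn n) (Cn n)) := contMDiff_equivTangentBundleProd
  have h2 : ContMDiff (I.prod 𝓘(ℝ, Cn n)).tangent 𝓘(ℝ, ℝ) ∞
      (fun p : TangentBundle (I.prod 𝓘(ℝ, Cn n)) (M × Cn n) =>
        D.α p.1.1 (p.2 : E × Cn n).1) :=
    ContMDiff.comp (g := fun p : TangentBundle I M => D.α p.1 p.2) hD.smooth_α h1.fst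
  have h3 : ContMDiff (I.prod 𝓘(ℝ, Cn n)).tangent 𝓘(ℝ, Cn n) ∞
      (fun p : TangentBundle (I.prod 𝓘(ℝ, Cn n)) (M × Cn n) => (p.2 : E × Cn n).2) :=
    (contMDiff_snd_tangentBundle_modelSpace (Cn n) 𝓘(ℝ, Cn n)).comp h1.snd
  have h4 : ContMDiff (I.prod 𝓘(ℝ, Cn n)).tangent 𝓘(ℝ, Cn n) ∞
      (fun p : TangentBundle (I.prod 𝓘(ℝ, Cn n)) (M × Cn n) => p.1.2) :=
    contMDiff_snd.comp (Bundle.contMDiff_proj (TangentSpace (I.prod 𝓘(ℝ, Cn n))))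
  have h5 : ContMDiff 𝓘(ℝ, Cn n × Cn n) 𝓘(ℝ, ℝ) ∞
      (fun q : Cn n × Cn n => (1 / 2 : ℝ) * stdSymplectic n q.1 q.2) :=
    (contDiff_const.mul (contDiffOn_univ.1 (contDiff_stdSymplectic contDiffOn_fst
      contDiffOn_snd))).contMDiff
  exact (h2.add (h5.comp (h4.prodMk_space h3))).congr fun p => stabilization_α p.1 p.2

/-- In a product chart the form is the sum of the pull-back of α under the first projection and of
the form with linear coefficients ½ ω(z, dz). Antisymmetrization doubles the latter and cancels the
factor ½. -/
theorem exact_stabilization :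
    IsExteriorDerivative (D.stabilization n).α (D.stabilization n).symp := by
  intro p v w
  let e := extChartAt I p.1
  let V := E × Cn n
  let Φ : V → M := fun y => e.symm y.1
  let y₀ : V := (e p.1, p.2)
  have hes : extChartAt (I.prod 𝓘(ℝ, Cn n)) p = e.prod (extChartAt 𝓘(ℝ, Cn n) p.2) :=
    extChartAt_prod p
  have he0 : extChartAt (I.prod 𝓘(ℝ, Cn n)) p p = y₀ := by rw [hes]; rfl
  have hsymm : (extChartAt (I.prod 𝓘(ℝ, Cn n)) p).symm = fun y : V => (Φ y, y.2) := by
    rw [hes]; rfl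
  let s : Set V := Prod.fst ⁻¹' e.target
  have hs : IsOpen s := (isOpen_extChartAt_target p.1).preimage continuous_fst
  have hΦ : ∀ y ∈ s, ContMDiffAt 𝓘(ℝ, V) I ∞ Φ y := fun y hy =>
    ((contMDiffOn_extChartAt_symm p.1).contMDiffAt
      ((isOpen_extChartAt_target p.1).mem_nhds hy)).comp y contDiff_fst.contMDiff.contMDiffAt
  have hy₀ : y₀ ∈ s := e.map_source (mem_extChartAt_source p.1)
  have hder : ∀ y ∈ s, ∀ u : V, (mfderiv 𝓘(ℝ, V) (I.prod 𝓘(ℝ, Cn n))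
      (extChartAt (I.prod 𝓘(ℝ, Cn n)) p).symm y u : E × Cn n) =
        ((mfderiv 𝓘(ℝ, V) I Φ y u : E), u.2) := by
    intro y hy u
    have h2 : HasMFDerivAt 𝓘(ℝ, V) 𝓘(ℝ, Cn n) (fun y : V => y.2) y
        (ContinuousLinearMap.snd ℝ E (Cn n)) :=
      (ContinuousLinearMap.snd ℝ E (Cn n)).hasFDerivAt.hasMFDerivAt
    have h1 := (((hΦ y hy).mdifferentiableAt (by simp)).hasMFDerivAt.prodMk h2).mfderiv
    have key : ∀ f : V → M × Cn n, f = (fun y : V => (Φ y, y.2)) → ∀ A : V →L[ℝ] E × Cn n,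
        (mfderiv 𝓘(ℝ, V) (I.prod 𝓘(ℝ, Cn n)) (fun y : V => (Φ y, y.2)) y : V →L[ℝ] E × Cn n) = A →
        (mfderiv 𝓘(ℝ, V) (I.prod 𝓘(ℝ, Cn n)) f y u : E × Cn n) = A u := by
      rintro _ rfl _ rfl; rfl
    exact key _ hsymm _ h1
  have hform : ∀ y ∈ s, ∀ u : V, chartForm (D.stabilization n).α p y u =
      D.α (Φ y) (mfderiv 𝓘(ℝ, V) I Φ y u) + 1 / 2 * stdSymplectic n y.2 u.2 := by
    intro y hy u
    unfold chartForm
    rw [ModelWithCorners.range_eq_univ, mfderivWithin_univ, stabilization_α, hder y hy u]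
    have key : ∀ q : M × Cn n, q = (Φ y, y.2) →
        D.α q.1 (mfderiv 𝓘(ℝ, V) I Φ y u : E) + 1 / 2 * stdSymplectic n q.2 u.2 =
        D.α (Φ y) (mfderiv 𝓘(ℝ, V) I Φ y u) + 1 / 2 * stdSymplectic n y.2 u.2 := by
      rintro _ rfl; rfl
    exact key _ (congrFun hsymm y)
  have hpull := fun v w : V => hD.exact.pullback_apply hD.smooth_α (hΦ y₀ hy₀) v w
  let T : V → V →L[ℝ] ℝ := fun u => LinearMap.toContinuousLinearMap ((1 / 2 : ℝ) •
    ((stdSymplectic n).flip u.2).comp (LinearMap.snd ℝ E (Cn n)))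
  have hstd : ∀ u : V, HasFDerivAt (fun y : V => 1 / 2 * stdSymplectic n y.2 u.2) (T u) y₀ :=
    fun u => (T u).hasFDerivAt
  have hfd : ∀ u u' : V, fderiv ℝ (fun y => chartForm (D.stabilization n).α p y u) y₀ u' =
      fderiv ℝ (fun y => D.α (Φ y) (mfderiv 𝓘(ℝ, V) I Φ y u)) y₀ u' +
        1 / 2 * stdSymplectic n u'.2 u.2 := by
    intro u u'
    have h1 : (fun y => chartForm (D.stabilization n).α p y u) =ᶠ[𝓝 y₀]
        fun y => D.α (Φ y) (mfderiv 𝓘(ℝ, V) I Φ y u) + 1 / 2 * stdSymplectic n y.2 u.2 := by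
      filter_upwards [hs.mem_nhds hy₀] with y hy using hform y hy u
    rw [h1.fderiv_eq]
    exact congrArg (fun A : V →L[ℝ] ℝ => A u') ((hpull u u).1.hasFDerivAt.add (hstd u)).fderiv
  rw [ModelWithCorners.range_eq_univ, mfderivWithin_univ, fderivWithin_univ, fderivWithin_univ,
    he0, hfd, hfd, stabilization_symp, hder y₀ hy₀ v, hder y₀ hy₀ w]
  have key : ∀ q : M × Cn n, q = (Φ y₀, y₀.2) →
      D.symp q.1 (mfderiv 𝓘(ℝ, V) I Φ y₀ v : E) (mfderiv 𝓘(ℝ, V) I Φ y₀ w : E) =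
      D.symp (Φ y₀) (mfderiv 𝓘(ℝ, V) I Φ y₀ v) (mfderiv 𝓘(ℝ, V) I Φ y₀ w) := by
    rintro _ rfl; rfl
  refine (congrArg (· + stdSymplectic n v.2 w.2) ((key _ (congrFun hsymm y₀)).trans
    (hpull v w).2.symm)).trans ?_
  rw [stdSymplectic_skew w.2 v.2]
  ring

theorem smooth_L_stabilization : ContMDiff (I.prod 𝓘(ℝ, Cn n)) (I.prod 𝓘(ℝ, Cn n)).tangent ∞
    (fun x : M × Cn n => (⟨x, (D.stabilization n).L x⟩ :
      TangentBundle (I.prod 𝓘(ℝ, Cn n)) (M × Cn n))) := by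
  have h1 : ContMDiff (I.tangent.prod 𝓘(ℝ, Cn n).tangent) (I.prod 𝓘(ℝ, Cn n)).tangent ∞
      (equivTangentBundleProd I M 𝓘(ℝ, Cn n) (Cn n)).symm := contMDiff_equivTangentBundleProd_symm
  have h2 : ContMDiff 𝓘(ℝ, Cn n) 𝓘(ℝ, Cn n).tangent ∞
      (fun z : Cn n => (⟨z, (1 / 2 : ℝ) • z⟩ : TangentBundle 𝓘(ℝ, Cn n) (Cn n))) :=
    contMDiff_vectorSpace_iff_contDiff.2 (contDiff_id.const_smul (1 / 2 : ℝ))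
  exact h1.comp ((hD.smooth_L.comp contMDiff_fst).prodMk (h2.comp contMDiff_snd))

theorem smooth_flow_stabilization : ContMDiff (𝓘(ℝ, ℝ).prod (I.prod 𝓘(ℝ, Cn n)))
    (I.prod 𝓘(ℝ, Cn n)) ∞ (fun p : ℝ × (M × Cn n) => (D.stabilization n).flow p.1 p.2) := by
  have h1 : ContMDiff 𝓘(ℝ, ℝ × Cn n) 𝓘(ℝ, Cn n) ∞
      (fun q : ℝ × Cn n => Real.exp (q.1 / 2) • q.2) := by
    apply ContDiff.contMDiff
    fun_prop
  exact (hD.smooth_flow.comp (contMDiff_fst.prodMk (contMDiff_fst.comp contMDiff_snd))).prodMk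
    (h1.comp (contMDiff_fst.prodMk_space (contMDiff_snd.comp contMDiff_snd)))

theorem flow_integral_stabilization (x : M × Cn n) :
    IsMIntegralCurve (I := I.prod 𝓘(ℝ, Cn n)) (fun t => (D.stabilization n).flow t x)
      (D.stabilization n).L := by
  intro t
  have h1 : HasFDerivAt (fun t : ℝ => Real.exp (t / 2) • x.2)
      ((1 : ℝ →L[ℝ] ℝ).smulRight ((1 / 2 : ℝ) • Real.exp (t / 2) • x.2)) t := by
    have h2 : HasDerivAt (fun t : ℝ => Real.exp (t / 2) • x.2)
        ((1 / 2 : ℝ) • Real.exp (t / 2) • x.2) t := by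
      have := ((hasDerivAt_id t).div_const 2).exp.smul_const x.2
      rwa [mul_comm, mul_smul] at this
    exact h2.hasFDerivAt.congr_fderiv (by ext; simp)
  have h2 := (hD.flow_integral x.1 t).prodMk h1.hasMFDerivAt
  let a : E := D.L (D.flow t x.1)
  let b : Cn n := (1 / 2 : ℝ) • Real.exp (t / 2) • x.2
  have e : ((1 : ℝ →L[ℝ] ℝ).smulRight a).prod ((1 : ℝ →L[ℝ] ℝ).smulRight b) =
      (1 : ℝ →L[ℝ] ℝ).smulRight ((a, b) : E × Cn n) := rfl
  have h3 : HasMFDerivAt 𝓘(ℝ, ℝ) (I.prod 𝓘(ℝ, Cn n))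
      (fun t => (D.flow t x.1, Real.exp (t / 2) • x.2)) t
      ((1 : ℝ →L[ℝ] ℝ).smulRight ((a, b) : E × Cn n)) := h2
  exact h3

end IsLiouville

end LiouvilleData

end Stabilization

/-! ### Starshaped hypersurfaces and the core of the stabilization. -/

section StabilizationStarshaped

open Filter Topology

/-- A smooth function which vanishes on the negative half-line and increases on the positive
half-line from zero to infinity. -/
def flatExp (s : ℝ) : ℝ := expNegInvGlue s * Real.exp s

theorem contDiff_flatExp : ContDiff ℝ ∞ flatExp :=
  expNegInvGlue.contDiff.mul Real.contDiff_exp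

theorem flatExp_of_nonpos {s : ℝ} (hs : s ≤ 0) : flatExp s = 0 := by
  rw [flatExp, expNegInvGlue.zero_of_nonpos hs, zero_mul]

theorem flatExp_nonneg (s : ℝ) : 0 ≤ flatExp s :=
  mul_nonneg (expNegInvGlue.nonneg s) (Real.exp_pos s).le

theorem monotone_flatExp : Monotone flatExp := fun _ _ h =>
  mul_le_mul (expNegInvGlue.monotone h) (Real.exp_le_exp.2 h) (Real.exp_pos _).le
    (expNegInvGlue.nonneg _)

theorem flatExp_of_pos {s : ℝ} (hs : 0 < s) : flatExp s = Real.exp (s - s⁻¹) := by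
  rw [flatExp, expNegInvGlue, if_neg hs.not_ge, ← Real.exp_add]
  congr 1
  ring

theorem pos_of_flatExp_pos {s : ℝ} (hs : 0 < flatExp s) : 0 < s := by
  by_contra! hc
  exact hs.ne' (flatExp_of_nonpos hc)

theorem one_lt_flatExp {s : ℝ} (hs : 1 < s) : 1 < flatExp s := by
  rw [flatExp_of_pos (by linarith), Real.one_lt_exp_iff]
  have : s⁻¹ < 1 := inv_lt_one_of_one_lt₀ hs
  linarith

theorem exists_hasDerivAt_flatExp_pos {s : ℝ} (hs : 0 < s) :
    ∃ d, 0 < d ∧ HasDerivAt flatExp d s := by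
  have h1 : flatExp =ᶠ[𝓝 s] fun s => Real.exp (s - s⁻¹) := by
    filter_upwards [lt_mem_nhds hs] with t ht using flatExp_of_pos ht
  refine ⟨Real.exp (s - s⁻¹) * (1 - -(s ^ 2)⁻¹), by rw [sub_neg_eq_add]; positivity, ?_⟩
  exact (((hasDerivAt_id s).sub (hasDerivAt_inv hs.ne')).exp).congr_of_eventuallyEq h1

variable {E : Type*} [NormedAddCommGroup E] [NormedSpace ℝ E] [FiniteDimensional ℝ E]
  {H : Type*} [TopologicalSpace H] {I : ModelWithCorners ℝ E H} [I.Boundaryless]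
  {M : Type*} [TopologicalSpace M] [T2Space M] [ChartedSpace H M] [IsManifold I ∞ M]
  {D : LiouvilleData I M} {n : ℕ}

namespace LiouvilleData

open Classical in
/-- A function which vanishes on the starshaped domain and increases along the Liouville flow
outside. -/
def radius (D : LiouvilleData I M) (P U : Set M) (x : M) : ℝ :=
  if x ∈ D.core U then 0 else flatExp (D.hitTime P x)

/-- A defining function of a starshaped hypersurface of the stabilization. -/
def stabRadius (D : LiouvilleData I M) (n : ℕ) (P U : Set M) (p : M × Cn n) : ℝ :=
  D.radius P U p.1 + ‖p.2‖ ^ 2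

namespace IsLiouville

variable (hD : D.IsLiouville) {P U : Set M} (h : D.IsStarshaped P U)

theorem radius_nonneg (x : M) : 0 ≤ D.radius P U x := by
  unfold radius
  split_ifs
  · exact le_rfl
  · exact flatExp_nonneg _

include hD h

theorem radius_flow (t : ℝ) {x : M} (hx : x ∉ D.core U) :
    D.radius P U (D.flow t x) = flatExp (D.hitTime P x + t) := by
  rw [radius, if_neg (mt (hD.flow_mem_core_iff h t).1 hx), hD.hitTime_flow h t hx]

theorem radius_flow_core (t : ℝ) {x : M} (hx : x ∈ D.core U) :
    D.radius P U (D.flow t x) = 0 :=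
  if_pos ((hD.flow_mem_core_iff h t).2 hx)

theorem contMDiff_radius : ContMDiff I 𝓘(ℝ, ℝ) ∞ (D.radius P U) := by
  intro x
  by_cases hx : x ∈ D.core U
  · have : D.radius P U =ᶠ[𝓝 x] fun _ => (0 : ℝ) := by
      filter_upwards [h.isOpen_domain.mem_nhds (hD.core_subset h hx)] with y hy
      by_cases hyc : y ∈ D.core U
      · exact if_pos hyc
      · exact (if_neg hyc).trans (flatExp_of_nonpos ((hD.mem_domain_iff h hyc).1 hy).le)
    exact contMDiffAt_const.congr_of_eventuallyEq this
  · have : D.radius P U =ᶠ[𝓝 x] fun y => flatExp (D.hitTime P y) := by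
      filter_upwards [(hD.isOpen_symplectization h).mem_nhds hx] with y hy using if_neg hy
    exact ((contDiff_flatExp.contMDiff).contMDiffAt.comp x
      (hD.contMDiffAt_hitTime h hx)).congr_of_eventuallyEq this

theorem contMDiff_stabRadius :
    ContMDiff (I.prod 𝓘(ℝ, Cn n)) 𝓘(ℝ, ℝ) ∞ (D.stabRadius n P U) :=
  ((hD.contMDiff_radius h).comp contMDiff_fst).add
    ((contDiff_norm_sq ℝ).contMDiff.comp contMDiff_snd)

theorem radius_le_flow {t : ℝ} (ht : 0 ≤ t) (x : M) :
    D.radius P U x ≤ D.radius P U (D.flow t x) := by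
  by_cases hx : x ∈ D.core U
  · rw [hD.radius_flow_core h t hx, radius, if_pos hx]
  · rw [hD.radius_flow h t hx, radius, if_neg hx]
    exact monotone_flatExp (by linarith)

/-- Since `flatExp s > 1` for `s > 1`, the sublevel set lies in the compact set L^1(closure U). -/
theorem isCompact_radius_le : IsCompact {x | D.radius P U x ≤ 1} := by
  refine (h.isCompact_closure.image (hD.contMDiff_flow 1).continuous).of_isClosed_subset
    (isClosed_le (hD.contMDiff_radius h).continuous continuous_const) fun x hx => ?_
  refine ⟨D.flow (-1) x, ?_, hD.flow_flow_neg 1 x⟩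
  by_cases hxc : x ∈ D.core U
  · exact (hD.mem_core_iff_closure h).1 hxc _
  · have h1 : D.hitTime P x ≤ 1 := by
      by_contra! hc
      have : flatExp (D.hitTime P x) ≤ 1 := by
        have := hx
        rwa [mem_ofPred_eq, radius, if_neg hxc] at this
      exact absurd (one_lt_flatExp hc) this.not_gt
    have h2 := hD.hitTime_flow h (-1) hxc
    have h3 := mt (hD.flow_mem_core_iff h (-1)).1 hxc
    rw [closure_eq h]
    by_cases h4 : D.hitTime P x = 1
    · right
      have := hD.flow_hitTime_mem h hxc
      rwa [h4] at this
    · left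
      exact (hD.mem_domain_iff h h3).2 (by rw [h2]; have := lt_of_le_of_ne h1 h4; linarith)

theorem norm_flow_sq (t : ℝ) (z : Cn n) : ‖Real.exp (t / 2) • z‖ ^ 2 = Real.exp t * ‖z‖ ^ 2 := by
  rw [norm_smul, mul_pow, Real.norm_of_nonneg (Real.exp_pos _).le, ← Real.exp_nat_mul]
  congr 2
  push_cast
  ring

theorem stabRadius_flow (t : ℝ) (p : M × Cn n) :
    D.stabRadius n P U ((D.stabilization n).flow t p) =
      D.radius P U (D.flow t p.1) + Real.exp t * ‖p.2‖ ^ 2 := by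
  rw [stabRadius, stabilization_flow, hD.norm_flow_sq h]

theorem stabRadius_le_flow {t : ℝ} (ht : 0 ≤ t) (p : M × Cn n) :
    D.stabRadius n P U p ≤ D.stabRadius n P U ((D.stabilization n).flow t p) := by
  rw [hD.stabRadius_flow h]
  refine add_le_add (hD.radius_le_flow h ht _) ?_
  exact le_mul_of_one_le_left (sq_nonneg _) (Real.one_le_exp ht)

/-- Where `radius` is positive it has positive derivative along the flow. Where it vanishes it is at
a minimum and has zero derivative, but then `‖p.2‖ ^ 2` is positive and grows exponentially. -/
theorem exists_hasDerivAt_stabRadius {p : M × Cn n} (hp : 0 < D.stabRadius n P U p) :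
    ∃ d, 0 < d ∧ HasDerivAt (fun t => D.stabRadius n P U ((D.stabilization n).flow t p)) d 0 := by
  have h1 : ∃ d, 0 ≤ d ∧ (0 < D.radius P U p.1 → 0 < d) ∧
      HasDerivAt (fun t => D.radius P U (D.flow t p.1)) d 0 := by
    by_cases hr : 0 < D.radius P U p.1
    · have hx : p.1 ∉ D.core U := fun hc => hr.ne' (if_pos hc)
      have hr' : 0 < flatExp (D.hitTime P p.1) := by rwa [radius, if_neg hx] at hr
      obtain ⟨d, hd, hd'⟩ := exists_hasDerivAt_flatExp_pos (pos_of_flatExp_pos hr')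
      refine ⟨d, hd.le, fun _ => hd, ?_⟩
      simp only [hD.radius_flow h _ hx]
      have : HasDerivAt flatExp d (D.hitTime P p.1 + 0) := by rwa [add_zero]
      exact this.comp_const_add _ _
    · refine ⟨0, le_rfl, fun h => absurd h hr, ?_⟩
      have hmin : ∀ t, D.radius P U (D.flow 0 p.1) ≤ D.radius P U (D.flow t p.1) := fun t => by
        rw [hD.flow_zero]
        exact (not_lt.1 hr).trans (radius_nonneg _)
      have hd : DifferentiableAt ℝ (fun t => D.radius P U (D.flow t p.1)) 0 :=
        (hasDerivAt_comp_curve ((hD.contMDiff_radius h).mdifferentiableAt (by simp))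
          (hD.flow_integral p.1 0)).differentiableAt
      have hl : IsLocalMin (fun t => D.radius P U (D.flow t p.1)) 0 :=
        Eventually.of_forall hmin
      have := hd.hasDerivAt
      rwa [hl.deriv_eq_zero] at this
  obtain ⟨d, hd0, hd1, hd⟩ := h1
  refine ⟨d + Real.exp 0 * ‖p.2‖ ^ 2, ?_, ?_⟩
  · rw [Real.exp_zero, one_mul]
    rcases (radius_nonneg (D := D) (P := P) (U := U) p.1).eq_or_lt with h0 | h0
    · have : 0 < ‖p.2‖ ^ 2 := by rw [stabRadius, ← h0, zero_add] at hp; exact hp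
      linarith
    · have := hd1 h0
      positivity
  · simp only [hD.stabRadius_flow h]
    exact hd.add ((Real.hasDerivAt_exp 0).mul_const _)

theorem stabRadius_flow_strictMono {p : M × Cn n} (hp : p.2 ≠ 0) :
    StrictMono fun t => D.stabRadius n P U ((D.stabilization n).flow t p) := by
  intro s t hst
  simp only [hD.stabRadius_flow h]
  refine add_lt_add_of_le_of_lt ?_ ?_
  · have := hD.radius_le_flow h (sub_nonneg.2 hst.le) (D.flow s p.1)
    rwa [← hD.flow_add, sub_add_cancel] at this
  · have : 0 < ‖p.2‖ := norm_pos_iff.2 hp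
    exact mul_lt_mul_of_pos_right (Real.exp_lt_exp.2 hst) (by positivity)

theorem continuous_stabRadius_flow :
    Continuous fun q : ℝ × (M × Cn n) =>
      D.stabRadius n P U ((D.stabilization n).flow q.1 q.2) :=
  (hD.contMDiff_stabRadius h).continuous.comp (hD.smooth_flow_stabilization).continuous

theorem exists_stabRadius_flow_neg_lt (p : M × Cn n) {c : ℝ} (hc : 0 < c) :
    ∃ t > 0, D.stabRadius n P U ((D.stabilization n).flow (-t) p) < c := by
  have h1 : Tendsto (fun t : ℝ => Real.exp (-t) * ‖p.2‖ ^ 2) atTop (𝓝 0) := by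
    simpa using (Real.tendsto_exp_neg_atTop_nhds_zero).mul_const (‖p.2‖ ^ 2)
  have h2 : ∀ᶠ t : ℝ in atTop, D.radius P U (D.flow (-t) p.1) = 0 := by
    by_cases hx : p.1 ∈ D.core U
    · exact Eventually.of_forall fun t => hD.radius_flow_core h (-t) hx
    · filter_upwards [eventually_ge_atTop (D.hitTime P p.1)] with t ht
      rw [hD.radius_flow h _ hx]
      exact flatExp_of_nonpos (by linarith)
  obtain ⟨t, ht1, ht2, ht3⟩ := ((h1.eventually_lt_const hc).and
    (h2.and (eventually_gt_atTop 0))).exists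
  refine ⟨t, ht3, ?_⟩
  rw [hD.stabRadius_flow h, ht2, zero_add]
  exact ht1

theorem exists_lt_stabRadius_flow {p : M × Cn n} (hp : p.2 ≠ 0) (c : ℝ) :
    ∃ t, c < D.stabRadius n P U ((D.stabilization n).flow t p) := by
  have : 0 < ‖p.2‖ ^ 2 := by have := norm_pos_iff.2 hp; positivity
  have h1 : Tendsto (fun t : ℝ => Real.exp t * ‖p.2‖ ^ 2) atTop atTop :=
    Real.tendsto_exp_atTop.atTop_mul_const this
  obtain ⟨t, ht⟩ := (h1.eventually_gt_atTop c).exists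
  refine ⟨t, ht.trans_le ?_⟩
  rw [hD.stabRadius_flow h]
  linarith [radius_nonneg (D := D) (P := P) (U := U) (D.flow t p.1)]

/-- The part of the level set with z ≠ 0 is the image of M × S^{2n-1} under pushing along the
Liouville flow, and both factors are connected. The points with z = 0 lie in its closure. -/
theorem isPreconnected_stabRadius_eq_one (hn : 1 ≤ n) :
    IsPreconnected {p : M × Cn n | D.stabRadius n P U p = 1} := by
  have := hD.connected
  let N := D.stabilization n
  let f : ℝ → M × Cn n → ℝ := fun t p => D.stabRadius n P U (N.flow t p)
  have hfc : Continuous fun q : ℝ × (M × Cn n) => f q.1 q.2 := hD.continuous_stabRadius_flow h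
  have hfp : ∀ p, Continuous fun t => f t p := fun p =>
    hfc.comp (by fun_prop : Continuous fun t : ℝ => (t, p))
  have hft : ∀ t, Continuous (f t) := fun t =>
    hfc.comp (by fun_prop : Continuous fun p : M × Cn n => (t, p))
  let A : Set (M × Cn n) := univ ×ˢ Metric.sphere 0 1
  have hz : ∀ p ∈ A, p.2 ≠ 0 := fun p hp h0 => by
    have := hp.2
    rw [h0] at this
    simp at this
  have hA : IsPreconnected A := by
    refine isPreconnected_univ.prod (isPreconnected_sphere ?_ _ _)
    have h1 : Module.finrank ℝ (Cn n) = 2 * n := by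
      rw [← Module.finrank_mul_finrank ℝ ℂ (Cn n), Complex.finrank_real_complex,
        finrank_euclideanSpace_fin]
    rw [← Module.finrank_eq_rank, h1]
    exact_mod_cast (by omega : 1 < 2 * n)
  have hex : ∀ p ∈ A, ∃ t, f t p = 1 := by
    intro p hp
    obtain ⟨t, -, ht⟩ := hD.exists_stabRadius_flow_neg_lt h p one_pos
    obtain ⟨s, hs⟩ := hD.exists_lt_stabRadius_flow h (hz p hp) 1
    exact mem_range_of_exists_le_of_exists_ge (hfp p) ⟨_, ht.le⟩ ⟨_, hs.le⟩
  choose! T hT using hex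
  -- Strict monotonicity along each trajectory makes the crossing time continuous: if the level has
  -- not been reached at time `a`, or has been passed at time `b`, the same holds for nearby
  -- starting points.
  have hTc : ContinuousOn T A := by
    intro p hp
    have hmono := hD.stabRadius_flow_strictMono h (hz p hp)
    refine tendsto_order.2 ⟨fun a ha => ?_, fun b hb => ?_⟩
    · have h1 : f a p < 1 := (hT p hp) ▸ hmono ha
      filter_upwards [mem_nhdsWithin_of_mem_nhds ((hft a).continuousAt.eventually_lt
        continuousAt_const h1), self_mem_nhdsWithin] with q hq hqA
      by_contra! hc
      have := (hD.stabRadius_flow_strictMono h (hz q hqA)).monotone hc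
      have h3 := hT q hqA
      simp only [f, N] at hq h3
      linarith
    · have h1 : 1 < f b p := (hT p hp) ▸ hmono hb
      filter_upwards [mem_nhdsWithin_of_mem_nhds (continuousAt_const.eventually_lt
        (hft b).continuousAt h1), self_mem_nhdsWithin] with q hq hqA
      by_contra! hc
      have := (hD.stabRadius_flow_strictMono h (hz q hqA)).monotone hc
      have h3 := hT q hqA
      simp only [f, N] at hq h3
      linarith
  let pr : M × Cn n → M × Cn n := fun p => N.flow (T p) p
  have hprc : ContinuousOn pr A :=
    (hD.smooth_flow_stabilization (n := n)).continuous.comp_continuousOn (hTc.prodMk continuousOn_id)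
  have himg : pr '' A = {p | D.stabRadius n P U p = 1 ∧ p.2 ≠ 0} := by
    ext p
    constructor
    · rintro ⟨q, hq, rfl⟩
      refine ⟨hT q hq, ?_⟩
      exact smul_ne_zero (Real.exp_pos _).ne' (hz q hq)
    · rintro ⟨hp1, hp0⟩
      let c := 2 * Real.log ‖p.2‖
      have hpos : 0 < ‖p.2‖ := norm_pos_iff.2 hp0
      have hexp : Real.exp (c / 2) = ‖p.2‖ := by
        simp only [c]
        rw [mul_div_cancel_left₀ _ two_ne_zero, Real.exp_log hpos]
      let q : M × Cn n := (D.flow (-c) p.1, ‖p.2‖⁻¹ • p.2)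
      have hqA : q ∈ A := ⟨trivial, by
        simp only [q, mem_sphere_iff_norm, sub_zero, norm_smul, norm_inv, norm_norm]
        exact inv_mul_cancel₀ hpos.ne'⟩
      have hqp : N.flow c q = p := by
        refine Prod.ext (hD.flow_flow_neg c p.1) ?_
        change Real.exp (c / 2) • ‖p.2‖⁻¹ • p.2 = p.2
        rw [hexp, smul_smul, mul_inv_cancel₀ hpos.ne', one_smul]
      refine ⟨q, hqA, ?_⟩
      have hTq : T q = c := by
        refine (hD.stabRadius_flow_strictMono h (hz q hqA)).injective ?_
        change f (T q) q = D.stabRadius n P U (N.flow c q)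
        rw [hT q hqA, hqp, hp1]
      change N.flow (T q) q = p
      rw [hTq, hqp]
  have hpre : IsPreconnected {p : M × Cn n | D.stabRadius n P U p = 1 ∧ p.2 ≠ 0} :=
    himg ▸ hA.image pr hprc
  refine hpre.subset_closure (fun p hp => hp.1) fun p hp => ?_
  by_cases hp0 : p.2 = 0
  swap
  · exact subset_closure ⟨hp, hp0⟩
  have hp1 : D.radius P U p.1 = 1 := by
    have := hp
    rwa [mem_ofPred_eq, stabRadius, hp0, norm_zero, zero_pow two_ne_zero, add_zero] at this
  have hxc : p.1 ∉ D.core U := fun hc => by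
    rw [radius, if_pos hc] at hp1
    exact zero_ne_one hp1
  let e : Cn n := EuclideanSpace.single ⟨0, hn⟩ 1
  have he : ‖e‖ = 1 := by simp [e]
  -- A point with z = 0 is approached within the level set by flowing backward in `M` and restoring
  -- the missing radius in the direction `e`.
  let g : ℝ → M × Cn n := fun t =>
    (D.flow (-t) p.1, Real.sqrt (1 - D.radius P U (D.flow (-t) p.1)) • e)
  have hgc : Continuous g := by
    have h1 : Continuous fun t : ℝ => D.flow (-t) p.1 :=
      (hD.contMDiff_flow_orbit p.1).continuous.comp continuous_neg
    exact h1.prodMk ((Real.continuous_sqrt.comp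
      (continuous_const.sub ((hD.contMDiff_radius h).continuous.comp h1))).smul continuous_const)
  have hg0 : g 0 = p := by
    refine Prod.ext ?_ ?_
    · simp [g, hD.flow_zero]
    · simp [g, hD.flow_zero, hp1, hp0]
  have hlim : Tendsto g (𝓝[>] 0) (𝓝 p) := by
    have := hgc.tendsto 0
    rw [hg0] at this
    exact this.mono_left nhdsWithin_le_nhds
  refine mem_closure_of_tendsto hlim ?_
  filter_upwards [self_mem_nhdsWithin] with t ht
  have ht : 0 < t := ht
  have hlt : D.radius P U (D.flow (-t) p.1) < 1 := by
    rw [hD.radius_flow h _ hxc]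
    have h1 : flatExp (D.hitTime P p.1) = 1 := by rwa [radius, if_neg hxc] at hp1
    have hs := pos_of_flatExp_pos (h1.symm ▸ one_pos)
    by_cases h2 : D.hitTime P p.1 + -t ≤ 0
    · rw [flatExp_of_nonpos h2]; exact one_pos
    · rw [← h1, flatExp_of_pos hs, flatExp_of_pos (not_le.1 h2), Real.exp_lt_exp]
      have : (D.hitTime P p.1)⁻¹ < (D.hitTime P p.1 + -t)⁻¹ :=
        inv_strictAnti₀ (not_le.1 h2) (by linarith)
      linarith
  have hpos : 0 < 1 - D.radius P U (D.flow (-t) p.1) := by linarith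
  refine ⟨?_, ?_⟩
  · change D.radius P U (D.flow (-t) p.1) + ‖Real.sqrt _ • e‖ ^ 2 = 1
    rw [norm_smul, he, mul_one, Real.norm_of_nonneg (Real.sqrt_nonneg _), Real.sq_sqrt hpos.le]
    ring
  · refine smul_ne_zero (Real.sqrt_pos.2 hpos).ne' ?_
    rw [← norm_pos_iff, he]
    exact one_pos

/-- Along the flow `stabRadius` never decreases, crosses the value `1` with positive speed, and
becomes smaller than any positive number in the past. These facts give disjointness, transversality
together with the frontier, and the covering of M × ℂⁿ by intermediate values. -/
theorem isStarshaped_stabilization (hn : 1 ≤ n) :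
    (D.stabilization n).IsStarshaped {p : M × Cn n | D.stabRadius n P U p = 1}
      {p : M × Cn n | D.stabRadius n P U p < 1} := by
  let N := D.stabilization n
  let f : M × Cn n → ℝ := D.stabRadius n P U
  have hf := hD.contMDiff_stabRadius (n := n) h
  have hfc : Continuous f := hf.continuous
  have hflow : ∀ p : M × Cn n, Continuous fun t => N.flow t p := fun p =>
    (hD.smooth_flow_stabilization (n := n)).continuous.comp (by fun_prop : Continuous fun t : ℝ => (t, p))
  have hN0 : ∀ p : M × Cn n, N.flow 0 p = p := fun p =>
    Prod.ext (hD.flow_zero p.1) (by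
      change Real.exp (0 / 2) • p.2 = p.2
      simp)
  have hNn : ∀ t, ∀ p : M × Cn n, N.flow t (N.flow (-t) p) = p := fun t p =>
    Prod.ext (hD.flow_flow_neg t p.1) (by
      change Real.exp (t / 2) • Real.exp (-t / 2) • p.2 = p.2
      rw [smul_smul, ← Real.exp_add, show t / 2 + -t / 2 = 0 by ring, Real.exp_zero, one_smul])
  have hcpt : IsCompact {p : M × Cn n | f p ≤ 1} := by
    refine ((hD.isCompact_radius_le h).prod (isCompact_closedBall (0 : Cn n) 1)).of_isClosed_subset
      (isClosed_le hfc continuous_const) fun p hp => ?_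
    have h0 := radius_nonneg (D := D) (P := P) (U := U) p.1
    have h1 : D.radius P U p.1 + ‖p.2‖ ^ 2 ≤ 1 := hp
    refine ⟨by change D.radius P U p.1 ≤ 1; nlinarith [sq_nonneg ‖p.2‖], ?_⟩
    rw [mem_closedBall_zero_iff]
    nlinarith [norm_nonneg p.2]
  have hcl : closure {p : M × Cn n | f p < 1} ⊆ {p | f p ≤ 1} :=
    closure_minimal (fun p hp => hp.out.le) (isClosed_le hfc continuous_const)
  have ho : IsOpen {p : M × Cn n | f p < 1} := isOpen_lt hfc continuous_const
  refine ⟨?_, hD.isPreconnected_stabRadius_eq_one h hn, ?_, ho,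
    hcpt.of_isClosed_subset isClosed_closure hcl, ?_, ?_, ?_⟩
  · exact hcpt.of_isClosed_subset (isClosed_eq hfc continuous_const) fun p hp => le_of_eq hp
  · intro p hp
    refine ⟨univ, fun q => f q - 1, isOpen_univ, trivial, ?_, ?_, ?_⟩
    · exact (hf.sub contMDiff_const).contMDiffOn
    · ext q
      simp [f, sub_eq_zero]
    · obtain ⟨d, hd, hd'⟩ := hD.exists_hasDerivAt_stabRadius h (p := p)
        (by rw [hp.out]; exact one_pos)
      have h1 := hasDerivAt_comp_curve (t := 0) (g := fun q => f q - 1)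
        ((hf.sub contMDiff_const).mdifferentiableAt (by simp)) (hD.flow_integral_stabilization p 0)
      have h2 := h1.unique (hd'.sub_const 1)
      have key : ∀ q, q = p → mfderiv (I.prod 𝓘(ℝ, Cn n)) 𝓘(ℝ, ℝ) (fun q => f q - 1) q (N.L q) = d →
          (mfderiv (I.prod 𝓘(ℝ, Cn n)) 𝓘(ℝ, ℝ) (fun q => f q - 1) p (N.L p) : ℝ) ≠ 0 := by
        rintro _ rfl h3
        exact fun h4 => hd.ne' (h3.symm.trans h4)
      exact key _ (hN0 p) h2
  · refine Subset.antisymm (frontier_lt_subset_eq hfc continuous_const) fun p hp => ?_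
    rw [ho.frontier_eq]
    refine ⟨?_, fun hc => (ne_of_lt hc) hp⟩
    have hlim : Tendsto (fun t : ℝ => N.flow t p) (𝓝[<] 0) (𝓝 p) := by
      have := (hflow p).tendsto 0
      rw [hN0] at this
      exact this.mono_left nhdsWithin_le_nhds
    refine mem_closure_of_tendsto hlim ?_
    obtain ⟨d, hd, hd'⟩ := hD.exists_hasDerivAt_stabRadius h (p := p)
      (by rw [hp.out]; exact one_pos)
    have h1 := hd'.hasDerivWithinAt (s := Iio 0)
    rw [hasDerivWithinAt_iff_tendsto_slope' (by simp)] at h1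
    filter_upwards [h1.eventually_const_lt hd, self_mem_nhdsWithin] with t ht ht0
    have ht0 : t < 0 := ht0
    rw [slope_def_field, sub_zero] at ht
    have h2 := (div_pos_iff.1 ht).resolve_left fun h3 => by linarith [h3.2]
    change f (N.flow t p) < 1
    have h3 := h2.1
    have h4 : D.stabRadius n P U ((D.stabilization n).flow 0 p) = 1 := by
      have := hN0 p
      simp only [N] at this
      rw [this]; exact hp
    rw [h4] at h3
    simp only [f, N]
    linarith
  · rw [Set.disjoint_left]
    intro p hp hp'
    simp only [mem_iUnion] at hp'
    obtain ⟨t, ht, q, hq, rfl⟩ := hp'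
    have h1 := hD.stabRadius_le_flow h ht q
    rw [hq.out] at h1
    exact absurd hp.out h1.not_gt
  · refine eq_univ_of_forall fun p => ?_
    by_cases hp : f p < 1
    · exact Or.inl hp
    right
    obtain ⟨t, ht0, ht⟩ := hD.exists_stabRadius_flow_neg_lt h p one_pos
    have hc : Continuous fun s : ℝ => f (N.flow (-s) p) :=
      hfc.comp ((hflow p).comp continuous_neg)
    obtain ⟨s, hs, hs1⟩ := intermediate_value_Icc' ht0.le hc.continuousOn
      (show (1 : ℝ) ∈ Icc (f (N.flow (-t) p)) (f (N.flow (-0) p)) from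
        ⟨ht.le, by rw [neg_zero, hN0]; exact not_lt.1 hp⟩)
    exact mem_biUnion (x := s) hs.1 ⟨N.flow (-s) p, hs1, hNn s p⟩

omit h in
/-- The stabilization of a Liouville manifold is a Liouville manifold. -/
theorem stabilization (hn : 1 ≤ n) : (D.stabilization n).IsLiouville := by
  obtain ⟨P, U, h⟩ := hD.exists_starshaped
  have := hD.connected
  exact
  { connected := inferInstance
    smooth_α := hD.smooth_α_stabilization
    exact := hD.exact_stabilization
    nondegenerate := by
      rintro p ⟨v, ζ⟩ hv
      have h1 : v = 0 := hD.nondegenerate p.1 v fun w => by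
        have := (stabilization_symp (n := n) p (v, ζ) ((w, (0 : Cn n)) : E × Cn n)).symm.trans
          (hv ((w, (0 : Cn n)) : E × Cn n))
        rwa [map_zero, add_zero] at this
      have h2 : ζ = 0 := stdSymplectic_nondegenerate fun w => by
        have := (stabilization_symp (n := n) p (v, ζ) (((0 : E), w) : E × Cn n)).symm.trans
          (hv (((0 : E), w) : E × Cn n))
        exact (zero_add _).symm.trans
          ((congrArg (· + stdSymplectic n ζ w) (map_zero (D.symp p.1 v)).symm).trans this)
      exact Prod.ext h1 h2
    smooth_L := hD.smooth_L_stabilization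
    smooth_flow := hD.smooth_flow_stabilization
    flow_zero := fun p => Prod.ext (hD.flow_zero p.1) (by
      change Real.exp (0 / 2) • p.2 = p.2
      simp)
    flow_integral := hD.flow_integral_stabilization
    exists_starshaped := ⟨_, _, hD.isStarshaped_stabilization h hn⟩ }

/-- The core of the stabilization is the core of the manifold. -/
theorem mem_core_stabilization_iff (hn : 1 ≤ n) {P' U' : Set (M × Cn n)}
    (h' : (D.stabilization n).IsStarshaped P' U') {p : M × Cn n} :
    p ∈ (D.stabilization n).core U' ↔ p.1 ∈ D.core U ∧ p.2 = 0 := by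
  -- The description by relatively compact forward orbits does not involve the chosen domain. It
  -- thus applies to any starshaped `U'` and can be tested on the two factors separately.
  rw [(hD.stabilization hn).mem_core_iff_exists_compact h']
  constructor
  · rintro ⟨K, hK, hp⟩
    refine ⟨(hD.mem_core_iff_exists_compact h).2 ⟨Prod.fst '' K, hK.image continuous_fst,
      fun t ht => ⟨_, hp t ht, rfl⟩⟩, ?_⟩
    by_contra h0
    obtain ⟨C, hC⟩ := (hK.image continuous_snd).isBounded.exists_norm_le
    have h1 : Tendsto (fun t : ℝ => Real.exp (t / 2) * ‖p.2‖) atTop atTop :=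
      (Real.tendsto_exp_atTop.comp (tendsto_id.atTop_div_const two_pos)).atTop_mul_const
        (norm_pos_iff.2 h0)
    obtain ⟨t, ht, ht0⟩ := ((h1.eventually_gt_atTop C).and (eventually_gt_atTop 0)).exists
    have h2 := hC _ ⟨_, hp t ht0, rfl⟩
    rw [stabilization_flow, norm_smul, Real.norm_of_nonneg (Real.exp_pos _).le] at h2
    linarith
  · rintro ⟨h1, h2⟩
    refine ⟨closure U ×ˢ {0}, h.isCompact_closure.prod isCompact_singleton, fun t _ =>
      ⟨(hD.mem_core_iff_closure h).1 h1 t, ?_⟩⟩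
    rw [stabilization_flow, h2]
    simp

end IsLiouville

end LiouvilleData

end StabilizationStarshaped

/-! ### Compactly supported area-preserving twists of the plane. -/

section Twist

open Filter Topology

/-- The standard symplectic form of the complex plane. -/
def planeForm (a b : ℂ) : ℝ := a.re * b.im - a.im * b.re

theorem planeForm_add_right (a b c : ℂ) : planeForm a (b + c) = planeForm a b + planeForm a c := by
  simp [planeForm]; ring

theorem planeForm_smul_right (a b : ℂ) (r : ℝ) : planeForm a (r • b) = r * planeForm a b := by
  simp [planeForm]; ring

theorem planeForm_smul_left (a b : ℂ) (r : ℝ) : planeForm (r • a) b = r * planeForm a b := by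
  simp [planeForm]; ring

theorem planeForm_self (a : ℂ) : planeForm a a = 0 := by
  simp [planeForm]; ring

theorem planeForm_I_smul_self (a : ℂ) : planeForm a (Complex.I * a) = ‖a‖ ^ 2 := by
  rw [← Complex.normSq_eq_norm_sq, Complex.normSq_apply]
  simp [planeForm]

theorem planeForm_rotate (θ : ℝ) (a b : ℂ) :
    planeForm (Complex.exp (θ * Complex.I) * a) (Complex.exp (θ * Complex.I) * b) =
      planeForm a b := by
  simp only [planeForm, Complex.mul_re, Complex.mul_im, Complex.exp_ofReal_mul_I_re,
    Complex.exp_ofReal_mul_I_im]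
  linear_combination (a.re * b.im - a.im * b.re) * Real.sin_sq_add_cos_sq θ

/-- The left argument of the planar symplectic form, as a continuous linear form. -/
def planeFormL (a : ℂ) : ℂ →L[ℝ] ℝ := a.re • Complex.imCLM - a.im • Complex.reCLM

theorem planeFormL_apply (a b : ℂ) : planeFormL a b = planeForm a b := rfl

theorem contDiff_planeForm {F : Type*} [NormedAddCommGroup F] [NormedSpace ℝ F]
    {f g : F → ℂ} (hf : ContDiff ℝ ∞ f) (hg : ContDiff ℝ ∞ g) :
    ContDiff ℝ ∞ fun x => planeForm (f x) (g x) :=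
  ((Complex.reCLM.contDiff.comp hf).mul (Complex.imCLM.contDiff.comp hg)).sub
    ((Complex.imCLM.contDiff.comp hf).mul (Complex.reCLM.contDiff.comp hg))

/-- `ψ` is a compactly supported isotopy of the plane, with inverse `χ`, and `T s` is a compactly
supported primitive of `λ - ψ_s^* λ`, where `λ` is the standard primitive of the area form. -/
structure IsTwist (ψ χ : ℝ → ℂ → ℂ) (T : ℝ → ℂ → ℝ) (R : ℝ) : Prop where
  smooth : ContDiff ℝ ∞ fun q : ℝ × ℂ => ψ q.1 q.2
  smooth_inv : ContDiff ℝ ∞ fun q : ℝ × ℂ => χ q.1 q.2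
  smooth_primitive : ContDiff ℝ ∞ fun q : ℝ × ℂ => T q.1 q.2
  left_inv : ∀ s ζ, χ s (ψ s ζ) = ζ
  right_inv : ∀ s ζ, ψ s (χ s ζ) = ζ
  zero : ∀ ζ, ψ 0 ζ = ζ
  primitive_zero : ∀ ζ, T 0 ζ = 0
  eq_self : ∀ s ζ, R ≤ ‖ζ‖ → ψ s ζ = ζ
  primitive_eq_zero : ∀ s ζ, R ≤ ‖ζ‖ → T s ζ = 0
  fderiv_primitive : ∀ s ζ v, fderiv ℝ (T s) ζ v =
    1 / 2 * planeForm ζ v - 1 / 2 * planeForm (ψ s ζ) (fderiv ℝ (ψ s) ζ v)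

/-- Rotation about the point `c` by an angle depending on the distance. -/
def twist (c : ℂ) (g : ℝ → ℝ) (s : ℝ) (ζ : ℂ) : ℂ :=
  c + Complex.exp ((s * g (‖ζ - c‖ ^ 2) : ℝ) * Complex.I) * (ζ - c)

theorem norm_twist_sub (c : ℂ) (g : ℝ → ℝ) (s : ℝ) (ζ : ℂ) : ‖twist c g s ζ - c‖ = ‖ζ - c‖ := by
  rw [twist, add_sub_cancel_left, norm_mul, Complex.norm_exp_ofReal_mul_I, one_mul]

theorem twist_neg_twist (c : ℂ) (g : ℝ → ℝ) (s : ℝ) (ζ : ℂ) :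
    twist c g (-s) (twist c g s ζ) = ζ := by
  rw [twist, norm_twist_sub, twist, add_sub_cancel_left, ← mul_assoc, ← Complex.exp_add]
  push_cast
  rw [← add_mul]
  simp

theorem contDiff_twist (c : ℂ) {g : ℝ → ℝ} (hg : ContDiff ℝ ∞ g) :
    ContDiff ℝ ∞ fun q : ℝ × ℂ => twist c g q.1 q.2 := by
  have h1 : ContDiff ℝ ∞ fun q : ℝ × ℂ => q.1 * g (‖q.2 - c‖ ^ 2) :=
    contDiff_fst.mul (hg.comp ((contDiff_snd.sub contDiff_const).norm_sq ℝ))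
  have h2 : ContDiff ℝ ∞ fun q : ℝ × ℂ =>
      Complex.exp ((q.1 * g (‖q.2 - c‖ ^ 2) : ℝ) * Complex.I) :=
    ((Complex.ofRealCLM.contDiff.comp h1).mul contDiff_const).cexp
  exact contDiff_const.add (h2.mul (contDiff_snd.sub contDiff_const))

/-- Let u = |ζ - c|², g = Θ', and let λ_c be the primitive centred at c, that is ½ u times the
angular form. Rotation by the angle s g(u) adds ½ s u g'(u) du to λ_c, and -½ s u g'(u) du is the
differential of ½ s (Θ - u g). Since λ - λ_c = ½ d(planeForm c ζ), recentring adds the term ½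
planeForm c (ζ - ψ). -/
theorem isTwist_twist (c : ℂ) {Θ : ℝ → ℝ} (hΘ : ContDiff ℝ ∞ Θ) {R : ℝ}
    (h0 : ∀ ζ : ℂ, R ≤ ‖ζ‖ → Θ (‖ζ - c‖ ^ 2) = 0 ∧ deriv Θ (‖ζ - c‖ ^ 2) = 0) :
    IsTwist (twist c (deriv Θ)) (fun s => twist c (deriv Θ) (-s))
      (fun s ζ => 1 / 2 * planeForm c (ζ - twist c (deriv Θ) s ζ) +
        s * (1 / 2 * (Θ (‖ζ - c‖ ^ 2) - ‖ζ - c‖ ^ 2 * deriv Θ (‖ζ - c‖ ^ 2)))) R := by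
  have hg : ContDiff ℝ ∞ (deriv Θ) := hΘ.iterate_deriv 1
  have hself : ∀ s ζ, R ≤ ‖ζ‖ → twist c (deriv Θ) s ζ = ζ := fun s ζ hζ => by
    rw [twist, (h0 ζ hζ).2]
    simp
  have hu : ContDiff ℝ ∞ fun q : ℝ × ℂ => ‖q.2 - c‖ ^ 2 :=
    (contDiff_snd.sub contDiff_const).norm_sq ℝ
  refine ⟨contDiff_twist c hg, ?_, ?_, twist_neg_twist c _, fun s ζ => ?_, fun ζ => ?_,
    fun ζ => ?_, hself, fun s ζ hζ => ?_, fun s ζ v => ?_⟩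
  · exact (contDiff_twist c hg).comp (contDiff_fst.neg.prodMk contDiff_snd)
  · exact (contDiff_const.mul (contDiff_planeForm contDiff_const
      (contDiff_snd.sub (contDiff_twist c hg)))).add
      (contDiff_fst.mul (contDiff_const.mul ((hΘ.comp hu).sub (hu.mul (hg.comp hu)))))
  · have := twist_neg_twist c (deriv Θ) (-s) ζ
    rwa [neg_neg] at this
  · simp [twist]
  · simp [twist, planeForm]
  · simp only [hself s ζ hζ, (h0 ζ hζ).1, (h0 ζ hζ).2]
    simp [planeForm]
  · let u : ℂ → ℝ := fun ζ => ‖ζ - c‖ ^ 2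
    obtain ⟨u', hu'⟩ : ∃ u', HasFDerivAt u u' ζ := by
      have : ContDiff ℝ ∞ u := (contDiff_id.sub contDiff_const).norm_sq ℝ
      exact ⟨_, (this.differentiable (by simp) ζ).hasFDerivAt⟩
    let g := deriv Θ
    have hgu : HasFDerivAt (fun ζ => g (u ζ)) (deriv g (u ζ) • u') ζ :=
      ((hg.differentiable (by simp) _).hasDerivAt).comp_hasFDerivAt ζ hu'
    have hΘu : HasFDerivAt (fun ζ => Θ (u ζ)) (g (u ζ) • u') ζ :=
      ((hΘ.differentiable (by simp) _).hasDerivAt).comp_hasFDerivAt ζ hu'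
    let e : ℂ := Complex.exp ((s * g (u ζ) : ℝ) * Complex.I)
    have hexp : HasFDerivAt (fun ζ => Complex.exp ((s * g (u ζ) : ℝ) * Complex.I))
        ((s * deriv g (u ζ)) • u'.smulRight (e * Complex.I)) ζ := by
      have h1 : HasDerivAt (fun θ : ℝ => Complex.exp ((s * θ : ℝ) * Complex.I))
          (e * (s * Complex.I)) (g (u ζ)) := by
        have := ((((hasDerivAt_id (g (u ζ))).const_mul s).ofReal_comp).mul_const
          Complex.I).cexp
        rw [mul_one] at this
        exact this
      refine (h1.hasFDerivAt.comp ζ hgu).congr_fderiv ?_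
      ext1 v
      simp
      ring
    have hψ : HasFDerivAt (twist c g s) (e • ContinuousLinearMap.id ℝ ℂ +
        (ζ - c) • ((s * deriv g (u ζ)) • u'.smulRight (e * Complex.I))) ζ := by
      have := (hexp.mul ((hasFDerivAt_id ζ).sub_const c)).const_add c
      exact this
    have hT : HasFDerivAt (fun ζ => 1 / 2 * planeForm c (ζ - twist c g s ζ) +
        s * (1 / 2 * (Θ (u ζ) - u ζ * g (u ζ)))) _ ζ :=
      ((((planeFormL c).hasFDerivAt.comp ζ ((hasFDerivAt_id ζ).sub hψ)).const_mul (1 / 2)).add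
        (((hΘu.sub (hu'.mul hgu)).const_mul (1 / 2)).const_mul s))
    rw [hψ.fderiv, hT.fderiv]
    have huv : u ζ = (ζ - c).re * (ζ - c).re + (ζ - c).im * (ζ - c).im := by
      rw [← Complex.normSq_apply, Complex.normSq_eq_norm_sq]
    have htw : twist c g s ζ = c + e * (ζ - c) := rfl
    have he : e.re ^ 2 + e.im ^ 2 = 1 := by
      have : ‖e‖ = 1 := Complex.norm_exp_ofReal_mul_I _
      have h2 := Complex.normSq_apply e
      rw [Complex.normSq_eq_norm_sq, this] at h2
      linarith
    rw [htw]
    simp only [add_apply, sub_apply, smul_apply, ContinuousLinearMap.comp_apply, smul_eq_mul,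
      ContinuousLinearMap.id_apply, ContinuousLinearMap.smulRight_apply, planeFormL_apply]
    generalize u' v = w
    generalize deriv g (u ζ) = g' at *
    generalize g (u ζ) = g0 at *
    rw [huv]
    simp only [planeForm, Complex.add_re, Complex.add_im, Complex.sub_re, Complex.sub_im,
      Complex.mul_re, Complex.mul_im, Complex.I_re, Complex.I_im, Complex.real_smul,
      Complex.ofReal_re, Complex.ofReal_im]
    linear_combination (1 / 2 * ((ζ.re - c.re) * v.im - (ζ.im - c.im) * v.re +
      s * g' * w * ((ζ.re - c.re) ^ 2 + (ζ.im - c.im) ^ 2))) * he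

/-- There is a twist which moves a given disc away from itself. -/
theorem exists_twist {B : ℝ} (hB : 0 ≤ B) : ∃ ψ χ T R, IsTwist ψ χ T R ∧ 0 < R ∧
    ∀ ζ, B ^ 2 < ‖ζ‖ ^ 2 + 2 * ‖ψ 1 ζ‖ ^ 2 := by
  -- The centre `c` is at distance `B + 1` from the origin, so the disc of radius `B` lies within
  -- distance `2 * B + 1` of `c`; there Θ(u) = πu and the rotation angle at time `1` is π.
  let A : ℝ := (2 * B + 1) ^ 2
  let f : ContDiffBump (0 : ℝ) := ⟨A + 1, A + 2, by positivity, by linarith⟩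
  let Θ : ℝ → ℝ := fun u => Real.pi * u * f u
  have hΘ : ContDiff ℝ ∞ Θ := (contDiff_const.mul contDiff_id).mul f.contDiff
  let c : ℂ := ((B + 1 : ℝ) : ℂ)
  have hc : ‖c‖ = B + 1 := by
    rw [Complex.norm_real, Real.norm_of_nonneg (by linarith)]
  -- Beyond radius `R` the distance to `c` is at least `A + 3`, whose square exceeds the outer
  -- radius `A + 2` of the bump function.
  let R : ℝ := B + 1 + (A + 3)
  have hA : 0 ≤ A := by positivity
  refine ⟨_, _, _, R, isTwist_twist c hΘ fun ζ hζ => ?_, by positivity, fun ζ => ?_⟩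
  · have h1 : A + 3 ≤ ‖ζ - c‖ := by
      have := norm_sub_norm_le ζ c
      rw [hc] at this
      linarith
    have h2 : A + 2 < ‖ζ - c‖ ^ 2 := by nlinarith
    have h3 : Θ =ᶠ[𝓝 (‖ζ - c‖ ^ 2)] fun _ => 0 := by
      filter_upwards [lt_mem_nhds h2] with u hu
      simp only [Θ]
      rw [f.zero_of_le_dist, mul_zero]
      rw [Real.dist_eq, sub_zero]
      exact hu.le.trans (le_abs_self u)
    exact ⟨h3.self_of_nhds, by rw [h3.deriv_eq, deriv_const]⟩
  · by_cases hζ : B < ‖ζ‖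
    · nlinarith [sq_nonneg ‖twist c (deriv Θ) 1 ζ‖]
    have h1 : ‖ζ - c‖ ≤ 2 * B + 1 := by
      have := norm_sub_le ζ c
      rw [hc] at this
      linarith
    have h2 : ‖ζ - c‖ ^ 2 < A + 1 := by nlinarith [norm_nonneg (ζ - c)]
    have h3 : Θ =ᶠ[𝓝 (‖ζ - c‖ ^ 2)] fun u => Real.pi * u := by
      have h0 : -(A + 1) < ‖ζ - c‖ ^ 2 := by nlinarith [sq_nonneg ‖ζ - c‖]
      filter_upwards [gt_mem_nhds h2, lt_mem_nhds h0] with u hu hu0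
      simp only [Θ]
      rw [f.one_of_mem_closedBall, mul_one]
      rw [mem_closedBall_zero_iff, Real.norm_eq_abs]
      exact (abs_lt.2 ⟨hu0, hu⟩).le
    have h4 : deriv Θ (‖ζ - c‖ ^ 2) = Real.pi := by
      rw [h3.deriv_eq]
      simp
    -- On the disc the twist is the half turn about `c`, which sends it to points of norm at least
    -- 2(B + 1) - B = B + 2.
    have h5 : twist c (deriv Θ) 1 ζ = 2 * c - ζ := by
      rw [twist, h4, one_mul, Complex.exp_pi_mul_I]
      ring
    have h6 : B + 2 ≤ ‖2 * c - ζ‖ := by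
      have := norm_sub_norm_le (2 * c) ζ
      rw [norm_mul, hc, Complex.norm_ofNat] at this
      linarith
    rw [h5]
    nlinarith [sq_nonneg ‖ζ‖]

end Twist

/-! ### The equivariant twist map on M × ℂᵏ⁺¹. -/

section TwistMap

open Filter Topology

theorem mfderiv_comp_vector {E : Type*} [NormedAddCommGroup E] [NormedSpace ℝ E]
    {H : Type*} [TopologicalSpace H] {I : ModelWithCorners ℝ E H}
    {M : Type*} [TopologicalSpace M] [ChartedSpace H M]
    {V W : Type*} [NormedAddCommGroup V] [NormedSpace ℝ V] [NormedAddCommGroup W] [NormedSpace ℝ W]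
    {F : V → W} {h : M → V} {x : M} (hF : DifferentiableAt ℝ F (h x))
    (hh : MDifferentiableAt I 𝓘(ℝ, V) h x) (v : TangentSpace I x) :
    mfderiv I 𝓘(ℝ, W) (fun x => F (h x)) x v = fderiv ℝ F (h x) (mfderiv I 𝓘(ℝ, V) h x v) :=
  congrArg (fun A : E →L[ℝ] W => A v)
    (HasMFDerivAt.comp x hF.hasFDerivAt.hasMFDerivAt hh.hasMFDerivAt).mfderiv

/-- The tail of a vector of `ℂᵏ⁺¹`. -/
def tailL (k : ℕ) : Cn (k + 1) →L[ℝ] Cn k :=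
  LinearMap.toContinuousLinearMap
    { toFun := fun z => WithLp.toLp 2 fun j => z j.succ
      map_add' := fun _ _ => rfl
      map_smul' := fun _ _ => rfl }

/-- The first coordinate of a vector of `ℂᵏ⁺¹`. -/
def headL (k : ℕ) : Cn (k + 1) →L[ℝ] ℂ :=
  LinearMap.toContinuousLinearMap
    { toFun := fun z => z 0
      map_add' := fun _ _ => rfl
      map_smul' := fun _ _ => rfl }

/-- The vector of `ℂᵏ⁺¹` with given first coordinate and tail. -/
def consL (k : ℕ) : ℂ × Cn k →L[ℝ] Cn (k + 1) :=
  LinearMap.toContinuousLinearMap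
    { toFun := fun q => WithLp.toLp 2 (Fin.cons q.1 fun j => q.2 j)
      map_add' := fun _ _ => by
        ext j
        refine Fin.cases ?_ (fun i => ?_) j <;> simp
      map_smul' := fun _ _ => by
        ext j
        refine Fin.cases ?_ (fun i => ?_) j <;> simp }

variable {k : ℕ}

theorem headL_apply (z : Cn (k + 1)) : headL k z = z 0 := rfl

@[simp] theorem headL_consL (c : ℂ) (w : Cn k) : headL k (consL k (c, w)) = c := rfl

@[simp] theorem tailL_consL (c : ℂ) (w : Cn k) : tailL k (consL k (c, w)) = w := rfl

@[simp] theorem consL_headL_tailL (z : Cn (k + 1)) : consL k (headL k z, tailL k z) = z := by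
  ext j
  refine Fin.cases rfl (fun i => rfl) j

theorem eq_of_headL_tailL {z z' : Cn (k + 1)} (h0 : headL k z = headL k z')
    (h1 : tailL k z = tailL k z') : z = z' := by
  rw [← consL_headL_tailL z, ← consL_headL_tailL z', h0, h1]

theorem norm_sq_eq_headL_tailL (z : Cn (k + 1)) :
    ‖z‖ ^ 2 = ‖headL k z‖ ^ 2 + ‖tailL k z‖ ^ 2 := by
  rw [EuclideanSpace.norm_sq_eq, EuclideanSpace.norm_sq_eq, Fin.sum_univ_succ]
  rfl

theorem stdSymplectic_succ (v w : Cn (k + 1)) : stdSymplectic (k + 1) v w =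
    planeForm (headL k v) (headL k w) + stdSymplectic k (tailL k v) (tailL k w) := by
  rw [stdSymplectic_apply, stdSymplectic_apply, Fin.sum_univ_succ]
  rfl

variable {E : Type*} [NormedAddCommGroup E] [NormedSpace ℝ E] [FiniteDimensional ℝ E]
  {H : Type*} [TopologicalSpace H] {I : ModelWithCorners ℝ E H} [I.Boundaryless]
  {M : Type*} [TopologicalSpace M] [T2Space M] [ChartedSpace H M] [IsManifold I ∞ M]
  {D : LiouvilleData I M}

/-- The projection `M × ℂᵏ⁺¹ → M × ℂᵏ` which forgets the first complex coordinate. -/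
def tailPt (p : M × Cn (k + 1)) : M × Cn k := (p.1, tailL k p.2)

/-- The first complex coordinate of a point of `M × ℂᵏ⁺¹`. -/
def headPt (p : M × Cn (k + 1)) : ℂ := headL k p.2

/-- The point of `M × ℂᵏ⁺¹` with given first complex coordinate and projection to `M × ℂᵏ`. -/
def consPt (c : ℂ) (y : M × Cn k) : M × Cn (k + 1) := (y.1, consL k (c, y.2))

@[simp] theorem tailPt_consPt (c : ℂ) (y : M × Cn k) : tailPt (consPt c y) = y := rfl

@[simp] theorem headPt_consPt (c : ℂ) (y : M × Cn k) : headPt (consPt c y) = c := rfl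

@[simp] theorem consPt_headPt_tailPt (p : M × Cn (k + 1)) : consPt (headPt p) (tailPt p) = p :=
  Prod.ext rfl (consL_headL_tailL p.2)

theorem eq_of_headPt_tailPt {p p' : M × Cn (k + 1)} (h0 : headPt p = headPt p')
    (h1 : tailPt p = tailPt p') : p = p' := by
  rw [← consPt_headPt_tailPt p, ← consPt_headPt_tailPt p', h0, h1]

theorem continuous_tailPt : Continuous (tailPt (M := M) (k := k)) :=
  continuous_fst.prodMk ((tailL k).continuous.comp continuous_snd)

theorem continuous_headPt : Continuous (headPt (M := M) (k := k)) :=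
  (headL k).continuous.comp continuous_snd

theorem contMDiff_tailPt :
    ContMDiff (I.prod 𝓘(ℝ, Cn (k + 1))) (I.prod 𝓘(ℝ, Cn k)) ∞ (tailPt (M := M) (k := k)) :=
  contMDiff_fst.prodMk ((tailL k).contDiff.contMDiff.comp contMDiff_snd)

theorem contMDiff_headPt :
    ContMDiff (I.prod 𝓘(ℝ, Cn (k + 1))) 𝓘(ℝ, ℂ) ∞ (headPt (M := M) (k := k)) :=
  (headL k).contDiff.contMDiff.comp contMDiff_snd

theorem contMDiff_consPt :
    ContMDiff (𝓘(ℝ, ℂ).prod (I.prod 𝓘(ℝ, Cn k))) (I.prod 𝓘(ℝ, Cn (k + 1))) ∞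
      (fun q : ℂ × (M × Cn k) => consPt q.1 q.2) :=
  (contMDiff_fst.comp contMDiff_snd).prodMk ((consL k).contDiff.contMDiff.comp
    (contMDiff_fst.prodMk_space (contMDiff_snd.comp contMDiff_snd)))

namespace LiouvilleData

theorem tailPt_flow (r : ℝ) (p : M × Cn (k + 1)) :
    tailPt ((D.stabilization (k + 1)).flow r p) = (D.stabilization k).flow r (tailPt p) :=
  Prod.ext rfl ((tailL k).map_smul _ _)

theorem headPt_flow (r : ℝ) (p : M × Cn (k + 1)) :
    headPt ((D.stabilization (k + 1)).flow r p) = Real.exp (r / 2) • headPt p :=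
  (headL k).map_smul _ _

section Split

variable {E' : Type*} [NormedAddCommGroup E'] [NormedSpace ℝ E']
  {H' : Type*} [TopologicalSpace H'] {I' : ModelWithCorners ℝ E' H'}
  {Q : Type*} [TopologicalSpace Q] [ChartedSpace H' Q]

/-- The Liouville form of `M × ℂᵏ⁺¹` is the sum of the Liouville forms of `M × ℂᵏ` and `ℂ`. -/
theorem stabilization_succ_α {f : Q → M × Cn (k + 1)} {q : Q}
    (hf : MDifferentiableAt I' (I.prod 𝓘(ℝ, Cn (k + 1))) f q) (v : TangentSpace I' q) :
    (D.stabilization (k + 1)).α (f q) (mfderiv I' (I.prod 𝓘(ℝ, Cn (k + 1))) f q v) =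
      (D.stabilization k).α (tailPt (f q))
        (mfderiv I' (I.prod 𝓘(ℝ, Cn k)) (fun q => tailPt (f q)) q v) +
      1 / 2 * planeForm (headPt (f q)) (mfderiv I' 𝓘(ℝ, ℂ) (fun q => headPt (f q)) q v) := by
  let B : E' →L[ℝ] E × Cn (k + 1) := mfderiv I' (I.prod 𝓘(ℝ, Cn (k + 1))) f q
  have h1 : HasMFDerivAt (I.prod 𝓘(ℝ, Cn (k + 1))) 𝓘(ℝ, Cn (k + 1))
      (Prod.snd : M × Cn (k + 1) → Cn (k + 1)) (f q) (ContinuousLinearMap.snd ℝ E (Cn (k + 1))) :=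
    hasMFDerivAt_snd (f q)
  have h2 : HasMFDerivAt (I.prod 𝓘(ℝ, Cn (k + 1))) I
      (Prod.fst : M × Cn (k + 1) → M) (f q) (ContinuousLinearMap.fst ℝ E (Cn (k + 1))) :=
    hasMFDerivAt_fst (f q)
  have h3 : HasMFDerivAt 𝓘(ℝ, Cn (k + 1)) 𝓘(ℝ, Cn k) (tailL k) (f q).2 (tailL k) :=
    (tailL k).hasFDerivAt.hasMFDerivAt
  have h4 : HasMFDerivAt 𝓘(ℝ, Cn (k + 1)) 𝓘(ℝ, ℂ) (headL k) (f q).2 (headL k) :=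
    (headL k).hasFDerivAt.hasMFDerivAt
  have ht : (mfderiv I' (I.prod 𝓘(ℝ, Cn k)) (fun q => tailPt (f q)) q v : E × Cn k) =
      ((B v).1, tailL k (B v).2) :=
    congrArg (fun A : E' →L[ℝ] E × Cn k => A v)
      (HasMFDerivAt.comp q (h2.prodMk (HasMFDerivAt.comp (f q) h3 h1)) hf.hasMFDerivAt).mfderiv
  have hh : (mfderiv I' 𝓘(ℝ, ℂ) (fun q => headPt (f q)) q v : ℂ) = headL k (B v).2 :=
    congrArg (fun A : E' →L[ℝ] ℂ => A v)
      (HasMFDerivAt.comp q (HasMFDerivAt.comp (f q) h4 h1) hf.hasMFDerivAt).mfderiv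
  rw [ht, hh]
  refine (stabilization_α (f q) (B v)).trans (Eq.trans ?_
    (congrArg (· + 1 / 2 * planeForm (headPt (f q)) (headL k (B v).2))
      (stabilization_α (tailPt (f q)) ((B v).1, tailL k (B v).2)).symm))
  have h5 := stdSymplectic_succ (f q).2 (B v).2
  refine (congrArg (fun r => D.α (f q).1 (B v).1 + 1 / 2 * r) h5).trans ?_
  change D.α (f q).1 (B v).1 + 1 / 2 * (planeForm (headL k (f q).2) (headL k (B v).2) +
    stdSymplectic k (tailL k (f q).2) (tailL k (B v).2)) = D.α (f q).1 (B v).1 +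
    1 / 2 * stdSymplectic k (tailL k (f q).2) (tailL k (B v).2) +
    1 / 2 * planeForm (headL k (f q).2) (headL k (B v).2)
  ring

end Split

/-- The derivative of the scaling factor is radial and is killed by `planeForm_self`; what remains
is homogeneous of degree two in e^{τ/2}. -/
theorem planeForm_exp_smul {ψ : ℂ → ℂ} {q : ℝ × ℂ} (hψ : DifferentiableAt ℝ ψ q.2) (w : ℝ × ℂ) :
    planeForm (Real.exp (q.1 / 2) • ψ q.2)
      (fderiv ℝ (fun q : ℝ × ℂ => Real.exp (q.1 / 2) • ψ q.2) q w) =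
      Real.exp q.1 * planeForm (ψ q.2) (fderiv ℝ ψ q.2 w.2) := by
  have h1 : HasFDerivAt (fun q : ℝ × ℂ => Real.exp (q.1 / 2))
      (Real.exp (q.1 / 2) • ((2 : ℝ)⁻¹ • ContinuousLinearMap.fst ℝ ℝ ℂ)) q := by
    have h0 : HasFDerivAt (fun q : ℝ × ℂ => q.1 / 2) ((2 : ℝ)⁻¹ • ContinuousLinearMap.fst ℝ ℝ ℂ) q := by
      simp only [div_eq_inv_mul]
      exact hasFDerivAt_fst.const_mul _
    exact h0.exp
  have h2 : HasFDerivAt (fun q : ℝ × ℂ => ψ q.2)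
      ((fderiv ℝ ψ q.2).comp (ContinuousLinearMap.snd ℝ ℝ ℂ)) q :=
    hψ.hasFDerivAt.comp q hasFDerivAt_snd
  have h4 : HasFDerivAt (fun q : ℝ × ℂ => Real.exp (q.1 / 2) • ψ q.2) _ q := h1.smul h2
  rw [h4.fderiv]
  have h3 : Real.exp q.1 = Real.exp (q.1 / 2) * Real.exp (q.1 / 2) := by
    rw [← Real.exp_add, add_halves]
  simp only [add_apply, smul_apply, ContinuousLinearMap.comp_apply,
    ContinuousLinearMap.smulRight_apply, ContinuousLinearMap.coe_fst', ContinuousLinearMap.coe_snd']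
  rw [planeForm_add_right, planeForm_smul_left, planeForm_smul_left, planeForm_smul_right,
    planeForm_smul_right, planeForm_self, h3]
  ring

/-- The first complex coordinate, normalized with the help of the starshaped hypersurface `P` of
`M × ℂᵏ` so that it is constant along the Liouville flow. -/
def normHead (D : LiouvilleData I M) (P : Set (M × Cn k)) (p : M × Cn (k + 1)) : ℂ :=
  Real.exp (-((D.stabilization k).hitTime P (tailPt p) / 2)) • headPt p

theorem exp_smul_normHead (P : Set (M × Cn k)) (p : M × Cn (k + 1)) :
    Real.exp ((D.stabilization k).hitTime P (tailPt p) / 2) • D.normHead P p = headPt p := by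
  rw [normHead, smul_smul, ← Real.exp_add, add_neg_cancel, Real.exp_zero, one_smul]

open Classical in
/-- The equivariant symplectomorphism of `M × ℂᵏ⁺¹` given by a family `ψ` of compactly supported
maps of the plane and the Reeb flow `G` for the times prescribed by the functions `T`. -/
def twistMap (D : LiouvilleData I M) (P U : Set (M × Cn k)) (G : ℝ → M × Cn k → M × Cn k)
    (ψ : ℝ → ℂ → ℂ) (T : ℝ → ℂ → ℝ) (s : ℝ) (p : M × Cn (k + 1)) : M × Cn (k + 1) :=
  if tailPt p ∈ (D.stabilization k).core U then p else
    consPt (Real.exp ((D.stabilization k).hitTime P (tailPt p) / 2) • ψ s (D.normHead P p))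
      (G (T s (D.normHead P p)) (tailPt p))

section

variable {P U : Set (M × Cn k)} {G : ℝ → M × Cn k → M × Cn k} {ψ χ : ℝ → ℂ → ℂ} {T : ℝ → ℂ → ℝ}
  {T' : ℝ → ℂ → ℝ} {R : ℝ}

theorem twistMap_of_mem {s : ℝ} {p : M × Cn (k + 1)}
    (hp : tailPt p ∈ (D.stabilization k).core U) : D.twistMap P U G ψ T s p = p := if_pos hp

theorem twistMap_of_notMem {s : ℝ} {p : M × Cn (k + 1)}
    (hp : tailPt p ∉ (D.stabilization k).core U) : D.twistMap P U G ψ T s p =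
    consPt (Real.exp ((D.stabilization k).hitTime P (tailPt p) / 2) • ψ s (D.normHead P p))
      (G (T s (D.normHead P p)) (tailPt p)) := if_neg hp

variable (hN : (D.stabilization k).IsLiouville) (h : (D.stabilization k).IsStarshaped P U)
  (hG : (D.stabilization k).IsReebFlow P U G)

section

include hG

theorem tailPt_twistMap_notMem {s : ℝ} {p : M × Cn (k + 1)}
    (hp : tailPt p ∉ (D.stabilization k).core U) :
    tailPt (D.twistMap P U G ψ T s p) ∉ (D.stabilization k).core U := by
  rw [twistMap_of_notMem hp]
  exact hG.mapsTo _ _ hp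

theorem hitTime_tailPt_twistMap {s : ℝ} {p : M × Cn (k + 1)}
    (hp : tailPt p ∉ (D.stabilization k).core U) :
    (D.stabilization k).hitTime P (tailPt (D.twistMap P U G ψ T s p)) =
      (D.stabilization k).hitTime P (tailPt p) := by
  rw [twistMap_of_notMem hp]
  exact hG.hitTime _ _ hp

theorem normHead_twistMap {s : ℝ} {p : M × Cn (k + 1)}
    (hp : tailPt p ∉ (D.stabilization k).core U) :
    D.normHead P (D.twistMap P U G ψ T s p) = ψ s (D.normHead P p) := by
  rw [normHead, hitTime_tailPt_twistMap hG hp, twistMap_of_notMem hp, headPt_consPt, smul_smul,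
    ← Real.exp_add, neg_add_cancel, Real.exp_zero, one_smul]

/-- In the coordinates (ζ, y) the map is (ζ, y) ↦ (ψ_s(ζ), G_{T_s(ζ)} y), and τ does not change.
Applying χ_s with the opposite Reeb time therefore undoes it. -/
theorem twistMap_twistMap {s : ℝ} (hχ : ∀ ζ, χ s (ψ s ζ) = ζ) (hT : ∀ ζ, T' s (ψ s ζ) = -T s ζ)
    (p : M × Cn (k + 1)) :
    D.twistMap P U G χ T' s (D.twistMap P U G ψ T s p) = p := by
  by_cases hp : tailPt p ∈ (D.stabilization k).core U
  · rw [twistMap_of_mem (s := s) (ψ := ψ) hp, twistMap_of_mem hp]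
  · rw [twistMap_of_notMem (tailPt_twistMap_notMem hG hp), hitTime_tailPt_twistMap hG hp,
      normHead_twistMap hG hp, hχ, hT, exp_smul_normHead, twistMap_of_notMem hp, tailPt_consPt,
      ← hG.add _ _ _ hp, neg_add_cancel, hG.zero _ hp, consPt_headPt_tailPt]

end

include hN h

theorem normHead_flow (r : ℝ) {p : M × Cn (k + 1)}
    (hp : tailPt p ∉ (D.stabilization k).core U) :
    D.normHead P ((D.stabilization (k + 1)).flow r p) = D.normHead P p := by
  rw [normHead, tailPt_flow, hN.hitTime_flow h r hp, headPt_flow, smul_smul, ← Real.exp_add, normHead]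
  congr 2
  ring

theorem twistMap_flow (hG : (D.stabilization k).IsReebFlow P U G) (s r : ℝ)
    (p : M × Cn (k + 1)) : D.twistMap P U G ψ T s ((D.stabilization (k + 1)).flow r p) =
      (D.stabilization (k + 1)).flow r (D.twistMap P U G ψ T s p) := by
  by_cases hp : tailPt p ∈ (D.stabilization k).core U
  · rw [twistMap_of_mem hp, twistMap_of_mem]
    rw [tailPt_flow]
    exact (hN.flow_mem_core_iff h r).2 hp
  · have hp' : tailPt ((D.stabilization (k + 1)).flow r p) ∉ (D.stabilization k).core U := by
      rw [tailPt_flow]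
      exact mt (hN.flow_mem_core_iff h r).1 hp
    apply eq_of_headPt_tailPt
    · rw [twistMap_of_notMem hp', normHead_flow hN h r hp, headPt_consPt, tailPt_flow,
        hN.hitTime_flow h r hp, headPt_flow, twistMap_of_notMem hp, headPt_consPt, smul_smul,
        ← Real.exp_add]
      congr 2
      ring
    · rw [twistMap_of_notMem hp', normHead_flow hN h r hp, tailPt_consPt, tailPt_flow,
        tailPt_flow, twistMap_of_notMem hp, tailPt_consPt, hG.flow _ _ _ hp]

theorem contMDiffAt_normHead {p : M × Cn (k + 1)}
    (hp : tailPt p ∉ (D.stabilization k).core U) :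
    ContMDiffAt (I.prod 𝓘(ℝ, Cn (k + 1))) 𝓘(ℝ, ℝ × ℂ) ∞
      (fun p => ((D.stabilization k).hitTime P (tailPt p), D.normHead P p)) p := by
  have h1 : ContMDiffAt (I.prod 𝓘(ℝ, Cn (k + 1))) 𝓘(ℝ, ℝ) ∞
      (fun p => (D.stabilization k).hitTime P (tailPt p)) p :=
    (hN.contMDiffAt_hitTime h hp).comp p contMDiff_tailPt.contMDiffAt
  have h2 : ContMDiffAt (I.prod 𝓘(ℝ, Cn (k + 1))) 𝓘(ℝ, ℝ × ℂ) ∞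
      (fun p => ((D.stabilization k).hitTime P (tailPt p), headPt p)) p :=
    h1.prodMk_space contMDiff_headPt.contMDiffAt
  have h3 : ContDiff ℝ ∞ fun q : ℝ × ℂ => (q.1, Real.exp (-(q.1 / 2)) • q.2) := by fun_prop
  exact h3.contMDiff.contMDiffAt.comp p h2

/-- Near the points whose projection lies in the core, the normalized first coordinate is large. -/
theorem eventually_le_norm_normHead {p : M × Cn (k + 1)}
    (hp : tailPt p ∈ (D.stabilization k).core U) (hp0 : headPt p ≠ 0) (R : ℝ) :
    ∀ᶠ p' in 𝓝 p, tailPt p' ∉ (D.stabilization k).core U → R ≤ ‖D.normHead P p'‖ := by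
  have hpos : 0 < ‖headPt p‖ := norm_pos_iff.2 hp0
  have h1 : Tendsto (fun t : ℝ => Real.exp (t / 2) * (‖headPt p‖ / 2)) atTop atTop :=
    (Real.tendsto_exp_atTop.comp (tendsto_id.atTop_div_const two_pos)).atTop_mul_const (by positivity)
  -- Close to the core the hitting time is below `-t`, so the normalizing factor exceeds e^{t/2},
  -- while |z₁| stays above half of its value at `p`.
  obtain ⟨t, ht⟩ := (h1.eventually_ge_atTop R).exists
  have ho : IsOpen ((D.stabilization k).flow t ⁻¹' U) :=
    h.isOpen_domain.preimage (hN.contMDiff_flow t).continuous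
  have hmem : tailPt p ∈ (D.stabilization k).flow t ⁻¹' U :=
    hN.core_subset h ((hN.flow_mem_core_iff h t).2 hp)
  have h2 : ∀ᶠ p' in 𝓝 p, tailPt p' ∈ (D.stabilization k).flow t ⁻¹' U :=
    continuous_tailPt.continuousAt.eventually (ho.mem_nhds hmem)
  have h3 : ∀ᶠ p' in 𝓝 p, ‖headPt p‖ / 2 < ‖headPt p'‖ :=
    continuousAt_const.eventually_lt continuous_headPt.norm.continuousAt
      (half_lt_self hpos)
  filter_upwards [h2, h3] with p' h2 h3 hp'
  have h4 := (hN.mem_domain_iff h (mt (hN.flow_mem_core_iff h t).1 hp')).1 h2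
  rw [hN.hitTime_flow h t hp'] at h4
  rw [normHead, norm_smul, Real.norm_of_nonneg (Real.exp_pos _).le]
  refine ht.trans (mul_le_mul (Real.exp_le_exp.2 (by linarith)) h3.le (by positivity)
    (Real.exp_pos _).le)

include hG

/-- Near such points ζ lies outside the supports of ψ and T. The extension by the identity over the
core is therefore smooth wherever z₁ ≠ 0. -/
theorem twistMap_eventuallyEq {p : M × Cn (k + 1)}
    (hp : tailPt p ∈ (D.stabilization k).core U) (hp0 : headPt p ≠ 0)
    (hψ : ∀ s ζ, R ≤ ‖ζ‖ → ψ s ζ = ζ) (hT : ∀ s ζ, R ≤ ‖ζ‖ → T s ζ = 0) :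
    ∀ᶠ p' in 𝓝 p, ∀ s, D.twistMap P U G ψ T s p' = p' := by
  filter_upwards [eventually_le_norm_normHead hN h hp hp0 R] with p' h1 s
  by_cases hp' : tailPt p' ∈ (D.stabilization k).core U
  · exact twistMap_of_mem hp'
  · rw [twistMap_of_notMem hp', hψ _ _ (h1 hp'), hT _ _ (h1 hp'), hG.zero _ hp',
      exp_smul_normHead, consPt_headPt_tailPt]

theorem contMDiffAt_twistMap {s : ℝ} {p : M × Cn (k + 1)}
    (hp : tailPt p ∉ (D.stabilization k).core U ∨ headPt p ≠ 0)
    (hψs : ContDiff ℝ ∞ fun q : ℝ × ℂ => ψ q.1 q.2) (hTs : ContDiff ℝ ∞ fun q : ℝ × ℂ => T q.1 q.2)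
    (hψ : ∀ s ζ, R ≤ ‖ζ‖ → ψ s ζ = ζ) (hT : ∀ s ζ, R ≤ ‖ζ‖ → T s ζ = 0) :
    ContMDiffAt (𝓘(ℝ, ℝ).prod (I.prod 𝓘(ℝ, Cn (k + 1)))) (I.prod 𝓘(ℝ, Cn (k + 1))) ∞
      (fun q : ℝ × (M × Cn (k + 1)) => D.twistMap P U G ψ T q.1 q.2) (s, p) := by
  by_cases hpc : tailPt p ∈ (D.stabilization k).core U
  · have hp0 := hp.resolve_left (not_not.2 hpc)
    have h1 := (twistMap_eventuallyEq (ψ := ψ) (T := T) hN h hG hpc hp0 hψ hT)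
    have h2 : (fun q : ℝ × (M × Cn (k + 1)) => D.twistMap P U G ψ T q.1 q.2) =ᶠ[𝓝 (s, p)]
        fun q => q.2 := by
      filter_upwards [continuousAt_snd.eventually h1] with q hq using hq q.1
    exact contMDiffAt_snd.congr_of_eventuallyEq h2
  · have h1 := (contMDiffAt_normHead hN h hpc).comp (s, p)
      (contMDiffAt_snd (I := 𝓘(ℝ, ℝ)) (M := ℝ) (n := ∞))
    have h2 : ContMDiffAt (𝓘(ℝ, ℝ).prod (I.prod 𝓘(ℝ, Cn (k + 1)))) 𝓘(ℝ, ℝ × (ℝ × ℂ)) ∞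
        (fun q : ℝ × (M × Cn (k + 1)) => (q.1, ((D.stabilization k).hitTime P (tailPt q.2),
          D.normHead P q.2))) (s, p) := contMDiffAt_fst.prodMk_space h1
    have h3 : ContMDiffAt (𝓘(ℝ, ℝ).prod (I.prod 𝓘(ℝ, Cn (k + 1)))) 𝓘(ℝ, ℂ) ∞
        (fun q : ℝ × (M × Cn (k + 1)) => Real.exp ((D.stabilization k).hitTime P (tailPt q.2) / 2) •
          ψ q.1 (D.normHead P q.2)) (s, p) := by
      have : ContDiff ℝ ∞ fun r : ℝ × (ℝ × ℂ) => Real.exp (r.2.1 / 2) • ψ r.1 r.2.2 :=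
        (by fun_prop : ContDiff ℝ ∞ fun r : ℝ × (ℝ × ℂ) => Real.exp (r.2.1 / 2)).smul
          (hψs.comp (by fun_prop : ContDiff ℝ ∞ fun r : ℝ × (ℝ × ℂ) => (r.1, r.2.2)))
      exact this.contMDiff.contMDiffAt.comp (s, p) h2
    have h4 : ContMDiffAt (𝓘(ℝ, ℝ).prod (I.prod 𝓘(ℝ, Cn (k + 1)))) 𝓘(ℝ, ℝ) ∞
        (fun q : ℝ × (M × Cn (k + 1)) => T q.1 (D.normHead P q.2)) (s, p) := by
      have : ContDiff ℝ ∞ fun r : ℝ × (ℝ × ℂ) => T r.1 r.2.2 :=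
        hTs.comp (by fun_prop : ContDiff ℝ ∞ fun r : ℝ × (ℝ × ℂ) => (r.1, r.2.2))
      exact this.contMDiff.contMDiffAt.comp (s, p) h2
    have h5 : ContMDiffAt (𝓘(ℝ, ℝ).prod (I.prod 𝓘(ℝ, Cn (k + 1)))) (I.prod 𝓘(ℝ, Cn k)) ∞
        (fun q : ℝ × (M × Cn (k + 1)) => G (T q.1 (D.normHead P q.2)) (tailPt q.2)) (s, p) := by
      have h6 : ContMDiffAt (𝓘(ℝ, ℝ).prod (I.prod 𝓘(ℝ, Cn k))) (I.prod 𝓘(ℝ, Cn k)) ∞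
          (fun q : ℝ × (M × Cn k) => G q.1 q.2) (T s (D.normHead P p), tailPt p) :=
        hG.smooth.contMDiffAt ((isOpen_univ.prod (hN.isOpen_symplectization h)).mem_nhds
          ⟨trivial, hpc⟩)
      exact ContMDiffAt.comp (s, p) h6 (h4.prodMk (contMDiff_tailPt.contMDiffAt.comp (s, p)
        contMDiffAt_snd))
    refine (contMDiff_consPt.contMDiffAt.comp (s, p) (h3.prodMk h5)).congr_of_eventuallyEq ?_
    have h7 : ∀ᶠ y in 𝓝 (tailPt p), y ∉ (D.stabilization k).core U :=
      (hN.isOpen_symplectization h).mem_nhds hpc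
    have hc : ContinuousAt (fun q : ℝ × (M × Cn (k + 1)) => tailPt q.2) (s, p) :=
      (continuous_tailPt.comp continuous_snd).continuousAt
    have h8 : ∀ᶠ q : ℝ × (M × Cn (k + 1)) in 𝓝 (s, p),
        tailPt q.2 ∉ (D.stabilization k).core U :=
      hc.eventually h7
    filter_upwards [h8] with q hq using twistMap_of_notMem hq

theorem contMDiffAt_twistMap_slice {s : ℝ} {p : M × Cn (k + 1)}
    (hp : tailPt p ∉ (D.stabilization k).core U ∨ headPt p ≠ 0) (ht : IsTwist ψ χ T R) :
    ContMDiffAt (I.prod 𝓘(ℝ, Cn (k + 1))) (I.prod 𝓘(ℝ, Cn (k + 1))) ∞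
      (D.twistMap P U G ψ T s) p :=
  (contMDiffAt_twistMap hN h hG hp ht.smooth ht.smooth_primitive ht.eq_self
    ht.primitive_eq_zero).comp p (contMDiff_const.prodMk contMDiff_id :
    ContMDiff (I.prod 𝓘(ℝ, Cn (k + 1))) (𝓘(ℝ, ℝ).prod (I.prod 𝓘(ℝ, Cn (k + 1)))) ∞
      fun p : M × Cn (k + 1) => (s, p)).contMDiffAt

/-- The twist map preserves the Liouville form. -/
theorem α_twistMap {s : ℝ} {p : M × Cn (k + 1)}
    (hp : tailPt p ∉ (D.stabilization k).core U ∨ headPt p ≠ 0) (ht : IsTwist ψ χ T R)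
    (v : TangentSpace (I.prod 𝓘(ℝ, Cn (k + 1))) p) :
    (D.stabilization (k + 1)).α (D.twistMap P U G ψ T s p)
      (mfderiv (I.prod 𝓘(ℝ, Cn (k + 1))) (I.prod 𝓘(ℝ, Cn (k + 1))) (D.twistMap P U G ψ T s) p v) =
      (D.stabilization (k + 1)).α p v := by
  have hid : ∀ f : M × Cn (k + 1) → M × Cn (k + 1), f =ᶠ[𝓝 p] id →
      (D.stabilization (k + 1)).α (f p)
        (mfderiv (I.prod 𝓘(ℝ, Cn (k + 1))) (I.prod 𝓘(ℝ, Cn (k + 1))) f p v) =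
        (D.stabilization (k + 1)).α p v := by
    intro f hf
    rw [hf.mfderiv_eq, mfderiv_id]
    have key : ∀ q, q = p → (D.stabilization (k + 1)).α q (v : E × Cn (k + 1)) =
        (D.stabilization (k + 1)).α p v := by rintro _ rfl; rfl
    exact key _ hf.self_of_nhds
  by_cases hpc : tailPt p ∈ (D.stabilization k).core U
  · refine hid _ ?_
    filter_upwards [twistMap_eventuallyEq (ψ := ψ) (T := T) hN h hG hpc
      (hp.resolve_left (not_not.2 hpc)) ht.eq_self ht.primitive_eq_zero] with q hq using hq s
  have hfd : MDifferentiableAt (I.prod 𝓘(ℝ, Cn (k + 1))) (I.prod 𝓘(ℝ, Cn (k + 1)))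
      (D.twistMap P U G ψ T s) p :=
    (contMDiffAt_twistMap_slice hN h hG hp ht).mdifferentiableAt (by simp)
  rw [stabilization_succ_α hfd]
  let hh : M × Cn (k + 1) → ℝ × ℂ :=
    fun p => ((D.stabilization k).hitTime P (tailPt p), D.normHead P p)
  have hhd : MDifferentiableAt (I.prod 𝓘(ℝ, Cn (k + 1))) 𝓘(ℝ, ℝ × ℂ) hh p :=
    (contMDiffAt_normHead hN h hpc).mdifferentiableAt (by simp)
  let w : ℝ × ℂ := mfderiv (I.prod 𝓘(ℝ, Cn (k + 1))) 𝓘(ℝ, ℝ × ℂ) hh p v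
  have hψd : Differentiable ℝ (ψ s) := (ht.smooth.comp
    (contDiff_const.prodMk contDiff_id : ContDiff ℝ ∞ fun ζ : ℂ => (s, ζ))).differentiable (by simp)
  have hTd : Differentiable ℝ (T s) := (ht.smooth_primitive.comp
    (contDiff_const.prodMk contDiff_id : ContDiff ℝ ∞ fun ζ : ℂ => (s, ζ))).differentiable (by simp)
  have h7 : ∀ᶠ p' in 𝓝 p, tailPt p' ∉ (D.stabilization k).core U :=
    continuous_tailPt.continuousAt.eventually
      ((hN.isOpen_symplectization h).mem_nhds hpc)
  have hhead : ∀ ϕ : ℂ → ℂ, Differentiable ℝ ϕ → ∀ f : M × Cn (k + 1) → ℂ,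
      (f =ᶠ[𝓝 p] fun p' => Real.exp ((hh p').1 / 2) • ϕ (hh p').2) →
      planeForm (f p) (mfderiv (I.prod 𝓘(ℝ, Cn (k + 1))) 𝓘(ℝ, ℂ) f p v) =
        Real.exp (hh p).1 * planeForm (ϕ (hh p).2) (fderiv ℝ ϕ (hh p).2 w.2) := by
    intro ϕ hϕ f hf
    have hd : Differentiable ℝ fun q : ℝ × ℂ => Real.exp (q.1 / 2) • ϕ q.2 :=
      (by fun_prop : Differentiable ℝ fun q : ℝ × ℂ => Real.exp (q.1 / 2)).smul
        (hϕ.comp differentiable_snd)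
    rw [← planeForm_exp_smul (hϕ _), hf.self_of_nhds, hf.mfderiv_eq]
    exact congrArg (planeForm _) (mfderiv_comp_vector (hd _) hhd v)
  have e1 := hhead (ψ s) hψd (fun p' => headPt (D.twistMap P U G ψ T s p')) (by
    filter_upwards [h7] with p' hp'
    rw [twistMap_of_notMem hp', headPt_consPt])
  have e2 := hhead id differentiable_id headPt
    (Eventually.of_forall fun p' => (exp_smul_normHead P p').symm)
  have etail : (fun p' => tailPt (D.twistMap P U G ψ T s p')) =ᶠ[𝓝 p]
      fun p' => G (T s (D.normHead P p')) (tailPt p') := by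
    filter_upwards [h7] with p' hp'
    rw [twistMap_of_notMem hp', tailPt_consPt]
  have hGd : MDifferentiableAt (𝓘(ℝ, ℝ).prod (I.prod 𝓘(ℝ, Cn k))) (I.prod 𝓘(ℝ, Cn k))
      (fun q : ℝ × (M × Cn k) => G q.1 q.2) (T s (D.normHead P p), tailPt p) :=
    (hG.smooth.contMDiffAt (x := (T s (D.normHead P p), tailPt p))
      ((isOpen_univ.prod (hN.isOpen_symplectization h)).mem_nhds
        ⟨trivial, hpc⟩)).mdifferentiableAt (by simp)
  have hTh : MDifferentiableAt (I.prod 𝓘(ℝ, Cn (k + 1))) 𝓘(ℝ, ℝ) (fun p' => T s (D.normHead P p')) p :=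
    MDifferentiableAt.comp (g := fun q : ℝ × ℂ => T s q.2) p
      ((hTd.comp differentiable_snd).mdifferentiable _) hhd
  have ha : mfderiv (I.prod 𝓘(ℝ, Cn (k + 1))) 𝓘(ℝ, ℝ) (fun p' => T s (D.normHead P p')) p v =
      fderiv ℝ (T s) (D.normHead P p) w.2 := by
    have h1 := mfderiv_comp_vector (F := fun q : ℝ × ℂ => T s q.2) (h := hh) (x := p)
      ((hTd.comp differentiable_snd) _) hhd v
    have h2 : HasFDerivAt (fun q : ℝ × ℂ => T s q.2)
        ((fderiv ℝ (T s) (hh p).2).comp (ContinuousLinearMap.snd ℝ ℝ ℂ)) (hh p) :=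
      (hTd _).hasFDerivAt.comp (hh p) hasFDerivAt_snd
    rw [h2.fderiv] at h1
    exact h1
  -- The Reeb velocity has α equal to e^τ, so the tail acquires e^τ dT. The head changes from e^τ λ
  -- to e^τ ψ^*λ, and dT = λ - ψ^*λ makes the sum unchanged.
  have etail' : (D.stabilization k).α (tailPt (D.twistMap P U G ψ T s p))
      (mfderiv (I.prod 𝓘(ℝ, Cn (k + 1))) (I.prod 𝓘(ℝ, Cn k))
        (fun p' => tailPt (D.twistMap P U G ψ T s p')) p v) =
      fderiv ℝ (T s) (D.normHead P p) w.2 * Real.exp (hh p).1 +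
        (D.stabilization k).α (tailPt p)
          (mfderiv (I.prod 𝓘(ℝ, Cn (k + 1))) (I.prod 𝓘(ℝ, Cn k)) tailPt p v) := by
    have key : ∀ f : M × Cn (k + 1) → M × Cn k, f =ᶠ[𝓝 p]
        (fun p' => G (T s (D.normHead P p')) (tailPt p')) →
        (D.stabilization k).α (f p)
          (mfderiv (I.prod 𝓘(ℝ, Cn (k + 1))) (I.prod 𝓘(ℝ, Cn k)) f p v) =
        (D.stabilization k).α (G (T s (D.normHead P p)) (tailPt p))
          (mfderiv (I.prod 𝓘(ℝ, Cn (k + 1))) (I.prod 𝓘(ℝ, Cn k))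
            (fun p' => G (T s (D.normHead P p')) (tailPt p')) p v) := by
      intro f hf
      rw [hf.mfderiv_eq]
      have key2 : ∀ q q', q = q' → ∀ u : E × Cn k, (D.stabilization k).α q u =
        (D.stabilization k).α q' u := by rintro _ _ rfl _; rfl
      exact key2 _ _ hf.self_of_nhds _
    refine (key _ etail).trans ?_
    rw [mfderiv_family_comp hGd hTh (contMDiff_tailPt.mdifferentiableAt (by simp)) ha]
    refine (map_add _ _ _).trans (congrArg₂ (· + ·) ((map_smul _ _ _).trans ?_)
      (hG.pullback _ _ hpc _))
    rw [hG.α_velocity _ _ hpc]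
    rfl
  have e3 := stabilization_succ_α (D := D) (f := fun p' : M × Cn (k + 1) => p') (q := p)
    mdifferentiableAt_id v
  have e4 : (D.stabilization (k + 1)).α p v = _ :=
    (hid (fun p' => p') EventuallyEq.rfl).symm.trans e3
  refine Eq.trans ?_ e4.symm
  refine (congrArg₂ (fun a b : ℝ => a + 1 / 2 * b) etail' e1).trans ?_
  refine Eq.trans ?_ (congrArg (fun b : ℝ => (D.stabilization k).α (tailPt p)
    (mfderiv (I.prod 𝓘(ℝ, Cn (k + 1))) (I.prod 𝓘(ℝ, Cn k)) tailPt p v) + 1 / 2 * b) e2.symm)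
  have e5 : fderiv ℝ (id : ℂ → ℂ) (hh p).2 w.2 = w.2 := by rw [fderiv_id]; rfl
  have e6 := ht.fderiv_primitive s (D.normHead P p) w.2
  rw [e5]
  change _ = _ + 1 / 2 * (Real.exp (hh p).1 * planeForm (D.normHead P p) w.2)
  rw [e6]
  change (_ - 1 / 2 * planeForm (ψ s (hh p).2) (fderiv ℝ (ψ s) (hh p).2 w.2)) * _ + _ + _ = _
  ring

/-- Preserving α on an open set implies preserving ω = dα. The inverse is the twist map built from χ
with Reeb time -T ∘ χ, for which smoothness and the support condition suffice. -/
theorem isEquivariantFamily_twistMap {S : Set (M × Cn (k + 1))}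
    (hN' : (D.stabilization (k + 1)).IsLiouville) (hS : IsOpen S)
    (hSm : ∀ p, p ∈ S ↔ tailPt p ∉ (D.stabilization k).core U ∨ headPt p ≠ 0)
    (ht : IsTwist ψ χ T R) :
    (D.stabilization (k + 1)).IsEquivariantFamily S univ (D.twistMap P U G ψ T)
      (D.twistMap P U G χ fun s ζ => -T s (χ s ζ)) := by
  have hχ : ∀ s ζ, R ≤ ‖ζ‖ → χ s ζ = ζ := fun s ζ hζ => by
    conv_lhs => rw [← ht.eq_self s ζ hζ]
    exact ht.left_inv s ζ
  have hmaps : ∀ (ψ : ℝ → ℂ → ℂ) (T : ℝ → ℂ → ℝ) (s : ℝ),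
      MapsTo (D.twistMap P U G ψ T s) S S := by
    intro ψ T s p hp
    by_cases hpc : tailPt p ∈ (D.stabilization k).core U
    · rwa [twistMap_of_mem hpc]
    · exact (hSm _).2 (Or.inl (tailPt_twistMap_notMem hG hpc))
  exact
  { smooth := fun q hq => (contMDiffAt_twistMap hN h hG ((hSm _).1 hq.2) ht.smooth
      ht.smooth_primitive ht.eq_self ht.primitive_eq_zero).contMDiffWithinAt
    smooth_inv := fun q hq => (contMDiffAt_twistMap hN h hG ((hSm _).1 hq.2) ht.smooth_inv
      (ht.smooth_primitive.comp (contDiff_fst.prodMk ht.smooth_inv)).neg hχ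
      fun s ζ hζ => by rw [hχ s ζ hζ, ht.primitive_eq_zero s ζ hζ, neg_zero]).contMDiffWithinAt
    mapsTo := fun s _ => hmaps ψ T s
    mapsTo_inv := fun s _ => hmaps _ _ s
    left_inv := fun s _ p _ => twistMap_twistMap hG (ht.left_inv s)
      (fun ζ => by rw [ht.left_inv]) p
    right_inv := fun s _ p _ => twistMap_twistMap hG (ht.right_inv s) (fun ζ => by rw [neg_neg]) p
    equivariant := fun s _ p _ r => twistMap_flow hN h hG s r p
    symplectic := fun s _ p hp v w => by
      refine hN'.exact.eq_of_pullback_eq hN'.smooth_α hN'.exact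
        (contMDiffAt_twistMap_slice hN h hG ((hSm p).1 hp) ht) ?_ v w
      filter_upwards [hS.mem_nhds hp] with q hq u
      exact α_twistMap hN h hG ((hSm q).1 hq) ht u }

end

end LiouvilleData

end TwistMap

/-! ### Composition and inversion of equivariant symplectic families. -/

section EquivariantFamilies

open Filter Topology

namespace LiouvilleData

variable {E : Type*} [NormedAddCommGroup E] [NormedSpace ℝ E] [FiniteDimensional ℝ E]
  {H : Type*} [TopologicalSpace H] {I : ModelWithCorners ℝ E H} [I.Boundaryless]
  {M : Type*} [TopologicalSpace M] [T2Space M] [ChartedSpace H M] [IsManifold I ∞ M]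
  {D : LiouvilleData I M} {S : Set M}
  {T : Type*} [NormedAddCommGroup T] [NormedSpace ℝ T] {K : Set T}
  {T' : Type*} [NormedAddCommGroup T'] [NormedSpace ℝ T'] {K' : Set T'}
  {Φ Ψ Φ' Ψ' : T → M → M}

namespace IsEquivariantFamily

theorem contMDiffAt_slice (hΦ : D.IsEquivariantFamily S K Φ Ψ) (hS : IsOpen S) {t : T}
    (ht : t ∈ K) {x : M} (hx : x ∈ S) : ContMDiffAt I I ∞ (Φ t) x := by
  have h1 : ContMDiff I (𝓘(ℝ, T).prod I) ∞ (fun q : M => (t, q)) :=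
    contMDiff_const.prodMk contMDiff_id
  exact ((hΦ.smooth.comp (h1.contMDiffOn (s := S)) fun q hq => ⟨ht, hq⟩) x hx).contMDiffAt
    (hS.mem_nhds hx)

theorem mdifferentiableAt (hΦ : D.IsEquivariantFamily S K Φ Ψ) (hS : IsOpen S) {t : T}
    (ht : t ∈ K) {x : M} (hx : x ∈ S) : MDifferentiableAt I I (Φ t) x :=
  (hΦ.contMDiffAt_slice hS ht hx).mdifferentiableAt (by simp)

theorem comp (hΦ : D.IsEquivariantFamily S K Φ Ψ) (hΦ' : D.IsEquivariantFamily S K Φ' Ψ')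
    (hS : IsOpen S) :
    D.IsEquivariantFamily S K (fun t x => Φ t (Φ' t x)) (fun t x => Ψ' t (Ψ t x)) where
  smooth := hΦ.smooth.comp (contMDiffOn_fst.prodMk hΦ'.smooth)
    fun q hq => ⟨hq.1, hΦ'.mapsTo q.1 hq.1 hq.2⟩
  smooth_inv := hΦ'.smooth_inv.comp (contMDiffOn_fst.prodMk hΦ.smooth_inv)
    fun q hq => ⟨hq.1, hΦ.mapsTo_inv q.1 hq.1 hq.2⟩
  mapsTo t ht := (hΦ.mapsTo t ht).comp (hΦ'.mapsTo t ht)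
  mapsTo_inv t ht := (hΦ'.mapsTo_inv t ht).comp (hΦ.mapsTo_inv t ht)
  left_inv t ht x hx := by
    rw [hΦ.left_inv t ht _ (hΦ'.mapsTo t ht hx), hΦ'.left_inv t ht x hx]
  right_inv t ht x hx := by
    rw [hΦ'.right_inv t ht _ (hΦ.mapsTo_inv t ht hx), hΦ.right_inv t ht x hx]
  equivariant t ht x hx r := by
    rw [hΦ'.equivariant t ht x hx, hΦ.equivariant t ht _ (hΦ'.mapsTo t ht hx)]
  symplectic t ht x hx v w := by
    have e : mfderiv I I (fun x => Φ t (Φ' t x)) x =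
        (mfderiv I I (Φ t) (Φ' t x)).comp (mfderiv I I (Φ' t) x) :=
      mfderiv_comp x (hΦ.mdifferentiableAt hS ht (hΦ'.mapsTo t ht hx))
        (hΦ'.mdifferentiableAt hS ht hx)
    rw [e]
    exact (hΦ.symplectic t ht _ (hΦ'.mapsTo t ht hx) _ _).trans (hΦ'.symplectic t ht x hx v w)

theorem symm (hΦ : D.IsEquivariantFamily S K Φ Ψ) (hS : IsOpen S)
    (hflow : ∀ r, MapsTo (D.flow r) S S) : D.IsEquivariantFamily S K Ψ Φ where
  smooth := hΦ.smooth_inv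
  smooth_inv := hΦ.smooth
  mapsTo := hΦ.mapsTo_inv
  mapsTo_inv := hΦ.mapsTo
  left_inv := hΦ.right_inv
  right_inv := hΦ.left_inv
  equivariant t ht x hx r := by
    have h1 := hΦ.mapsTo_inv t ht hx
    conv_lhs => rw [← hΦ.right_inv t ht x hx, ← hΦ.equivariant t ht _ h1]
    exact hΦ.left_inv t ht _ (hflow r h1)
  symplectic t ht x hx v w := by
    have hΨd : MDifferentiableAt I I (Ψ t) x := by
      have h1 : ContMDiff I (𝓘(ℝ, T).prod I) ∞ (fun q : M => (t, q)) :=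
        contMDiff_const.prodMk contMDiff_id
      exact (((hΦ.smooth_inv.comp (h1.contMDiffOn (s := S)) fun q hq => ⟨ht, hq⟩) x
        hx).contMDiffAt (hS.mem_nhds hx)).mdifferentiableAt (by simp)
    have e := mfderiv_comp x (hΦ.mdifferentiableAt hS ht (hΦ.mapsTo_inv t ht hx)) hΨd
    have e' : Φ t ∘ Ψ t =ᶠ[𝓝 x] id := by
      filter_upwards [hS.mem_nhds hx] with y hy using hΦ.right_inv t ht y hy
    have key : ∀ f : M → M, f =ᶠ[𝓝 x] id →
        D.symp (f x) (mfderiv I I f x v) (mfderiv I I f x w) = D.symp x v w := by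
      intro f hf
      rw [hf.mfderiv_eq, mfderiv_id]
      have key2 : ∀ y, y = x → D.symp y (v : E) (w : E) = D.symp x v w := by rintro _ rfl; rfl
      exact key2 _ hf.self_of_nhds
    rw [← hΦ.symplectic t ht (Ψ t x) (hΦ.mapsTo_inv t ht hx)]
    have h2 := key _ e'
    rw [e] at h2
    exact h2

theorem reparam (hΦ : D.IsEquivariantFamily S K Φ Ψ) {g : T' → T} (hg : ContDiffOn ℝ ∞ g K')
    (hgK : MapsTo g K' K) :
    D.IsEquivariantFamily S K' (fun t => Φ (g t)) (fun t => Ψ (g t)) := by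
  have h1 : ContMDiffOn (𝓘(ℝ, T').prod I) (𝓘(ℝ, T).prod I) ∞
      (fun q : T' × M => (g q.1, q.2)) (K' ×ˢ S) :=
    (hg.contMDiffOn.comp contMDiffOn_fst fun q hq => hq.1).prodMk contMDiffOn_snd
  exact
  { smooth := hΦ.smooth.comp h1 fun q hq => ⟨hgK hq.1, hq.2⟩
    smooth_inv := hΦ.smooth_inv.comp h1 fun q hq => ⟨hgK hq.1, hq.2⟩
    mapsTo := fun t ht => hΦ.mapsTo _ (hgK ht)
    mapsTo_inv := fun t ht => hΦ.mapsTo_inv _ (hgK ht)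
    left_inv := fun t ht => hΦ.left_inv _ (hgK ht)
    right_inv := fun t ht => hΦ.right_inv _ (hgK ht)
    equivariant := fun t ht => hΦ.equivariant _ (hgK ht)
    symplectic := fun t ht => hΦ.symplectic _ (hgK ht) }

theorem mono {K₀ : Set T} (hΦ : D.IsEquivariantFamily S K Φ Ψ) (hK : K₀ ⊆ K) :
    D.IsEquivariantFamily S K₀ Φ Ψ :=
  hΦ.reparam (g := id) contDiffOn_id hK

/-- Equivariant symplectomorphisms preserve the Liouville form. -/
theorem α_pullback (hD : D.IsLiouville) (hΦ : D.IsEquivariantFamily S K Φ Ψ) (hS : IsOpen S)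
    {t : T} (ht : t ∈ K) {x : M} (hx : x ∈ S) (v : TangentSpace I x) :
    D.α (Φ t x) (mfderiv I I (Φ t) x v) = D.α x v := by
  -- Differentiating equivariance at time zero shows that the map carries L to L; since it preserves
  -- ω it preserves α = i_L ω.
  have hL : mfderiv I I (Φ t) x (D.L x) = D.L (Φ t x) := by
    have hd : MDifferentiableAt I I (Φ t) (D.flow 0 x) := by
      rw [hD.flow_zero]
      exact hΦ.mdifferentiableAt hS ht hx
    have h1 := (HasMFDerivAt.comp (0 : ℝ) hd.hasMFDerivAt (hD.flow_integral x 0)).mfderiv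
    have h2 : (Φ t ∘ fun r => D.flow r x) = fun r => D.flow r (Φ t x) :=
      funext fun r => hΦ.equivariant t ht x hx r
    have h3 := hD.mfderiv_flow_orbit 0 (Φ t x)
    have key : ∀ y z : M, y = x → z = Φ t x → ∀ f : ℝ → M, f = (fun r => D.flow r (Φ t x)) →
        ∀ A : ℝ →L[ℝ] E, (mfderiv 𝓘(ℝ, ℝ) I f 0 : ℝ →L[ℝ] E) = A →
        (mfderiv 𝓘(ℝ, ℝ) I (fun r => D.flow r (Φ t x)) 0 (1 : ℝ) : E) = D.L z →
        A 1 = (mfderiv I I (Φ t) y (D.L y) : E) →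
        (mfderiv I I (Φ t) x (D.L x) : E) = D.L (Φ t x) := by
      rintro _ _ rfl rfl _ rfl _ rfl h5 h6
      exact h6.symm.trans h5
    refine key _ _ (hD.flow_zero x) (hD.flow_zero _) _ h2 _ h1 h3 ?_
    refine congrArg (mfderiv I I (Φ t) (D.flow 0 x)) ?_
    exact one_smul ℝ (D.L (D.flow 0 x) : E)
  change D.symp (Φ t x) (D.L (Φ t x)) _ = D.symp x (D.L x) v
  rw [← hL]
  exact hΦ.symplectic t ht x hx _ _

end IsEquivariantFamily

end LiouvilleData

end EquivariantFamilies

/-! ## Linear symplectic families -/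

section LinearFamilies

/-- `V` is a smooth family of linear symplectomorphisms of `ℂⁿ` with inverses `V'`. -/
structure IsLinearFamily {n : ℕ} {T : Type*} [NormedAddCommGroup T] [NormedSpace ℝ T]
    (V V' : T → Cn n →L[ℝ] Cn n) : Prop where
  smooth : ContDiff ℝ ∞ V
  smooth_inv : ContDiff ℝ ∞ V'
  left_inv : ∀ t, V' t * V t = 1
  right_inv : ∀ t, V t * V' t = 1
  symp : ∀ t v w, stdSymplectic n (V t v) (V t w) = stdSymplectic n v w

namespace IsLinearFamily

variable {n : ℕ} {T : Type*} [NormedAddCommGroup T] [NormedSpace ℝ T]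
  {T' : Type*} [NormedAddCommGroup T'] [NormedSpace ℝ T'] {V V' W W' : T → Cn n →L[ℝ] Cn n}

theorem mul (hV : IsLinearFamily V V') (hW : IsLinearFamily W W') :
    IsLinearFamily (fun t => V t * W t) (fun t => W' t * V' t) where
  smooth := hV.smooth.mul hW.smooth
  smooth_inv := hW.smooth_inv.mul hV.smooth_inv
  left_inv t := by rw [mul_assoc, ← mul_assoc (V' t), hV.left_inv, one_mul, hW.left_inv]
  right_inv t := by rw [mul_assoc, ← mul_assoc (W t), hW.right_inv, one_mul, hV.right_inv]
  symp t v w := (hV.symp t _ _).trans (hW.symp t v w)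

theorem reparam (hV : IsLinearFamily V V') {g : T' → T} (hg : ContDiff ℝ ∞ g) :
    IsLinearFamily (fun t => V (g t)) (fun t => V' (g t)) where
  smooth := hV.smooth.comp hg
  smooth_inv := hV.smooth_inv.comp hg
  left_inv _ := hV.left_inv _
  right_inv _ := hV.right_inv _
  symp _ := hV.symp _

theorem one : IsLinearFamily (fun _ : T => (1 : Cn n →L[ℝ] Cn n)) (fun _ => 1) where
  smooth := contDiff_const
  smooth_inv := contDiff_const
  left_inv _ := one_mul 1
  right_inv _ := one_mul 1
  symp _ _ _ := rfl

theorem apply_eq_zero_iff (hV : IsLinearFamily V V') (t : T) (z : Cn n) : V t z = 0 ↔ z = 0 := by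
  refine ⟨fun h => ?_, fun h => by rw [h, map_zero]⟩
  have : V' t (V t z) = z := congrArg (fun A : Cn n →L[ℝ] Cn n => A z) (hV.left_inv t)
  rw [← this, h, map_zero]

variable {E : Type*} [NormedAddCommGroup E] [NormedSpace ℝ E] [FiniteDimensional ℝ E]
  {H : Type*} [TopologicalSpace H] {I : ModelWithCorners ℝ E H} [I.Boundaryless]
  {M : Type*} [TopologicalSpace M] [T2Space M] [ChartedSpace H M] [IsManifold I ∞ M]
  {D : LiouvilleData I M}

theorem contMDiff (hV : ContDiff ℝ ∞ V) :
    ContMDiff (𝓘(ℝ, T).prod (I.prod 𝓘(ℝ, Cn n))) (I.prod 𝓘(ℝ, Cn n)) ∞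
      (fun q : T × (M × Cn n) => (q.2.1, V q.1 q.2.2)) := by
  have h1 : ContDiff ℝ ∞ fun r : T × Cn n => V r.1 r.2 :=
    (hV.comp contDiff_fst).clm_apply contDiff_snd
  exact (contMDiff_fst.comp contMDiff_snd).prodMk (h1.contMDiff.comp
    (contMDiff_fst.prodMk_space (contMDiff_snd.comp contMDiff_snd)))

/-- Real linear maps commute with the dilations of ℂⁿ. The condition on `S` says that membership
depends only on the component in `M` and on whether z vanishes, as it does for the complement of the
core. -/
theorem isEquivariantFamily (hV : IsLinearFamily V V') {S : Set (M × Cn n)}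
    (hS : ∀ p q : M × Cn n, p.1 = q.1 → (p.2 = 0 ↔ q.2 = 0) → p ∈ S → q ∈ S) :
    (D.stabilization n).IsEquivariantFamily S univ (fun t p => (p.1, V t p.2))
      (fun t p => (p.1, V' t p.2)) where
  smooth := (contMDiff hV.smooth).contMDiffOn
  smooth_inv := (contMDiff hV.smooth_inv).contMDiffOn
  mapsTo t _ p hp := hS p _ rfl (hV.apply_eq_zero_iff t p.2).symm hp
  mapsTo_inv t _ p hp := by
    refine hS p _ rfl ?_ hp
    have : V t (V' t p.2) = p.2 := congrArg (fun A : Cn n →L[ℝ] Cn n => A p.2) (hV.right_inv t)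
    have h2 := hV.apply_eq_zero_iff t (V' t p.2)
    rw [this] at h2
    exact h2
  left_inv t _ p _ :=
    Prod.ext rfl (congrArg (fun A : Cn n →L[ℝ] Cn n => A p.2) (hV.left_inv t))
  right_inv t _ p _ :=
    Prod.ext rfl (congrArg (fun A : Cn n →L[ℝ] Cn n => A p.2) (hV.right_inv t))
  equivariant t _ p _ r := Prod.ext rfl ((V t).map_smul _ _)
  symplectic t _ p _ v w := by
    have h1 : ∀ u : E × Cn n, (mfderiv (I.prod 𝓘(ℝ, Cn n)) (I.prod 𝓘(ℝ, Cn n))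
        (fun p : M × Cn n => (p.1, V t p.2)) p u : E × Cn n) = (u.1, V t u.2) := by
      intro u
      have h2 : HasMFDerivAt (I.prod 𝓘(ℝ, Cn n)) 𝓘(ℝ, Cn n) (fun p : M × Cn n => V t p.2) p
          ((V t).comp (ContinuousLinearMap.snd ℝ E (Cn n))) :=
        HasMFDerivAt.comp p ((V t).hasFDerivAt.hasMFDerivAt) (hasMFDerivAt_snd p)
      exact congrArg (fun A : E × Cn n →L[ℝ] E × Cn n => A u)
        ((hasMFDerivAt_fst p).prodMk h2).mfderiv
    rw [h1 v, h1 w]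
    exact congrArg (D.symp p.1 (v : E × Cn n).1 (w : E × Cn n).1 + ·) (hV.symp t _ _)

end IsLinearFamily

/-- The loop `u` of linear symplectomorphisms of `ℂⁿ` is contractible through loops based at the
identity. -/
def IsContractibleLinearLoop {n : ℕ} (u : ℝ → Cn n →L[ℝ] Cn n) : Prop :=
  ∃ V V' : ℝ × ℝ → Cn n →L[ℝ] Cn n, IsLinearFamily V V' ∧ (∀ t, V (0, t) = 1) ∧
    (∀ t, V (1, t) = u t) ∧ (∀ s, V (s, 0) = 1) ∧ ∀ s t, V (s, t + 1) = V (s, t)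

theorem IsContractibleLinearLoop.mul {n : ℕ} {u u' : ℝ → Cn n →L[ℝ] Cn n}
    (hu : IsContractibleLinearLoop u) (hu' : IsContractibleLinearLoop u') :
    IsContractibleLinearLoop fun t => u t * u' t := by
  obtain ⟨V, V', hV, h0, h1, h2, h3⟩ := hu
  obtain ⟨W, W', hW, k0, k1, k2, k3⟩ := hu'
  refine ⟨_, _, hV.mul hW, fun t => ?_, fun t => ?_, fun s => ?_, fun s t => ?_⟩
  · rw [h0, k0, one_mul]
  · rw [h1, k1]
  · rw [h2, k2, one_mul]
  · rw [h3, k3]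

theorem isContractibleLinearLoop_one {n : ℕ} :
    IsContractibleLinearLoop fun _ => (1 : Cn n →L[ℝ] Cn n) :=
  ⟨_, _, IsLinearFamily.one, fun _ => rfl, fun _ => rfl, fun _ => rfl, fun _ _ => rfl⟩

variable {k : ℕ}

/-- Multiplication by `e^{iθ}` of the first coordinate. -/
def phaseL (θ : ℝ) : Cn (k + 1) →L[ℝ] Cn (k + 1) :=
  LinearMap.toContinuousLinearMap
    { toFun := fun z => WithLp.toLp 2 fun i =>
        if i = 0 then Complex.exp (θ * Complex.I) * z 0 else z i
      map_add' := fun v w => by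
        ext i
        by_cases hi : i = 0 <;> simp [hi, mul_add]
      map_smul' := fun c v => by
        ext i
        by_cases hi : i = 0
        · simp [hi]; ring
        · simp [hi] }

theorem phaseL_apply (θ : ℝ) (z : Cn (k + 1)) (i : Fin (k + 1)) :
    phaseL θ z i = if i = 0 then Complex.exp (θ * Complex.I) * z 0 else z i := rfl

/-- Rotation of the plane of the coordinates `0` and `j`. -/
def planeRot (j : Fin (k + 1)) (θ : ℝ) : Cn (k + 1) →L[ℝ] Cn (k + 1) :=
  LinearMap.toContinuousLinearMap
    { toFun := fun z => WithLp.toLp 2 fun i =>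
        if i = 0 then (Real.cos θ : ℂ) * z 0 - (Real.sin θ : ℂ) * z j
        else if i = j then (Real.sin θ : ℂ) * z 0 + (Real.cos θ : ℂ) * z j else z i
      map_add' := fun v w => by
        ext i
        by_cases hi : i = 0
        · simp [hi]; ring
        by_cases hj : i = j
        · simp [hj]; split_ifs <;> ring
        · simp [hi, hj]
      map_smul' := fun c v => by
        ext i
        by_cases hi : i = 0
        · simp [hi]; ring
        by_cases hj : i = j
        · simp [hj]; split_ifs <;> ring
        · simp [hi, hj] }

theorem planeRot_apply (j : Fin (k + 1)) (θ : ℝ) (z : Cn (k + 1)) (i : Fin (k + 1)) :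
    planeRot j θ z i =
      if i = 0 then (Real.cos θ : ℂ) * z 0 - (Real.sin θ : ℂ) * z j
      else if i = j then (Real.sin θ : ℂ) * z 0 + (Real.cos θ : ℂ) * z j else z i := rfl

theorem isLinearFamily_phaseL :
    IsLinearFamily (phaseL (k := k)) (fun θ => phaseL (-θ)) := by
  have hs : ContDiff ℝ ∞ (phaseL (k := k)) := by
    refine contDiff_clm_apply_iff.2 fun z => ?_
    refine (contDiff_piLp 2).2 fun i => ?_
    simp only [phaseL_apply]
    split_ifs
    · exact ((Complex.ofRealCLM.contDiff.mul contDiff_const).cexp).mul contDiff_const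
    · exact contDiff_const
  have hinv : ∀ θ, phaseL (k := k) (-θ) * phaseL θ = 1 := fun θ => by
    ext z i
    change phaseL (-θ) (phaseL θ z) i = z i
    by_cases hi : i = 0
    · subst hi
      simp only [phaseL_apply, if_true]
      rw [← mul_assoc, ← Complex.exp_add]
      simp
    · simp only [phaseL_apply, if_neg hi]
  refine ⟨hs, hs.comp contDiff_neg, hinv, fun θ => ?_, fun θ v w => ?_⟩
  · have := hinv (-θ)
    rwa [neg_neg] at this
  · rw [stdSymplectic_apply, stdSymplectic_apply]
    refine Finset.sum_congr rfl fun i _ => ?_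
    by_cases hi : i = 0
    · subst hi
      simp only [phaseL_apply, if_true]
      exact planeForm_rotate θ (v 0) (w 0)
    · simp only [phaseL_apply, if_neg hi]

theorem isLinearFamily_planeRot {j : Fin (k + 1)} (hj : j ≠ 0) :
    IsLinearFamily (planeRot j) (fun θ => planeRot j (-θ)) := by
  have hs : ContDiff ℝ ∞ (planeRot j) := by
    refine contDiff_clm_apply_iff.2 fun z => ?_
    refine (contDiff_piLp 2).2 fun i => ?_
    have hc : ContDiff ℝ ∞ fun θ : ℝ => (Real.cos θ : ℂ) :=
      Complex.ofRealCLM.contDiff.comp Real.contDiff_cos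
    have hsn : ContDiff ℝ ∞ fun θ : ℝ => (Real.sin θ : ℂ) :=
      Complex.ofRealCLM.contDiff.comp Real.contDiff_sin
    simp only [planeRot_apply]
    split_ifs
    · exact (hc.mul contDiff_const).sub (hsn.mul contDiff_const)
    · exact (hsn.mul contDiff_const).add (hc.mul contDiff_const)
    · exact contDiff_const
  have hcs : ∀ θ : ℝ, (Real.cos θ : ℂ) ^ 2 + (Real.sin θ : ℂ) ^ 2 = 1 := fun θ => by
    exact_mod_cast Real.cos_sq_add_sin_sq θ
  have hinv : ∀ θ, planeRot j (-θ) * planeRot j θ = 1 := fun θ => by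
    ext z i
    change planeRot j (-θ) (planeRot j θ z) i = z i
    simp only [planeRot_apply, if_true, if_neg hj, Real.cos_neg, Real.sin_neg, Complex.ofReal_neg]
    split_ifs with h1 h2
    · subst h1
      linear_combination (z 0) * hcs θ
    · subst h2
      linear_combination (z i) * hcs θ
    · rfl
  refine ⟨hs, hs.comp contDiff_neg, hinv, fun θ => ?_, fun θ v w => ?_⟩
  · have := hinv (-θ)
    rwa [neg_neg] at this
  · rw [← sub_eq_zero, stdSymplectic_apply, stdSymplectic_apply, ← Finset.sum_sub_distrib]
    rw [Finset.sum_eq_add (0 : Fin (k + 1)) j hj.symm _ (by simp) (by simp)]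
    · simp only [planeRot_apply, if_true, if_neg hj]
      simp only [Complex.sub_re, Complex.sub_im, Complex.add_re, Complex.add_im, Complex.mul_re,
        Complex.mul_im, Complex.ofReal_re, Complex.ofReal_im]
      linear_combination ((v 0).re * (w 0).im - (v 0).im * (w 0).re + (v j).re * (w j).im -
        (v j).im * (w j).re) * Real.cos_sq_add_sin_sq θ
    · rintro i - ⟨h1, h2⟩
      simp only [planeRot_apply, if_neg h1, if_neg h2, sub_self]

/-- The loop of diagonal matrices with entries `e^{i|J|θ}` at the first place and `e^{-iθ}` at the
places in `J`. -/
theorem exists_isContractibleLinearLoop (c : ℕ) (J : Finset (Fin (k + 1))) (hJ : 0 ∉ J) :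
    ∃ u : ℝ → Cn (k + 1) →L[ℝ] Cn (k + 1), IsContractibleLinearLoop u ∧ ∀ t z i,
      u t z i = if i = 0 then Complex.exp ((J.card * (2 * Real.pi * c * t) : ℝ) * Complex.I) * z 0
        else if i ∈ J then Complex.exp ((-(2 * Real.pi * c * t) : ℝ) * Complex.I) * z i
        else z i := by
  induction J using Finset.induction_on with
  | empty =>
    refine ⟨_, isContractibleLinearLoop_one, fun t z i => ?_⟩
    by_cases hi : i = 0 <;> simp [hi]
  | insert j J hjJ ih =>
    obtain ⟨u, hu, hu'⟩ := ih fun h => hJ (Finset.mem_insert_of_mem h)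
    have hj : j ≠ 0 := fun h => hJ (h ▸ Finset.mem_insert_self _ _)
    let θ : ℝ → ℝ := fun t => 2 * Real.pi * c * t
    -- This is a commutator of a phase with a rotation of the (0, j) plane. At s = 0 it is trivial.
    -- At s = 1 the rotation is a quarter turn and moves the factor e^{-iθ} from place 0 to place j,
    -- giving diag(e^{iθ}, e^{-iθ}). For each s it is 1-periodic in t, because θ advances by a
    -- multiple of 2π.
    let V : ℝ × ℝ → Cn (k + 1) →L[ℝ] Cn (k + 1) := fun q =>
      phaseL (θ q.2) * planeRot j (Real.pi / 2 * q.1) *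
        (phaseL (-θ q.2) * planeRot j (-(Real.pi / 2 * q.1)))
    have hθ : ContDiff ℝ ∞ fun q : ℝ × ℝ => θ q.2 := by fun_prop
    have hs : ContDiff ℝ ∞ fun q : ℝ × ℝ => Real.pi / 2 * q.1 := by fun_prop
    have hp := isLinearFamily_phaseL (k := k)
    have hr := isLinearFamily_planeRot hj
    have hV := ((hp.reparam hθ).mul (hr.reparam hs)).mul ((hp.reparam hθ.neg).mul
      (hr.reparam hs.neg))
    have hr0 : planeRot j 0 = 1 := by
      ext z i
      rw [planeRot_apply]
      split_ifs with h1 h2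
      · simp [h1]
      · simp [h2]
      · rfl
    have hp0 : phaseL (k := k) 0 = 1 := by
      ext z i
      rw [phaseL_apply]
      split_ifs with h1
      · simp [h1]
      · rfl
    have hpp : ∀ (θ : ℝ) (m : ℤ), phaseL (k := k) (θ + m * (2 * Real.pi)) = phaseL θ := by
      intro θ m
      ext z i
      rw [phaseL_apply, phaseL_apply]
      have : Complex.exp ((θ + m * (2 * Real.pi) : ℝ) * Complex.I) =
          Complex.exp (θ * Complex.I) := by
        rw [Complex.exp_eq_exp_iff_exists_int]
        exact ⟨m, by push_cast; ring⟩
      rw [this]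
    have hloop : IsContractibleLinearLoop fun t => V (1, t) := by
      refine ⟨V, _, hV, fun t => ?_, fun t => rfl, fun s => ?_, fun s t => ?_⟩
      · simp only [V, mul_zero, neg_zero, hr0, mul_one]
        exact hp.right_inv _
      · simp only [V, θ, mul_zero, neg_zero, hp0, one_mul]
        exact hr.right_inv _
      · have e1 : θ (t + 1) = θ t + (c : ℤ) * (2 * Real.pi) := by
          simp only [θ]; push_cast; ring
        have e2 : -θ (t + 1) = -θ t + (-c : ℤ) * (2 * Real.pi) := by
          simp only [θ]; push_cast; ring
        simp only [V]
        rw [e2, e1, hpp, hpp]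
    refine ⟨_, hloop.mul hu, fun t z i => ?_⟩
    change phaseL (θ t) (planeRot j (Real.pi / 2 * 1) (phaseL (-θ t)
      (planeRot j (-(Real.pi / 2 * 1)) (u t z)))) i = _
    simp only [phaseL_apply, planeRot_apply, mul_one, Real.cos_neg, Real.sin_neg, Real.cos_pi_div_two,
      Real.sin_pi_div_two, if_true, if_neg hj, hu', Finset.mem_insert]
    rw [Finset.card_insert_of_notMem hjJ]
    by_cases hi : i = 0
    · subst hi
      simp only [if_true]
      have : Complex.exp (((J.card + 1 : ℕ) * (2 * Real.pi * c * t) : ℝ) * Complex.I) =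
          Complex.exp (θ t * Complex.I) *
            Complex.exp ((J.card * (2 * Real.pi * c * t) : ℝ) * Complex.I) := by
        rw [← Complex.exp_add]
        congr 1
        simp only [θ]
        push_cast
        ring
      rw [this]
      simp
      ring
    · by_cases hij : i = j
      · subst hij
        simp only [if_neg hi, if_true, true_or, if_neg hjJ]
        simp [θ]
      · simp [hi, hij]

end LinearFamilies

/-! ### Hamiltonians of compositions and of unitary rotations. -/

section PositiveLoop

open Filter Topology

namespace LiouvilleData

section Velocity

variable {E : Type*} [NormedAddCommGroup E] [NormedSpace ℝ E] [FiniteDimensional ℝ E]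
  {H : Type*} [TopologicalSpace H] {I : ModelWithCorners ℝ E H} [I.Boundaryless]
  {M : Type*} [TopologicalSpace M] [T2Space M] [ChartedSpace H M] [IsManifold I ∞ M]
  {D : LiouvilleData I M} {S : Set M} {Φ Ψ : ℝ → M → M} {γ : ℝ → M} {t : ℝ}

theorem IsEquivariantFamily.mdifferentiableAt_uncurry (hΦ : D.IsEquivariantFamily S univ Φ Ψ)
    (hS : IsOpen S) (t : ℝ) {x : M} (hx : x ∈ S) :
    MDifferentiableAt (𝓘(ℝ, ℝ).prod I) I (fun q : ℝ × M => Φ q.1 q.2) (t, x) :=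
  (hΦ.smooth.contMDiffAt (x := (t, x)) ((isOpen_univ.prod hS).mem_nhds
    ⟨trivial, hx⟩)).mdifferentiableAt (by simp)

theorem IsEquivariantFamily.mdifferentiableAt_curve (hΦ : D.IsEquivariantFamily S univ Φ Ψ)
    (hS : IsOpen S) (hγ : MDifferentiableAt 𝓘(ℝ, ℝ) I γ t) (hγS : γ t ∈ S) :
    MDifferentiableAt 𝓘(ℝ, ℝ) I (fun τ => Φ τ (γ τ)) t :=
  MDifferentiableAt.comp t (hΦ.mdifferentiableAt_uncurry hS t hγS) (mdifferentiableAt_id.prodMk hγ)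

/-- The Hamiltonian of a product of two equivariant isotopies. -/
theorem IsEquivariantFamily.α_curve (hD : D.IsLiouville) (hΦ : D.IsEquivariantFamily S univ Φ Ψ)
    (hS : IsOpen S) (hγ : MDifferentiableAt 𝓘(ℝ, ℝ) I γ t) (hγS : γ t ∈ S) :
    D.α (Φ t (γ t)) (mfderiv 𝓘(ℝ, ℝ) I (fun τ => Φ τ (γ τ)) t (1 : ℝ)) =
      D.α (Φ t (γ t)) (mfderiv 𝓘(ℝ, ℝ) I (fun τ => Φ τ (γ t)) t (1 : ℝ)) +
        D.α (γ t) (mfderiv 𝓘(ℝ, ℝ) I γ t (1 : ℝ)) := by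
  have h1 : mfderiv 𝓘(ℝ, ℝ) 𝓘(ℝ, ℝ) (fun τ : ℝ => τ) t (1 : ℝ) = (1 : ℝ) := by
    have : mfderiv 𝓘(ℝ, ℝ) 𝓘(ℝ, ℝ) (fun τ : ℝ => τ) t = ContinuousLinearMap.id ℝ ℝ := mfderiv_id
    rw [this]
    rfl
  rw [mfderiv_family_comp (s := fun τ : ℝ => τ) (hΦ.mdifferentiableAt_uncurry hS t hγS)
    mdifferentiableAt_id hγ h1]
  refine (map_add _ _ _).trans (congrArg₂ (· + ·) ?_
    (hΦ.α_pullback hD hS (mem_univ t) hγS _))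
  exact congrArg (D.α (Φ t (γ t))) (one_smul ℝ _)

end Velocity

variable {E : Type*} [NormedAddCommGroup E] [NormedSpace ℝ E] [FiniteDimensional ℝ E]
  {H : Type*} [TopologicalSpace H] {I : ModelWithCorners ℝ E H} [I.Boundaryless]
  {M : Type*} [TopologicalSpace M] [T2Space M] [ChartedSpace H M] [IsManifold I ∞ M]
  {D : LiouvilleData I M} {n k : ℕ}

theorem α_vertical_velocity (x : M) {g : ℝ → Cn n} {g' : Cn n} {t : ℝ} (hg : HasDerivAt g g' t) :
    (D.stabilization n).α (x, g t)
      (mfderiv 𝓘(ℝ, ℝ) (I.prod 𝓘(ℝ, Cn n)) (fun τ => ((x, g τ) : M × Cn n)) t (1 : ℝ)) =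
      1 / 2 * stdSymplectic n (g t) g' := by
  have h1 : (mfderiv 𝓘(ℝ, ℝ) (I.prod 𝓘(ℝ, Cn n)) (fun τ => ((x, g τ) : M × Cn n)) t (1 : ℝ) :
      E × Cn n) = (0, g') := by
    have h2 := ((hasMFDerivAt_const (I := 𝓘(ℝ, ℝ)) (I' := I) x t).prodMk
      hg.hasFDerivAt.hasMFDerivAt).mfderiv
    refine (congrArg (fun A : ℝ →L[ℝ] E × Cn n => A 1) h2).trans ?_
    exact Prod.ext rfl (one_smul ℝ g')
  rw [h1]
  refine (stabilization_α (D := D) (x, g t) ((0, g') : E × Cn n)).trans ?_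
  exact (congrArg (· + 1 / 2 * stdSymplectic n (g t) g') (map_zero (D.α x))).trans (zero_add _)

theorem norm_exp_smul (t : ℝ) (z : Cn n) :
    ‖Complex.exp (2 * Real.pi * t * Complex.I) • z‖ = ‖z‖ := by
  have : (2 * Real.pi * t * Complex.I : ℂ) = ((2 * Real.pi * t : ℝ) : ℂ) * Complex.I := by
    push_cast; ring
  rw [norm_smul, this, Complex.norm_exp_ofReal_mul_I, one_mul]

/-- The velocity is 2πc i z, and α pairs it with z as ½ ω(z, 2πc i z) = πc|z|². -/
theorem α_velocity_rotE (c t : ℝ) (p : M × Cn n) :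
    (D.stabilization n).α (rotE (c * t) p)
      (mfderiv 𝓘(ℝ, ℝ) (I.prod 𝓘(ℝ, Cn n)) (fun τ => rotE (c * τ) p) t (1 : ℝ)) =
      c * (Real.pi * ‖p.2‖ ^ 2) := by
  let g : ℝ → Cn n := fun τ => Complex.exp (2 * Real.pi * (c * τ : ℝ) * Complex.I) • p.2
  have hg : HasDerivAt g ((2 * Real.pi * c : ℝ) • Complex.I • g t) t := by
    have h1 : HasDerivAt (fun τ : ℝ => (2 * Real.pi * (c * τ : ℝ) * Complex.I : ℂ))
        (2 * Real.pi * (c : ℝ) * Complex.I) t := by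
      have := ((((hasDerivAt_id t).const_mul c).ofReal_comp).const_mul
        (2 * Real.pi : ℂ)).mul_const Complex.I
      rw [mul_one] at this
      exact this
    refine (h1.cexp.smul_const p.2).congr_deriv ?_
    simp only [g, ← Complex.coe_smul, smul_smul]
    congr 1
    push_cast
    ring
  refine (α_vertical_velocity (D := D) p.1 hg).trans ?_
  rw [map_smul, stdSymplectic_I_smul, norm_exp_smul, smul_eq_mul]
  ring

theorem rotF_apply (t : ℝ) (p : M × Cn n) (i : Fin n) : (rotF t p).2 i =
    if i.val = 0 then Complex.exp (2 * Real.pi * ((n : ℂ) - 1) * t * Complex.I) * p.2 i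
    else Complex.exp (-(2 * Real.pi * t * Complex.I)) * p.2 i := rfl

theorem headPt_rotF (t : ℝ) (p : M × Cn (k + 1)) : headPt (rotF t p) =
    Complex.exp ((k * (2 * Real.pi * t) : ℝ) * Complex.I) * headPt p := by
  have h : headPt (rotF t p) = Complex.exp (2 * Real.pi * (((k + 1 : ℕ) : ℂ) - 1) * t *
    Complex.I) * p.2 0 := (rotF_apply t p 0).trans (if_pos rfl)
  rw [h]
  change _ = _ * p.2 0
  congr 2
  push_cast
  ring

theorem tailL_rotF (t : ℝ) (p : M × Cn (k + 1)) : tailL k (rotF t p).2 =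
    Complex.exp (2 * Real.pi * (-t : ℝ) * Complex.I) • tailL k p.2 := by
  ext j
  have h : tailL k (rotF t p).2 j = Complex.exp (-(2 * Real.pi * t * Complex.I)) * p.2 j.succ :=
    (rotF_apply t p j.succ).trans (if_neg (Nat.succ_ne_zero j.val))
  rw [h]
  change _ = Complex.exp _ * p.2 j.succ
  congr 2
  push_cast
  ring

theorem norm_headPt_rotF (t : ℝ) (p : M × Cn (k + 1)) : ‖headPt (rotF t p)‖ = ‖headPt p‖ := by
  rw [headPt_rotF, norm_mul, Complex.norm_exp_ofReal_mul_I, one_mul]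

theorem norm_rotF_sq (t : ℝ) (p : M × Cn (k + 1)) :
    ‖(rotF t p).2‖ ^ 2 = ‖headPt p‖ ^ 2 + ‖tailL k p.2‖ ^ 2 := by
  rw [norm_sq_eq_headL_tailL, tailL_rotF, norm_exp_smul]
  exact congrArg (fun r => r ^ 2 + ‖tailL k p.2‖ ^ 2) (norm_headPt_rotF t p)

/-- The first coordinate turns `k` times per period and the others turn once in the opposite sense,
so their contributions carry the weights `k` and `-1`. -/
theorem α_velocity_rotF (c t : ℝ) (p : M × Cn (k + 1)) :
    (D.stabilization (k + 1)).α (rotF (c * t) p)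
      (mfderiv 𝓘(ℝ, ℝ) (I.prod 𝓘(ℝ, Cn (k + 1))) (fun τ => rotF (c * τ) p) t (1 : ℝ)) =
      c * (Real.pi * (k * ‖headPt p‖ ^ 2 - ‖tailL k p.2‖ ^ 2)) := by
  let g : ℝ → Cn (k + 1) := fun τ => (rotF (c * τ) p).2
  let h : ℝ → ℂ := fun τ => Complex.exp ((k * (2 * Real.pi * (c * τ)) : ℝ) * Complex.I) * headPt p
  let w : ℝ → Cn k := fun τ =>
    Complex.exp (2 * Real.pi * (-(c * τ) : ℝ) * Complex.I) • tailL k p.2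
  have hgc : g = fun τ => consL k (h τ, w τ) := funext fun τ =>
    eq_of_headL_tailL (headPt_rotF _ p) (tailL_rotF _ p)
  have hh : HasDerivAt h ((k * (2 * Real.pi * c) : ℝ) • (Complex.I * h t)) t := by
    have h1 : HasDerivAt (fun τ : ℝ => ((k * (2 * Real.pi * (c * τ)) : ℝ) : ℂ) * Complex.I)
        (((k * (2 * Real.pi * c) : ℝ) : ℂ) * Complex.I) t := by
      have := ((((hasDerivAt_id t).const_mul c).const_mul (2 * Real.pi)).const_mul
        (k : ℝ)).ofReal_comp.mul_const Complex.I
      rw [mul_one] at this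
      exact this
    refine (h1.cexp.mul_const (headPt p)).congr_deriv ?_
    simp only [h, Complex.real_smul]
    ring
  have hw : HasDerivAt w ((-(2 * Real.pi * c) : ℝ) • Complex.I • w t) t := by
    have h1 : HasDerivAt (fun τ : ℝ => (2 * Real.pi * (-(c * τ) : ℝ) * Complex.I : ℂ))
        (2 * Real.pi * (-c : ℝ) * Complex.I) t := by
      have := ((((hasDerivAt_id t).const_mul c).neg.ofReal_comp).const_mul
        (2 * Real.pi : ℂ)).mul_const Complex.I
      rw [mul_one] at this
      exact this
    refine (h1.cexp.smul_const (tailL k p.2)).congr_deriv ?_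
    simp only [w, ← Complex.coe_smul, smul_smul]
    congr 1
    push_cast
    ring
  have hg : HasDerivAt g (consL k ((k * (2 * Real.pi * c) : ℝ) • (Complex.I * h t),
      (-(2 * Real.pi * c) : ℝ) • Complex.I • w t)) t := by
    rw [hgc]
    exact (consL k).hasFDerivAt.comp_hasDerivAt t (hh.prodMk hw)
  refine (α_vertical_velocity (D := D) p.1 hg).trans ?_
  rw [stdSymplectic_succ, hgc]
  simp only [headL_consL, tailL_consL]
  rw [planeForm_smul_right, planeForm_I_smul_self, map_smul, stdSymplectic_I_smul, smul_eq_mul]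
  have e1 : ‖h t‖ = ‖headPt p‖ := by
    rw [norm_mul, Complex.norm_exp_ofReal_mul_I, one_mul]
  have e2 : ‖w t‖ = ‖tailL k p.2‖ := norm_exp_smul _ _
  rw [e1, e2]
  ring

/-- The scalar rotation as a linear map. -/
def rotL (n : ℕ) (t : ℝ) : Cn n →L[ℝ] Cn n :=
  ((Complex.exp (2 * Real.pi * t * Complex.I)) • (ContinuousLinearMap.id ℂ (Cn n))).restrictScalars ℝ

theorem rotL_apply (t : ℝ) (z : Cn n) :
    rotL n t z = Complex.exp (2 * Real.pi * t * Complex.I) • z := rfl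

theorem isLinearFamily_rotL : IsLinearFamily (rotL n) (fun t => rotL n (-t)) := by
  have hs : ContDiff ℝ ∞ (rotL n) := by
    refine contDiff_clm_apply_iff.2 fun z => ?_
    simp only [rotL_apply]
    exact (((contDiff_const.mul Complex.ofRealCLM.contDiff).mul contDiff_const).cexp).smul
      contDiff_const
  have hinv : ∀ t, rotL n (-t) * rotL n t = 1 := fun t => by
    ext1 z
    change rotL n (-t) (rotL n t z) = z
    rw [rotL_apply, rotL_apply, smul_smul, ← Complex.exp_add]
    simp
  refine ⟨hs, hs.comp contDiff_neg, hinv, fun t => ?_, fun t v w => ?_⟩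
  · have := hinv (-t)
    rwa [neg_neg] at this
  · rw [stdSymplectic_apply, stdSymplectic_apply]
    refine Finset.sum_congr rfl fun i _ => ?_
    have : (2 * Real.pi * t * Complex.I : ℂ) = ((2 * Real.pi * t : ℝ) : ℂ) * Complex.I := by
      push_cast; ring
    have h2 := planeForm_rotate (2 * Real.pi * t) (v i) (w i)
    rw [← this] at h2
    exact h2

theorem rotE_add_one (t : ℝ) (p : M × Cn n) : rotE (t + 1) p = rotE t p := by
  have : Complex.exp (2 * Real.pi * (t + 1 : ℝ) * Complex.I) =
      Complex.exp (2 * Real.pi * t * Complex.I) := by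
    rw [Complex.exp_eq_exp_iff_exists_int]
    exact ⟨1, by push_cast; ring⟩
  rw [rotE, rotE, this]

theorem rotE_zero (p : M × Cn n) : rotE 0 p = p := by
  simp [rotE]

/-- Take all `k` non-zero indices in `exists_isContractibleLinearLoop`, with three turns per period.
The first coordinate then turns `3 * k` times, as in f_{3t}. -/
theorem exists_contraction_rotF :
    ∃ u : ℝ → Cn (k + 1) →L[ℝ] Cn (k + 1), IsContractibleLinearLoop u ∧
      ∀ t, ∀ p : M × Cn (k + 1), (p.1, u t p.2) = rotF (3 * t) p := by
  obtain ⟨u, hu, hu'⟩ := exists_isContractibleLinearLoop (k := k) 3 (Finset.univ.erase 0) (by simp)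
  refine ⟨u, hu, fun t p => eq_of_headPt_tailPt ?_ (Prod.ext rfl ?_)⟩
  · rw [headPt_rotF]
    refine (hu' t p.2 0).trans ?_
    rw [if_pos rfl]
    simp only [Finset.card_erase_of_mem (Finset.mem_univ _), Finset.card_univ, Fintype.card_fin,
      Nat.add_sub_cancel, headPt, headL_apply]
    congr 2
    push_cast
    ring
  · change tailL k (u t p.2) = tailL k (rotF (3 * t) p).2
    rw [tailL_rotF]
    ext j
    refine (hu' t p.2 j.succ).trans ?_
    rw [if_neg (Fin.succ_ne_zero j), if_pos (Finset.mem_erase.2 ⟨Fin.succ_ne_zero j,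
      Finset.mem_univ _⟩)]
    change _ = Complex.exp _ * p.2 j.succ
    congr 2
    push_cast
    ring

/-- On the complement of the core the vertical coordinate is controlled by the radial one. -/
theorem exists_norm_sq_le (hN : (D.stabilization k).IsLiouville) {P U : Set (M × Cn k)}
    (h : (D.stabilization k).IsStarshaped P U) :
    ∃ C : ℝ, 0 ≤ C ∧ ∀ y ∉ (D.stabilization k).core U,
      ‖y.2‖ ^ 2 ≤ C * Real.exp ((D.stabilization k).hitTime P y) := by
  -- The bound holds on the compact hypersurface and propagates along trajectories, since both sides
  -- are multiplied by e^t under the flow for time t.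
  obtain ⟨C, hC⟩ := (h.isCompact.image continuous_snd).isBounded.exists_norm_le
  refine ⟨C ^ 2, sq_nonneg C, fun y hy => ?_⟩
  let τ := (D.stabilization k).hitTime P y
  have h1 := hN.flow_hitTime_mem h hy
  have h2 : ‖((D.stabilization k).flow (-τ) y).2‖ ≤ C := hC _ ⟨_, h1, rfl⟩
  have h3 : y.2 = Real.exp (τ / 2) • ((D.stabilization k).flow (-τ) y).2 :=
    congrArg Prod.snd (hN.flow_flow_neg τ y).symm
  have h4 : ‖y.2‖ ^ 2 = Real.exp τ * ‖((D.stabilization k).flow (-τ) y).2‖ ^ 2 := by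
    conv_lhs => rw [h3]
    rw [norm_smul, mul_pow, Real.norm_of_nonneg (Real.exp_pos _).le, ← Real.exp_nat_mul]
    congr 2
    push_cast
    ring
  rw [h4, mul_comm]
  have := pow_le_pow_left₀ (norm_nonneg _) h2 2
  gcongr

end LiouvilleData

end PositiveLoop

/-! ### The positive contractible loop. -/

section PositiveLoopExists

open Filter Topology

namespace LiouvilleData

variable {E : Type*} [NormedAddCommGroup E] [NormedSpace ℝ E] [FiniteDimensional ℝ E]
  {H : Type*} [TopologicalSpace H] {I : ModelWithCorners ℝ E H} [I.Boundaryless]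
  {M : Type*} [TopologicalSpace M] [T2Space M] [ChartedSpace H M] [IsManifold I ∞ M]
  {D : LiouvilleData I M} {k : ℕ}

theorem twistMap_zero {P U : Set (M × Cn k)} {G : ℝ → M × Cn k → M × Cn k}
    {ψ χ : ℝ → ℂ → ℂ} {T : ℝ → ℂ → ℝ} {R : ℝ} (hG : (D.stabilization k).IsReebFlow P U G)
    (ht : IsTwist ψ χ T R) (p : M × Cn (k + 1)) : D.twistMap P U G ψ T 0 p = p := by
  by_cases hp : tailPt p ∈ (D.stabilization k).core U
  · exact twistMap_of_mem hp
  · rw [twistMap_of_notMem hp, ht.zero, ht.primitive_zero, hG.zero _ hp, exp_smul_normHead,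
      consPt_headPt_tailPt]

/-- The estimate which makes the loop positive. -/
theorem twistMap_estimate (hk : 1 ≤ k) {P U : Set (M × Cn k)} {G : ℝ → M × Cn k → M × Cn k}
    {ψ : ℝ → ℂ → ℂ} {T : ℝ → ℂ → ℝ} (hG : (D.stabilization k).IsReebFlow P U G)
    (hcore : ∀ y ∈ (D.stabilization k).core U, y.2 = 0) {C : ℝ}
    (hC : ∀ y ∉ (D.stabilization k).core U,
      ‖y.2‖ ^ 2 ≤ C * Real.exp ((D.stabilization k).hitTime P y))
    (hψ : ∀ ζ, 4 * C < ‖ζ‖ ^ 2 + 2 * ‖ψ 1 ζ‖ ^ 2) {p : M × Cn (k + 1)}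
    (hp : tailPt p ∉ (D.stabilization k).core U ∨ headPt p ≠ 0) :
    0 < ‖p.2‖ ^ 2 + (3 * k - 1) * ‖headPt (D.twistMap P U G ψ T 1 p)‖ ^ 2 -
      4 * ‖tailL k (D.twistMap P U G ψ T 1 p).2‖ ^ 2 := by
  have hk' : (1 : ℝ) ≤ k := by exact_mod_cast hk
  -- Over the core the twist is the identity and w = 0, so no negative term is present and z₁ ≠ 0
  -- gives strict positivity.
  by_cases hpc : tailPt p ∈ (D.stabilization k).core U
  · have h0 : tailL k p.2 = 0 := hcore _ hpc
    have h1 : 0 < ‖headPt p‖ := norm_pos_iff.2 (hp.resolve_left (not_not.2 hpc))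
    rw [twistMap_of_mem hpc, h0, norm_zero]
    have h2 : 0 ≤ (3 * k - 1 : ℝ) * ‖headPt p‖ ^ 2 := mul_nonneg (by linarith) (sq_nonneg _)
    have h3 : ‖p.2‖ ^ 2 = ‖headPt p‖ ^ 2 + ‖tailL k p.2‖ ^ 2 := norm_sq_eq_headL_tailL p.2
    rw [h0, norm_zero] at h3
    nlinarith
  -- Divided by e^τ, the expression is at least |ζ|² + 2|ψ₁(ζ)|² - 4C. The coefficient 2 comes from
  -- `3 * k - 1 ≥ 2`, and the bound on w is available at the image because the twist preserves τ.
  · let τ := (D.stabilization k).hitTime P (tailPt p)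
    let ζ := D.normHead P p
    have hexp : ∀ c : ℂ, ‖Real.exp (τ / 2) • c‖ ^ 2 = Real.exp τ * ‖c‖ ^ 2 := fun c => by
      rw [norm_smul, mul_pow, Real.norm_of_nonneg (Real.exp_pos _).le, ← Real.exp_nat_mul]
      congr 2
      push_cast
      ring
    have h1 : Real.exp τ * ‖ζ‖ ^ 2 ≤ ‖p.2‖ ^ 2 := by
      rw [← hexp, exp_smul_normHead, norm_sq_eq_headL_tailL]
      exact le_add_of_nonneg_right (sq_nonneg _)
    have h2 : ‖headPt (D.twistMap P U G ψ T 1 p)‖ ^ 2 = Real.exp τ * ‖ψ 1 ζ‖ ^ 2 := by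
      rw [twistMap_of_notMem hpc, headPt_consPt, hexp]
    have h3 := hC _ (tailPt_twistMap_notMem (ψ := ψ) (T := T) (s := 1) hG hpc)
    rw [hitTime_tailPt_twistMap hG hpc] at h3
    have h3 : ‖tailL k (D.twistMap P U G ψ T 1 p).2‖ ^ 2 ≤ C * Real.exp τ := h3
    rw [h2]
    have h4 : 0 < Real.exp τ * (‖ζ‖ ^ 2 + 2 * ‖ψ 1 ζ‖ ^ 2 - 4 * C) :=
      mul_pos (Real.exp_pos _) (by linarith [hψ ζ])
    have h5 : 2 * (Real.exp τ * ‖ψ 1 ζ‖ ^ 2) ≤ (3 * k - 1) * (Real.exp τ * ‖ψ 1 ζ‖ ^ 2) :=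
      mul_le_mul_of_nonneg_right (by linarith) (by positivity)
    nlinarith

/-- The condition `1 ≤ k` ensures that M × ℂᵏ is a stabilization with core in {w = 0}, which
provides the Reeb flow and the bound on w, and that `3 * k - 1` is at least 2. -/
theorem IsLiouville.exists_positive_contractible_loop (hD : D.IsLiouville) (hk : 1 ≤ k)
    {P' U' : Set (M × Cn (k + 1))} (h' : (D.stabilization (k + 1)).IsStarshaped P' U') :
    ∃ a b : ℝ → M × Cn (k + 1) → M × Cn (k + 1),
      (D.stabilization (k + 1)).IsEquivariantFamily ((D.stabilization (k + 1)).symplectization U')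
        (Icc (0 : ℝ) 1) a b ∧
      (∀ x ∈ (D.stabilization (k + 1)).symplectization U', a 0 x = x) ∧
      (D.stabilization (k + 1)).IsPositiveLoop ((D.stabilization (k + 1)).symplectization U')
        (fun t x => rotE (-t) (rotF (3 * t) (a 1 (rotE t (b 1 x))))) ∧
      (D.stabilization (k + 1)).IsContractibleLoop ((D.stabilization (k + 1)).symplectization U')
        (fun t x => rotE (-t) (rotF (3 * t) (a 1 (rotE t (b 1 x))))) := by
  obtain ⟨P₀, U₀, h₀⟩ := hD.exists_starshaped
  have hN := hD.stabilization hk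
  have hN' := hD.stabilization (n := k + 1) (by omega)
  obtain ⟨P, U, h⟩ := hN.exists_starshaped
  obtain ⟨G, hG⟩ := hN.exists_reebFlow h
  obtain ⟨C, hC0, hC⟩ := exists_norm_sq_le hN h
  -- The radius is chosen so that its square is `4 * C`, the constant of `twistMap_estimate`.
  obtain ⟨ψ, χ, T, R, ht, -, hψ⟩ := exists_twist (B := 2 * Real.sqrt C) (by positivity)
  have hB : (2 * Real.sqrt C) ^ 2 = 4 * C := by
    rw [mul_pow, Real.sq_sqrt hC0]; norm_num
  rw [hB] at hψ
  let N' := D.stabilization (k + 1)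
  let S := N'.symplectization U'
  have hS : IsOpen S := hN'.isOpen_symplectization h'
  have hflow : ∀ r, MapsTo (N'.flow r) S S := fun r x hx => mt (hN'.flow_mem_core_iff h' r).1 hx
  -- Both cores equal Core(M) × {0} in their respective products. Thus `S` is exactly the domain on
  -- which the twist map has been shown to be smooth.
  have hSm : ∀ p, p ∈ S ↔ tailPt p ∉ (D.stabilization k).core U ∨ headPt p ≠ 0 := by
    intro p
    have h1 : p ∈ S ↔ ¬(p.1 ∈ D.core U₀ ∧ p.2 = 0) :=
      not_congr (hD.mem_core_stabilization_iff h₀ (by omega) h')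
    have h2 := hD.mem_core_stabilization_iff h₀ hk h (p := tailPt p)
    rw [h1, h2, ← not_and_or]
    refine not_congr ⟨fun h3 => ⟨⟨h3.1, ?_⟩, ?_⟩, fun h3 => ⟨h3.1.1, ?_⟩⟩
    · exact (congrArg (tailL k) h3.2).trans (map_zero _)
    · exact (congrArg (headL k) h3.2).trans (map_zero _)
    · exact eq_of_headL_tailL (h3.2.trans (map_zero (headL k)).symm)
        (h3.1.2.trans (map_zero (tailL k)).symm)
  have hSlin : ∀ p q : M × Cn (k + 1), p.1 = q.1 → (p.2 = 0 ↔ q.2 = 0) → p ∈ S → q ∈ S := by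
    intro p q h1 h2 hp hq
    refine hp ((hD.mem_core_stabilization_iff h₀ (by omega) h').2 ?_)
    rw [h1, h2]
    exact (hD.mem_core_stabilization_iff h₀ (by omega) h').1 hq
  let a := D.twistMap P U G ψ T
  let b := D.twistMap P U G χ fun s ζ => -T s (χ s ζ)
  have ha : N'.IsEquivariantFamily S univ a b :=
    isEquivariantFamily_twistMap hN h hG hN' hS hSm ht
  have ha0 : ∀ x, a 0 x = x := twistMap_zero hG ht
  have hb0 : ∀ x ∈ S, b 0 x = x := fun x hx => by
    conv_lhs => rw [← ha0 x]
    exact ha.left_inv 0 trivial x hx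
  obtain ⟨u, ⟨V, V', hV, hV0, hV1, hVs, hVt⟩, hu⟩ := exists_contraction_rotF (M := M) (k := k)
  have hVF : ∀ t, ∀ p : M × Cn (k + 1), (p.1, V (1, t) p.2) = rotF (3 * t) p := fun t p => by
    rw [hV1]; exact hu t p
  -- The twist and the contraction of f_{3t} share the parameter s. At s = 0 the map collapses to
  -- e_{-t} e_t, at t = 0 to a^{(s)} (a^{(s)})⁻¹, and at s = 1 it is the loop itself.
  let F : ℝ × ℝ → M × Cn (k + 1) → M × Cn (k + 1) := fun q x =>
    let y := a q.1 (rotE q.2 (b q.1 x))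
    rotE (-q.2) (y.1, V q y.2)
  obtain ⟨F', hF⟩ : ∃ F', N'.IsEquivariantFamily S univ F F' := by
    have hE : N'.IsEquivariantFamily S (univ : Set (ℝ × ℝ)) (fun q p => rotE q.2 p) _ :=
      (isLinearFamily_rotL.reparam contDiff_snd).isEquivariantFamily hSlin
    have hE' : N'.IsEquivariantFamily S (univ : Set (ℝ × ℝ)) (fun q p => rotE (-q.2) p) _ :=
      (isLinearFamily_rotL.reparam contDiff_snd.neg).isEquivariantFamily hSlin
    have hVV := hV.isEquivariantFamily (D := D) hSlin
    have hA := ha.reparam (T' := ℝ × ℝ) (K' := univ) (g := Prod.fst) contDiffOn_fst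
      (fun _ _ => trivial)
    have hB := (ha.symm hS hflow).reparam (T' := ℝ × ℝ) (K' := univ) (g := Prod.fst) contDiffOn_fst
      (fun _ _ => trivial)
    exact ⟨_, hE'.comp (hVV.comp (hA.comp (hE.comp hB hS) hS) hS) hS⟩
  have hF1 : ∀ t x, F (1, t) x = rotE (-t) (rotF (3 * t) (a 1 (rotE t (b 1 x)))) := fun t x => by
    simp only [F, hVF]
  have hFt : ∀ s t x, F (s, t + 1) x = F (s, t) x := fun s t x => by
    have e : rotE (M := M) (n := k + 1) (-(t + 1)) = rotE (-t) := funext fun p => by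
      rw [← rotE_add_one (-(t + 1)), show -(t + 1) + 1 = -t by ring]
    simp only [F, hVt, rotE_add_one, e]
  have hFs : ∀ s, ∀ x ∈ S, F (s, 0) x = x := fun s x hx => by
    simp only [F, hVs, neg_zero, rotE_zero]
    exact ha.right_inv s trivial x hx
  have hF0 : ∀ t, ∀ x ∈ S, F (0, t) x = x := fun t x hx => by
    simp only [F, hV0, ha0, hb0 x hx]
    exact Prod.ext rfl (congrArg (fun A : Cn (k + 1) →L[ℝ] Cn (k + 1) => A x.2)
      (isLinearFamily_rotL.left_inv t))
  have hloop : (fun t x => rotE (-t) (rotF (3 * t) (a 1 (rotE t (b 1 x))))) = fun t => F (1, t) :=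
    funext fun t => funext fun x => (hF1 t x).symm
  refine ⟨a, b, ha.mono (subset_univ _), fun x _ => ha0 x, ?_, F, F', hF.mono (subset_univ _), hF0,
    fun t x _ => hF1 t x, fun s _ => hFs s, fun s _ t x _ => hFt s t x⟩
  refine ⟨?_, ?_, ?_, fun t x hx => ?_⟩
  · rw [hloop]
    exact ⟨_, hF.reparam (g := fun t : ℝ => ((1 : ℝ), t)) (contDiffOn_const.prodMk contDiffOn_id)
      fun _ _ => trivial⟩
  · exact fun x hx => (hF1 0 x).symm.trans (hFs 1 x hx)
  · exact fun t x _ => (hF1 (t + 1) x).symm.trans ((hFt 1 t x).trans (hF1 t x))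
  · let y := b 1 x
    have hy : y ∈ S := ha.mapsTo_inv 1 trivial hx
    have hlin : ∀ c : ℝ, N'.IsEquivariantFamily S univ (fun t p => rotE (c * t) p) _ := fun c =>
      (isLinearFamily_rotL.reparam (contDiff_const.mul contDiff_id)).isEquivariantFamily hSlin
    have hrotF : N'.IsEquivariantFamily S univ (fun t p => rotF (3 * t) p)
        (fun t p => (p.1, V' (1, t) p.2)) := by
      have := (hV.reparam (contDiff_const.prodMk contDiff_id : ContDiff ℝ ∞
        fun t : ℝ => ((1 : ℝ), t))).isEquivariantFamily (D := D) hSlin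
      simp only [hVF] at this
      exact this
    have hA := ha.reparam (T' := ℝ) (K' := univ) (g := fun _ => (1 : ℝ)) contDiffOn_const
      (fun _ _ => trivial)
    -- The orbit is built one factor at a time, and each factor adds its own Hamiltonian. The
    -- explicit multiples `1 * τ` and `-1 * τ` match the common form of `α_velocity_rotE`.
    let γ₁ : ℝ → M × Cn (k + 1) := fun τ => rotE (1 * τ) y
    let γ₂ : ℝ → M × Cn (k + 1) := fun τ => a 1 (γ₁ τ)
    let γ₃ : ℝ → M × Cn (k + 1) := fun τ => rotF (3 * τ) (γ₂ τ)
    let γ₄ : ℝ → M × Cn (k + 1) := fun τ => rotE (-1 * τ) (γ₃ τ)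
    have hγ₁ : γ₁ t ∈ S := (hlin 1).mapsTo t trivial hy
    have hγ₂ : γ₂ t ∈ S := ha.mapsTo 1 trivial hγ₁
    have hγ₃ : γ₃ t ∈ S := hrotF.mapsTo t trivial hγ₂
    have hd₁ : MDifferentiableAt 𝓘(ℝ, ℝ) (I.prod 𝓘(ℝ, Cn (k + 1))) γ₁ t :=
      (hlin 1).mdifferentiableAt_curve (γ := fun _ => y) hS mdifferentiableAt_const hy
    have hd₂ : MDifferentiableAt 𝓘(ℝ, ℝ) (I.prod 𝓘(ℝ, Cn (k + 1))) γ₂ t :=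
      hA.mdifferentiableAt_curve hS hd₁ hγ₁
    have hd₃ : MDifferentiableAt 𝓘(ℝ, ℝ) (I.prod 𝓘(ℝ, Cn (k + 1))) γ₃ t :=
      hrotF.mdifferentiableAt_curve hS hd₂ hγ₂
    let A : (ℝ → M × Cn (k + 1)) → ℝ := fun γ =>
      N'.α (γ t) (mfderiv 𝓘(ℝ, ℝ) (I.prod 𝓘(ℝ, Cn (k + 1))) γ t (1 : ℝ))
    have e₁ : A γ₁ = 1 * (Real.pi * ‖y.2‖ ^ 2) := α_velocity_rotE 1 t y
    have e₂' : A (fun _ : ℝ => a 1 (γ₁ t)) = 0 := by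
      simp only [A]
      rw [mfderiv_const]
      exact map_zero _
    have e₂ : A γ₂ = A (fun _ : ℝ => a 1 (γ₁ t)) + A γ₁ := hA.α_curve hN' hS hd₁ hγ₁
    have e₃' : A (fun τ => rotF (3 * τ) (γ₂ t)) = 3 * (Real.pi * (k * ‖headPt (γ₂ t)‖ ^ 2 -
        ‖tailL k (γ₂ t).2‖ ^ 2)) := α_velocity_rotF 3 t (γ₂ t)
    have e₃ : A γ₃ = A (fun τ => rotF (3 * τ) (γ₂ t)) + A γ₂ := hrotF.α_curve hN' hS hd₂ hγ₂
    have e₄' : A (fun τ => rotE (-1 * τ) (γ₃ t)) = -1 * (Real.pi * ‖(γ₃ t).2‖ ^ 2) :=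
      α_velocity_rotE (-1) t (γ₃ t)
    have e₄ : A γ₄ = A (fun τ => rotE (-1 * τ) (γ₃ t)) + A γ₃ := (hlin (-1)).α_curve hN' hS hd₃ hγ₃
    have hfun : (fun τ => rotE (-τ) (rotF (3 * τ) (a 1 (rotE τ (b 1 x))))) = γ₄ :=
      funext fun τ => by simp only [γ₄, γ₃, γ₂, γ₁, one_mul, neg_one_mul, y]
    have hpos : 0 < A γ₄ := by
      have e : A γ₄ = -1 * (Real.pi * ‖(γ₃ t).2‖ ^ 2) + (3 * (Real.pi * (k * ‖headPt (γ₂ t)‖ ^ 2 -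
          ‖tailL k (γ₂ t).2‖ ^ 2)) + (0 + 1 * (Real.pi * ‖y.2‖ ^ 2))) := by
        rw [e₄, e₄', e₃, e₃', e₂, e₂', e₁]
      clear_value A
      rw [e]
      have h1 : ‖(γ₃ t).2‖ ^ 2 = _ := norm_rotF_sq (3 * t) (γ₂ t)
      have h2 : ‖y.2‖ = ‖(γ₁ t).2‖ := (norm_exp_smul _ _).symm
      -- The rotation f preserves |z₁|² + |w|², so e_{-t} subtracts one more of each: the
      -- coefficients become 3k - 1 and -(3 + 1).
      have h3 : 0 < ‖(γ₁ t).2‖ ^ 2 + (3 * k - 1) * ‖headPt (γ₂ t)‖ ^ 2 -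
          4 * ‖tailL k (γ₂ t).2‖ ^ 2 :=
        twistMap_estimate hk hG (fun z hz =>
          ((hD.mem_core_stabilization_iff h₀ hk h).1 hz).2) hC hψ ((hSm _).1 hγ₁)
      rw [h1, h2]
      have h4 := mul_pos Real.pi_pos h3
      nlinarith [h4]
    have key : ∀ f : ℝ → M × Cn (k + 1), f = γ₄ →
        0 < N'.α (f t) (mfderiv 𝓘(ℝ, ℝ) (I.prod 𝓘(ℝ, Cn (k + 1))) f t (1 : ℝ)) := by
      rintro _ rfl
      exact hpos
    have hf := key (fun τ => rotE (-τ) (rotF (3 * τ) (a 1 (rotE τ (b 1 x))))) hfun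
    exact hf

end LiouvilleData

end PositiveLoopExists

/-! ## The ideal contact boundary as a quotient of the symplectization -/

section BoundaryProjection

open Filter Topology

namespace LiouvilleData

variable {E : Type*} [NormedAddCommGroup E] [NormedSpace ℝ E] [FiniteDimensional ℝ E]
  {H : Type*} [TopologicalSpace H] {I : ModelWithCorners ℝ E H} [I.Boundaryless]
  {M : Type*} [TopologicalSpace M] [T2Space M] [ChartedSpace H M] [IsManifold I ∞ M]
  {F : Type*} [NormedAddCommGroup F] [NormedSpace ℝ F] [FiniteDimensional ℝ F]
  {G : Type*} [TopologicalSpace G] {J : ModelWithCorners ℝ F G} [J.Boundaryless]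
  {Q : Type*} [TopologicalSpace Q] [ChartedSpace G Q] [IsManifold J ∞ Q]
  {E' : Type*} [NormedAddCommGroup E'] [NormedSpace ℝ E']
  {H' : Type*} [TopologicalSpace H'] {I' : ModelWithCorners ℝ E' H'}
  {N : Type*} [TopologicalSpace N] [ChartedSpace H' N]
  {D : LiouvilleData I M} {P U : Set M} {ι : Q → M} {κ : M → Q}

/-- `κ` is the projection of the symplectization onto the hypersurface parametrized by `ι` along
the Liouville trajectories. -/
def IsBoundaryProjection (D : LiouvilleData I M) (P U : Set M) (ι : Q → M) (κ : M → Q) : Prop :=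
  ∀ x ∈ D.symplectization U, ι (κ x) = D.flow (-D.hitTime P x) x

variable (hD : D.IsLiouville) (h : D.IsStarshaped P U) (hι : IsParametrization J I ι P)
include hD h hι

theorem IsParametrization.exists_boundaryProjection (hne : (D.symplectization U).Nonempty) :
    ∃ κ : M → Q, D.IsBoundaryProjection P U ι κ := by
  have hex : ∀ x ∈ D.symplectization U, ∃ q, ι q = D.flow (-D.hitTime P x) x := fun x hx =>
    hι.range_eq.ge (hD.flow_hitTime_mem h hx)
  obtain ⟨x₀, hx₀⟩ := hne
  have : Nonempty Q := ⟨(hex x₀ hx₀).choose⟩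
  choose! κ hκ using hex
  exact ⟨κ, hκ⟩

theorem IsParametrization.mem_symplectization (q : Q) : ι q ∈ D.symplectization U :=
  hD.notMem_core_of_mem h (hι.range_eq.le (mem_range_self q))

theorem IsParametrization.hitTime_flow (t : ℝ) (q : Q) : D.hitTime P (D.flow t (ι q)) = t := by
  rw [hD.hitTime_flow h t (hι.mem_symplectization hD h q),
    hD.hitTime_of_mem h (hι.range_eq.le (mem_range_self q)), zero_add]

/-- From L^t(ι q) the time is recovered by `hitTime` and the point by L^{-t}, so a tangent vector in
the kernel has zero time component and is then killed by the immersion ι. -/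
theorem IsParametrization.mfderiv_flow_injective (t : ℝ) (q : Q) :
    Function.Injective (mfderiv (𝓘(ℝ, ℝ).prod J) I (fun p : ℝ × Q => D.flow p.1 (ι p.2)) (t, q)) := by
  let f : ℝ × Q → M := fun p => D.flow p.1 (ι p.2)
  have hf : ContMDiff (𝓘(ℝ, ℝ).prod J) I ∞ f :=
    hD.smooth_flow.comp (contMDiff_fst.prodMk (hι.smooth.comp contMDiff_snd))
  have hfd : MDifferentiableAt (𝓘(ℝ, ℝ).prod J) I f (t, q) := hf.mdifferentiableAt (by simp)
  rw [injective_iff_map_eq_zero]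
  rintro ⟨a, w⟩ hv
  have ha : a = 0 := by
    have h1 : MDifferentiableAt I 𝓘(ℝ, ℝ) (D.hitTime P) (f (t, q)) :=
      (hD.contMDiffAt_hitTime h ((not_congr (hD.flow_mem_core_iff h t)).2
        (hι.mem_symplectization hD h q))).mdifferentiableAt (by simp)
    have h2 := mfderiv_comp (t, q) h1 hfd
    have h3 : D.hitTime P ∘ f = Prod.fst := funext fun p => hι.hitTime_flow hD h p.1 p.2
    rw [h3, mfderiv_fst] at h2
    have h4 := congrArg (fun A : ℝ × F →L[ℝ] ℝ => A (a, w)) h2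
    refine h4.trans ((congrArg (mfderiv I 𝓘(ℝ, ℝ) (D.hitTime P) (f (t, q))) hv).trans ?_)
    exact map_zero _
  subst ha
  have hw : mfderiv J I ι q w = 0 := by
    have h1 : MDifferentiableAt J (𝓘(ℝ, ℝ).prod J) (fun y : Q => (t, y)) q :=
      mdifferentiableAt_const.prodMk mdifferentiableAt_id
    have h2 := mfderiv_comp q hfd h1
    rw [mfderiv_prod_right] at h2
    have h3 : MDifferentiableAt J I (f ∘ fun y : Q => (t, y)) q := hfd.comp q h1
    have h4 := mfderiv_comp q ((hD.contMDiff_flow (-t)).mdifferentiableAt (by simp)) h3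
    have h5 : D.flow (-t) ∘ (f ∘ fun y : Q => (t, y)) = ι :=
      funext fun y => hD.flow_neg_flow t (ι y)
    rw [h5, h2] at h4
    have h6 := congrArg (fun A : F →L[ℝ] E => A w) h4
    refine h6.trans ((congrArg (mfderiv I I (D.flow (-t)) (f (t, q))) hv).trans ?_)
    exact map_zero _
  exact Prod.ext rfl (hι.immersion q (hw.trans (map_zero _).symm))

variable (hκ : D.IsBoundaryProjection P U ι κ)
include hκ

/-- The codimension condition makes (t, q) ↦ L^t(ι q) a map between equal dimensions, hence it has a
smooth local section; κ is the second component of that section. -/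
theorem IsBoundaryProjection.contMDiffOn : ContMDiffOn I J ∞ κ (D.symplectization U) := by
  intro x hx
  refine ContMDiffAt.contMDiffWithinAt ?_
  let f : ℝ × Q → M := fun p => D.flow p.1 (ι p.2)
  have hf : ContMDiff (𝓘(ℝ, ℝ).prod J) I ∞ f :=
    hD.smooth_flow.comp (contMDiff_fst.prodMk (hι.smooth.comp contMDiff_snd))
  have hfx : f (D.hitTime P x, κ x) = x := by
    change D.flow _ (ι (κ x)) = x
    rw [hκ x hx, hD.flow_flow_neg]
  have hdim : Module.finrank ℝ (ℝ × F) = Module.finrank ℝ E := by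
    rw [Module.finrank_prod, Module.finrank_self, add_comm, hι.codimension]
  obtain ⟨σ, hσ, -, hfσ⟩ := exists_local_section (hf.contMDiffAt (x := (D.hitTime P x, κ x)))
    (hι.mfderiv_flow_injective hD h _ _) hdim
  rw [hfx] at hσ hfσ
  refine (contMDiff_snd.contMDiffAt.comp x hσ).congr_of_eventuallyEq ?_
  filter_upwards [hfσ, (hD.isOpen_symplectization h).mem_nhds hx] with y hy hyS
  apply hι.injective
  have h1 : D.hitTime P y = (σ y).1 := by
    rw [← hι.hitTime_flow hD h (σ y).1 (σ y).2]
    exact congrArg _ hy.symm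
  rw [hκ y hyS, h1]
  have h2 : D.flow (-(σ y).1) (f (σ y)) = ι (σ y).2 := hD.flow_neg_flow _ _
  rw [hy] at h2
  exact h2

theorem IsBoundaryProjection.proj_flow (r : ℝ) {x : M} (hx : x ∈ D.symplectization U) :
    κ (D.flow r x) = κ x := by
  apply hι.injective
  rw [hκ x hx, hκ _ ((not_congr (hD.flow_mem_core_iff h r)).2 hx), hD.hitTime_flow h r hx,
    ← hD.flow_add, show -(D.hitTime P x + r) + r = -D.hitTime P x by ring]

theorem IsBoundaryProjection.proj_apply (q : Q) : κ (ι q) = q := by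
  apply hι.injective
  rw [hκ _ (hι.mem_symplectization hD h q), hD.hitTime_of_mem h (hι.range_eq.le (mem_range_self q)),
    neg_zero, hD.flow_zero]

/-- The contact form of the boundary, pulled back to the symplectization. -/
theorem IsBoundaryProjection.boundaryForm_comp {γ : N → M} {p : N} (hγ : MDifferentiableAt I' I γ p)
    (hp : γ p ∈ D.symplectization U) (v : TangentSpace I' p) :
    D.boundaryForm J ι (κ (γ p)) (mfderiv I' J (fun p => κ (γ p)) p v) =
      Real.exp (-D.hitTime P (γ p)) * D.α (γ p) (mfderiv I' I γ p v) := by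
  have hτ : MDifferentiableAt I 𝓘(ℝ, ℝ) (D.hitTime P) (γ p) :=
    (hD.contMDiffAt_hitTime h hp).mdifferentiableAt (by simp)
  have hs : MDifferentiableAt I' 𝓘(ℝ, ℝ) (fun p => -D.hitTime P (γ p)) p :=
    (contDiff_neg.contMDiff.mdifferentiableAt (by simp : (∞ : WithTop ℕ∞) ≠ 0)).comp p (hτ.comp p hγ)
  have h1 := hD.α_flow_comp hs hγ v
  refine Eq.trans ?_ h1
  have hκd : MDifferentiableAt I J κ (γ p) :=
    ((hκ.contMDiffOn hD h hι _ hp).contMDiffAt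
      ((hD.isOpen_symplectization h).mem_nhds hp)).mdifferentiableAt (by simp)
  have hκγ : MDifferentiableAt I' J (fun p => κ (γ p)) p := hκd.comp p hγ
  have h2 := mfderiv_comp p (hι.smooth.mdifferentiableAt (by simp)) hκγ
  have h3 : (ι ∘ fun p => κ (γ p)) =ᶠ[𝓝 p] fun p => D.flow (-D.hitTime P (γ p)) (γ p) := by
    filter_upwards [hγ.continuousAt.preimage_mem_nhds
      ((hD.isOpen_symplectization h).mem_nhds hp)] with q hq
    exact hκ _ hq
  have key : ∀ f g : N → M, f =ᶠ[𝓝 p] g →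
      D.α (f p) (mfderiv I' I f p v) = D.α (g p) (mfderiv I' I g p v) := by
    intro f g hfg
    rw [hfg.mfderiv_eq]
    have key2 : ∀ y, y = g p → D.α y (mfderiv I' I g p v : E) = D.α (g p) (mfderiv I' I g p v) := by
      rintro _ rfl; rfl
    exact key2 _ hfg.self_of_nhds
  refine Eq.trans ?_ (key _ _ h3)
  rw [h2]
  rfl

end LiouvilleData

end BoundaryProjection

/-! ## Non-orderability -/

section NonOrderability

open Filter Topology

section Homotopy

variable {E : Type*} [NormedAddCommGroup E] [NormedSpace ℝ E]
  {H : Type*} [TopologicalSpace H] {I : ModelWithCorners ℝ E H}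
  {Q : Type*} [TopologicalSpace Q] [ChartedSpace H Q] {β : CovectorField I (M := Q)}

theorem IsContactFamily.reparam {T : Type*} [NormedAddCommGroup T] [NormedSpace ℝ T]
    {T' : Type*} [NormedAddCommGroup T'] [NormedSpace ℝ T'] {K : Set T} {K' : Set T'}
    {Φ Ψ : T → Q → Q} (hΦ : IsContactFamily β K Φ Ψ) {g : T' → T} (hg : ContDiffOn ℝ ∞ g K')
    (hgK : MapsTo g K' K) : IsContactFamily β K' (fun t => Φ (g t)) (fun t => Ψ (g t)) := by
  have h1 : ContMDiffOn (𝓘(ℝ, T').prod I) (𝓘(ℝ, T).prod I) ∞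
      (fun q : T' × Q => (g q.1, q.2)) (K' ×ˢ univ) :=
    (hg.contMDiffOn.comp contMDiffOn_fst fun q hq => hq.1).prodMk contMDiffOn_snd
  exact
  { smooth := hΦ.smooth.comp h1 fun q hq => ⟨hgK hq.1, hq.2⟩
    smooth_inv := hΦ.smooth_inv.comp h1 fun q hq => ⟨hgK hq.1, hq.2⟩
    left_inv := fun t ht => hΦ.left_inv _ (hgK ht)
    right_inv := fun t ht => hΦ.right_inv _ (hgK ht)
    contact := fun t ht => hΦ.contact _ (hgK ht) }

namespace ContactPath

theorem Homotopic.of_eq {f g : ContactPath β}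
    (hfg : ∀ t ∈ Icc (0 : ℝ) 1, ∀ q, g.toFun t q = f.toFun t q) : Homotopic f g :=
  ⟨_, _, f.family.reparam (g := Prod.snd) contDiffOn_snd fun _ hp => hp.2, fun _ _ _ => rfl,
    fun t ht q => (hfg t ht q).symm, fun _ _ => f.map_zero, fun _ _ _ => rfl⟩

theorem Homotopic.toFun_one_eq {f g : ContactPath β} (hfg : Homotopic f g) :
    f.toFun 1 = g.toFun 1 := by
  obtain ⟨F, _, _, _, h1, _, h2⟩ := hfg
  have h0 : (1 : ℝ) ∈ Icc (0 : ℝ) 1 := ⟨zero_le_one, le_rfl⟩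
  exact funext fun q => (h2 1 h0 q).symm.trans (h1 1 h0 q)

/-- `Quot` identifies along the equivalence relation generated by `Homotopic`. The end point is
constant along each homotopy and so descends, without transitivity of `Homotopic` being needed. -/
theorem toFun_one_eq_of_mk_eq {f g : ContactPath β}
    (hfg : (Quot.mk _ f : ContUniversalCover β) = Quot.mk _ g) : f.toFun 1 = g.toFun 1 :=
  congrArg (Quot.lift (fun p : ContactPath β => p.toFun 1) fun _ _ => Homotopic.toFun_one_eq) hfg

end ContactPath

end Homotopy

namespace LiouvilleData

variable {E : Type*} [NormedAddCommGroup E] [NormedSpace ℝ E] [FiniteDimensional ℝ E]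
  {H : Type*} [TopologicalSpace H] {I : ModelWithCorners ℝ E H} [I.Boundaryless]
  {M : Type*} [TopologicalSpace M] [T2Space M] [ChartedSpace H M] [IsManifold I ∞ M]
  {F : Type*} [NormedAddCommGroup F] [NormedSpace ℝ F] [FiniteDimensional ℝ F]
  {G : Type*} [TopologicalSpace G] {J : ModelWithCorners ℝ F G} [J.Boundaryless]
  {Q : Type*} [TopologicalSpace Q] [ChartedSpace G Q] [IsManifold J ∞ Q]
  {T : Type*} [NormedAddCommGroup T] [NormedSpace ℝ T] {K : Set T}
  {D : LiouvilleData I M} {P U : Set M} {ι : Q → M} {κ : M → Q}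

/-- Equivariant maps permute the Liouville trajectories and so descend along κ. They preserve α, and
the boundary form differs from α by the factor e^{-τ}, so the kernel is preserved. -/
theorem IsBoundaryProjection.isContactFamily (hD : D.IsLiouville) (h : D.IsStarshaped P U)
    (hι : IsParametrization J I ι P) (hκ : D.IsBoundaryProjection P U ι κ) {Φ Ψ : T → M → M}
    (hΦ : D.IsEquivariantFamily (D.symplectization U) K Φ Ψ) :
    IsContactFamily (D.boundaryForm J ι) K (fun t q => κ (Φ t (ι q))) (fun t q => κ (Ψ t (ι q))) := by
  have hS := hD.isOpen_symplectization h
  have hιS := hι.mem_symplectization hD h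
  have hκs := hκ.contMDiffOn hD h hι
  have hflow : ∀ r, MapsTo (D.flow r) (D.symplectization U) (D.symplectization U) :=
    fun r x hx => mt (hD.flow_mem_core_iff h r).1 hx
  have hm : ContMDiff (𝓘(ℝ, T).prod J) (𝓘(ℝ, T).prod I) ∞ (fun p : T × Q => (p.1, ι p.2)) :=
    contMDiff_fst.prodMk (hι.smooth.comp contMDiff_snd)
  have hsm : ∀ {Φ Ψ : T → M → M}, D.IsEquivariantFamily (D.symplectization U) K Φ Ψ →
      ContMDiffOn (𝓘(ℝ, T).prod J) J ∞ (fun p : T × Q => κ (Φ p.1 (ι p.2))) (K ×ˢ univ) :=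
    fun hΦ => hκs.comp (hΦ.smooth.comp (hm.contMDiffOn (s := K ×ˢ univ))
      fun p hp => ⟨hp.1, hιS p.2⟩) fun p hp => hΦ.mapsTo _ hp.1 (hιS p.2)
  have hinv : ∀ {Φ Ψ : T → M → M}, D.IsEquivariantFamily (D.symplectization U) K Φ Ψ →
      ∀ t ∈ K, ∀ q, κ (Ψ t (ι (κ (Φ t (ι q))))) = q := by
    intro Φ Ψ hΦ t ht q
    have h1 := hΦ.mapsTo t ht (hιS q)
    rw [hκ _ h1, (hΦ.symm hS hflow).equivariant t ht _ h1,
      hκ.proj_flow hD h hι _ (hΦ.mapsTo_inv t ht h1), hΦ.left_inv t ht _ (hιS q),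
      hκ.proj_apply hD h hι]
  refine ⟨hsm hΦ, hsm (hΦ.symm hS hflow), hinv hΦ, hinv (hΦ.symm hS hflow), fun t ht q v => ?_⟩
  have hιd : MDifferentiableAt J I ι q := hι.smooth.mdifferentiableAt (by simp)
  have hΦd := hΦ.mdifferentiableAt hS ht (hιS q)
  have e := hκ.boundaryForm_comp hD h hι (γ := fun q => Φ t (ι q)) (hΦd.comp q hιd)
    (hΦ.mapsTo t ht (hιS q)) v
  have e2 : mfderiv J I (fun q => Φ t (ι q)) q v = mfderiv I I (Φ t) (ι q) (mfderiv J I ι q v) :=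
    congrArg (fun A : F →L[ℝ] E => A v) (mfderiv_comp q hΦd hιd)
  rw [e, e2, hΦ.α_pullback hD hS ht (hιS q), mul_eq_zero, or_iff_right (Real.exp_pos _).ne']
  rfl

/-- The value of an equivariant Hamiltonian on an affinely reparametrized isotopy. -/
theorem IsEquivariantFamily.α_velocity_affine {S : Set M} {φ ψ : ℝ → M → M}
    (hφ : D.IsEquivariantFamily S univ φ ψ) (hS : IsOpen S) (c d t : ℝ) {x : M} (hx : x ∈ S) :
    MDifferentiableAt 𝓘(ℝ, ℝ) I (fun τ => φ (c + d * τ) x) t ∧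
    D.α (φ (c + d * t) x) (mfderiv 𝓘(ℝ, ℝ) I (fun τ => φ (c + d * τ) x) t (1 : ℝ)) =
      d * D.α (φ (c + d * t) x) (mfderiv 𝓘(ℝ, ℝ) I (fun τ => φ τ x) (c + d * t) (1 : ℝ)) := by
  have h1 : MDifferentiableAt 𝓘(ℝ, ℝ) I (fun τ => φ τ x) (c + d * t) :=
    hφ.mdifferentiableAt_curve (γ := fun _ => x) hS mdifferentiableAt_const hx
  have h2 : HasDerivAt (fun τ : ℝ => c + d * τ) d t := by
    simpa using ((hasDerivAt_id t).const_mul d).const_add c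
  have h3 := h2.hasFDerivAt.hasMFDerivAt
  refine ⟨h1.comp t h3.mdifferentiableAt, ?_⟩
  have h4 : mfderiv 𝓘(ℝ, ℝ) I (fun τ => φ (c + d * τ) x) t (1 : ℝ) =
      mfderiv 𝓘(ℝ, ℝ) I (fun τ => φ τ x) (c + d * t) ((1 : ℝ) • d) :=
    congrArg (fun A : ℝ →L[ℝ] E => A 1) (h1.hasMFDerivAt.comp t h3).mfderiv
  rw [h4]
  have h5 : (mfderiv 𝓘(ℝ, ℝ) I (fun τ => φ τ x) (c + d * t) ((1 : ℝ) • d) : E) =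
      d • (mfderiv 𝓘(ℝ, ℝ) I (fun τ => φ τ x) (c + d * t) (1 : ℝ) : E) := by
    refine Eq.trans ?_ (map_smul (mfderiv 𝓘(ℝ, ℝ) I (fun τ => φ τ x) (c + d * t)) d (1 : ℝ))
    exact congrArg (mfderiv 𝓘(ℝ, ℝ) I (fun τ => φ τ x) (c + d * t))
      ((one_smul ℝ d).trans (mul_one d).symm)
  refine (congrArg (D.α (φ (c + d * t) x)) h5).trans ?_
  exact map_smul (D.α (φ (c + d * t) x)) d _

end LiouvilleData

end NonOrderability

/-! ### Positive contractible loops obstruct orderability. -/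

section PositiveLoopNotOrderable

open Filter Topology

namespace LiouvilleData

variable {E : Type*} [NormedAddCommGroup E] [NormedSpace ℝ E] [FiniteDimensional ℝ E]
  {H : Type*} [TopologicalSpace H] {I : ModelWithCorners ℝ E H} [I.Boundaryless]
  {M : Type*} [TopologicalSpace M] [T2Space M] [ChartedSpace H M] [IsManifold I ∞ M]
  {F : Type*} [NormedAddCommGroup F] [NormedSpace ℝ F] [FiniteDimensional ℝ F]
  {G : Type*} [TopologicalSpace G] {J : ModelWithCorners ℝ F G} [J.Boundaryless]
  {Q : Type*} [TopologicalSpace Q] [ChartedSpace G Q] [IsManifold J ∞ Q]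
  {D : LiouvilleData I M} {P U : Set M} {ι : Q → M} {κ : M → Q} {φ ψ : ℝ → M → M}

theorem IsEquivariantFamily.shift {S : Set M} (hS : IsOpen S)
    (hflow : ∀ r, MapsTo (D.flow r) S S) (hφ : D.IsEquivariantFamily S univ φ ψ) (c d : ℝ) :
    D.IsEquivariantFamily S univ (fun t x => φ (c + d * t) (ψ c x))
      (fun t x => φ c (ψ (c + d * t) x)) :=
  (hφ.reparam (T' := ℝ) (g := fun t => c + d * t)
      (contDiff_const.add (contDiff_const.mul contDiff_id)).contDiffOn fun _ _ => trivial).comp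
    ((hφ.reparam (T' := ℝ) (g := fun _ => c) contDiffOn_const fun _ _ => trivial).symm hS hflow) hS

/-- The contact isotopy of the ideal boundary induced by the piece `t ↦ φ_{c + d t} ∘ φ_c⁻¹` of an
equivariant symplectic isotopy. -/
def IsBoundaryProjection.contactPath (hD : D.IsLiouville) (h : D.IsStarshaped P U)
    (hι : IsParametrization J I ι P) (hκ : D.IsBoundaryProjection P U ι κ)
    (hφ : D.IsEquivariantFamily (D.symplectization U) univ φ ψ) (c d : ℝ) :
    ContactPath (D.boundaryForm J ι) where
  toFun t q := κ (φ (c + d * t) (ψ c (ι q)))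
  invFun t q := κ (φ c (ψ (c + d * t) (ι q)))
  family := hκ.isContactFamily hD h hι ((hφ.shift (hD.isOpen_symplectization h)
    (fun r _ hx => mt (hD.flow_mem_core_iff h r).1 hx) c d).mono (subset_univ _))
  map_zero q := by
    rw [mul_zero, add_zero, hφ.right_inv c trivial _ (hι.mem_symplectization hD h q),
      hκ.proj_apply hD h hι]

/-- The contact Hamiltonian of the piece is e^{-τ} times `d` times the positive Hamiltonian of φ.
Allowing `d = 0` covers the constant path. -/
theorem IsBoundaryProjection.isNonneg_contactPath (hD : D.IsLiouville) (h : D.IsStarshaped P U)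
    (hι : IsParametrization J I ι P) (hκ : D.IsBoundaryProjection P U ι κ)
    (hφ : D.IsEquivariantFamily (D.symplectization U) univ φ ψ)
    (hpos : ∀ t, ∀ x ∈ D.symplectization U,
      0 < D.α (φ t x) (mfderiv 𝓘(ℝ, ℝ) I (fun τ : ℝ => φ τ x) t (1 : ℝ)))
    (c : ℝ) {d : ℝ} (hd : 0 ≤ d) : (hκ.contactPath hD h hι hφ c d).IsNonneg := by
  intro t ht q
  have hS := hD.isOpen_symplectization h
  have hx := hφ.mapsTo_inv c trivial (hι.mem_symplectization hD h q)
  have hy := hφ.mapsTo (c + d * t) trivial hx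
  obtain ⟨hγ, hα⟩ := hφ.α_velocity_affine hS c d t hx
  have hκd : MDifferentiableAt I J κ (φ (c + d * t) (ψ c (ι q))) :=
    ((hκ.contMDiffOn hD h hι _ hy).contMDiffAt (hS.mem_nhds hy)).mdifferentiableAt (by simp)
  have hd' : MDifferentiableAt 𝓘(ℝ, ℝ) J (fun τ : ℝ => κ (φ (c + d * τ) (ψ c (ι q)))) t :=
    hκd.comp t hγ
  change 0 ≤ D.boundaryForm J ι (κ (φ (c + d * t) (ψ c (ι q)))) (mfderivWithin 𝓘(ℝ, ℝ) J
    (fun τ : ℝ => κ (φ (c + d * τ) (ψ c (ι q)))) (Icc (0 : ℝ) 1) t (1 : ℝ))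
  rw [mfderivWithin_eq_mfderiv
      (uniqueMDiffWithinAt_iff_uniqueDiffWithinAt.2 (uniqueDiffOn_Icc zero_lt_one t ht)) hd']
  refine le_of_le_of_eq ?_ (hκ.boundaryForm_comp hD h hι hγ hy (1 : ℝ)).symm
  rw [hα]
  exact mul_nonneg (Real.exp_pos _).le (mul_nonneg hd (hpos _ _ hx).le)

/-- The time `t₀` map of a contractible loop is joined to the identity by the inverse of the first
piece of the loop and by its second piece; these are homotopic. -/
theorem IsContractibleLoop.homotopic_contactPath (hD : D.IsLiouville) (h : D.IsStarshaped P U)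
    (hι : IsParametrization J I ι P) (hκ : D.IsBoundaryProjection P U ι κ)
    (hφ : D.IsEquivariantFamily (D.symplectization U) univ φ ψ)
    (hc : D.IsContractibleLoop (D.symplectization U) φ) {t₀ : ℝ} :
    ContactPath.Homotopic (hκ.contactPath hD h hι hφ 0 t₀).inv
      (hκ.contactPath hD h hι hφ t₀ (1 - t₀)) := by
  obtain ⟨A, B, hA, hA0, hA1, hAs, hAt⟩ := hc
  have hS := hD.isOpen_symplectization h
  have hιS := hι.mem_symplectization hD h
  have hflow : ∀ r, MapsTo (D.flow r) (D.symplectization U) (D.symplectization U) :=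
    fun r x hx => mt (hD.flow_mem_core_iff h r).1 hx
  have i0 : (0 : ℝ) ∈ Icc (0 : ℝ) 1 := ⟨le_rfl, zero_le_one⟩
  have i1 : (1 : ℝ) ∈ Icc (0 : ℝ) 1 := ⟨zero_le_one, le_rfl⟩
  have hB : ∀ s ∈ Icc (0 : ℝ) 1, ∀ t, ∀ x y, x ∈ D.symplectization U → A (s, t) x = y →
      B (s, t) y = x := by
    rintro s hs t x _ hx rfl
    exact hA.left_inv (s, t) ⟨hs, trivial⟩ x hx
  have hB1 : ∀ t, ∀ x ∈ D.symplectization U, B (1, t) x = ψ t x := fun t x hx => by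
    have h1 := hφ.mapsTo_inv t trivial hx
    exact hB 1 i1 t _ _ h1 ((hA1 t _ h1).trans (hφ.right_inv t trivial x hx))
  have hB0 : ∀ t, ∀ x ∈ D.symplectization U, B (0, t) x = x := fun t x hx =>
    hB 0 i0 t x x hx (hA0 t x hx)
  have hBs : ∀ s ∈ Icc (0 : ℝ) 1, ∀ x ∈ D.symplectization U, B (s, 0) x = x := fun s hs x hx =>
    hB s hs 0 x x hx (hAs s hs x hx)
  have hAs1 : ∀ s ∈ Icc (0 : ℝ) 1, ∀ x ∈ D.symplectization U, A (s, 1) x = x := fun s hs x hx => by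
    rw [← zero_add (1 : ℝ), hAt s hs 0 x hx, hAs s hs x hx]
  have hφ0 : ∀ x ∈ D.symplectization U, φ 0 x = x := fun x hx =>
    (hA1 0 x hx).symm.trans (hAs 1 i1 x hx)
  let K : Set (ℝ × ℝ) := Icc (0 : ℝ) 1 ×ˢ Icc (0 : ℝ) 1
  have hA' := hA.symm hS hflow
  -- The homotopy is A(s, t₀ + (1 - t₀)t) ∘ A(s, t₀)⁻¹ ∘ A(s, t₀t) ∘ φ_{t₀t}⁻¹. At s = 0 only the
  -- last factor remains, the inverse of the first piece. At s = 1 the last two factors cancel and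
  -- leave the second piece. At t = 0 it is the identity, and at t = 1 it is φ_{t₀}⁻¹ because A(s,
  -- 1) is the identity.
  have f₁ := hA.reparam (T' := ℝ × ℝ) (K' := K) (g := fun p => (p.1, t₀ + (1 - t₀) * p.2))
    (contDiff_fst.prodMk (contDiff_const.add (contDiff_const.mul contDiff_snd))).contDiffOn
    fun p hp => ⟨hp.1, trivial⟩
  have f₂ := hA'.reparam (T' := ℝ × ℝ) (K' := K) (g := fun p => (p.1, t₀))
    (contDiff_fst.prodMk contDiff_const).contDiffOn fun p hp => ⟨hp.1, trivial⟩
  have f₃ := hA.reparam (T' := ℝ × ℝ) (K' := K) (g := fun p => (p.1, t₀ * p.2))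
    (contDiff_fst.prodMk (contDiff_const.mul contDiff_snd)).contDiffOn fun p hp => ⟨hp.1, trivial⟩
  have f₄ := hA'.reparam (T' := ℝ × ℝ) (K' := K) (g := fun p => ((1 : ℝ), t₀ * p.2))
    (contDiff_const.prodMk (contDiff_const.mul contDiff_snd)).contDiffOn fun p hp => ⟨i1, trivial⟩
  have f := f₁.comp (f₂.comp (f₃.comp f₄ hS) hS) hS
  have hψS : ∀ t q, ψ t (ι q) ∈ D.symplectization U := fun t q =>
    hφ.mapsTo_inv t trivial (hιS q)
  have hBS : ∀ s ∈ Icc (0 : ℝ) 1, ∀ t, ∀ x ∈ D.symplectization U, B (s, t) x ∈ D.symplectization U :=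
    fun s hs t x hx => hA.mapsTo_inv (s, t) ⟨hs, trivial⟩ hx
  refine ⟨_, _, hκ.isContactFamily hD h hι f, fun t ht q => ?_, fun t ht q => ?_, fun s hs q => ?_,
    fun s hs q => ?_⟩
  · change κ _ = κ (φ 0 (ψ (0 + t₀ * t) (ι q)))
    dsimp only
    rw [hB1 _ _ (hιS q), hA0 _ _ (hψS _ q), hB0 _ _ (hψS _ q), hA0 _ _ (hψS _ q), zero_add,
      hφ0 _ (hψS _ q)]
  · change κ _ = κ (φ (t₀ + (1 - t₀) * t) (ψ t₀ (ι q)))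
    dsimp only
    rw [hB1 _ _ (hιS q), hA1 _ _ (hψS _ q), hφ.right_inv _ trivial _ (hιS q), hB1 _ _ (hιS q),
      hA1 _ _ (hψS _ q)]
  · dsimp only
    rw [mul_zero, mul_zero, add_zero, hBs 1 i1 _ (hιS q), hAs s hs _ (hιS q),
      hA.right_inv (s, t₀) ⟨hs, trivial⟩ _ (hιS q), hκ.proj_apply hD h hι]
  · change κ _ = κ (φ 0 (ψ (0 + t₀ * 1) (ι q)))
    dsimp only
    rw [mul_one, mul_one, add_sub_cancel, hB1 _ _ (hιS q),
      hA.left_inv (s, t₀) ⟨hs, trivial⟩ _ (hψS _ q), hAs1 s hs _ (hψS _ q), zero_add,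
      hφ0 _ (hψS _ q)]

/-- A positive contractible loop of equivariant symplectomorphisms of the symplectization obstructs
orderability of the ideal contact boundary. -/
theorem IsLiouville.not_isOrderable_boundaryForm (hD : D.IsLiouville) (h : D.IsStarshaped P U)
    (hι : IsParametrization J I ι P) (hne : (D.symplectization U).Nonempty)
    (hφ : D.IsPositiveLoop (D.symplectization U) φ)
    (hc : D.IsContractibleLoop (D.symplectization U) φ) : ¬ IsOrderable (D.boundaryForm J ι) := by
  intro hord
  obtain ⟨κ, hκ⟩ := hι.exists_boundaryProjection hD h hne
  obtain ⟨ψ, hψ⟩ := hφ.family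
  have hιS := hι.mem_symplectization hD h
  have hφ0 : ∀ q, φ 0 (ι q) = ι q := fun q => hφ.map_zero _ (hιS q)
  have hψ0 : ∀ q, ψ 0 (ι q) = ι q := fun q => by
    conv_lhs => rw [← hφ0 q]
    exact hψ.left_inv 0 trivial _ (hιS q)
  -- The constant path is represented by the degenerate piece `g`. The first piece `f` is itself
  -- non-negative. The product of `g` with the inverse of `f` is homotopic to the rest of the loop,
  -- again non-negative. Antisymmetry then equates `f` and `g`, and so their end points.
  have hid : ∀ t₀ ∈ Ioo (0 : ℝ) 1, ∀ q, κ (φ t₀ (ι q)) = q := by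
    intro t₀ ht₀ q
    let f := hκ.contactPath hD h hι hψ 0 t₀
    let g := hκ.contactPath hD h hι hψ 0 0
    have hg : ∀ t q, g.toFun t q = q := fun t q => by
      change κ (φ (0 + 0 * t) (ψ 0 (ι q))) = q
      rw [hψ0, zero_mul, add_zero, hφ0, hκ.proj_apply hD h hι]
    have hg' : ∀ t q, g.inv.toFun t q = q := fun t q => by
      change κ (φ 0 (ψ (0 + 0 * t) (ι q))) = q
      rw [zero_mul, add_zero, hψ0, hφ0, hκ.proj_apply hD h hι]
    have hfg : (Quot.mk _ f : ContUniversalCover (D.boundaryForm J ι)) = Quot.mk _ g := by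
      refine hord _ _ ⟨f, g, f, rfl, rfl,
        hκ.isNonneg_contactPath hD h hι hψ hφ.positive 0 ht₀.1.le, Quot.sound ?_⟩
        ⟨g, f, hκ.contactPath hD h hι hψ t₀ (1 - t₀), rfl, rfl,
          hκ.isNonneg_contactPath hD h hι hψ hφ.positive t₀ (sub_nonneg.2 ht₀.2.le), ?_⟩
      · exact ContactPath.Homotopic.of_eq fun t _ q => congrArg (f.toFun t) (hg' t q)
      · have h1 : (Quot.mk _ f.inv : ContUniversalCover (D.boundaryForm J ι)) =
            Quot.mk _ (g.mul f.inv) :=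
          Quot.sound (ContactPath.Homotopic.of_eq fun t _ q => hg t _)
        exact (Quot.sound (hc.homotopic_contactPath hD h hι hκ hψ)).symm.trans h1
    have h2 : κ (φ (0 + t₀ * 1) (ψ 0 (ι q))) = q :=
      (congrFun (ContactPath.toFun_one_eq_of_mk_eq hfg) q).trans (hg 1 q)
    rwa [hψ0, mul_one, zero_add] at h2
  obtain ⟨x₀, hx₀⟩ := hne
  let q := κ x₀
  have hγ : MDifferentiableAt 𝓘(ℝ, ℝ) I (fun τ => φ τ (ι q)) (1 / 2) :=
    hψ.mdifferentiableAt_curve (γ := fun _ => ι q) (hD.isOpen_symplectization h)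
      mdifferentiableAt_const (hιS q)
  have h1 := hκ.boundaryForm_comp hD h hι hγ (hψ.mapsTo _ trivial (hιS q)) (1 : ℝ)
  -- The projected orbit is constant around the time 1/2, so its velocity there vanishes, whereas
  -- positivity of the loop makes the contact form strictly positive on that velocity.
  have h2 : (fun τ => κ (φ τ (ι q))) =ᶠ[𝓝 (1 / 2)] fun _ => q := by
    filter_upwards [Ioo_mem_nhds (a := (0 : ℝ)) (b := 1) (by norm_num : (0 : ℝ) < 1 / 2)
      (by norm_num)] with τ hτ using hid τ hτ q
  rw [h2.mfderiv_eq, mfderiv_const] at h1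
  have h3 := mul_pos (Real.exp_pos (-D.hitTime P (φ (1 / 2) (ι q))))
    (hφ.positive (1 / 2) (ι q) (hιS q))
  exact h3.ne ((map_zero _).symm.trans h1)

end LiouvilleData

end PositiveLoopNotOrderable

/-- The vector with all entries `1` is not in the core, which lies in {z = 0}. A nonempty boundary
is required for the contradiction with positivity, and also covers the case where `M` is a point. -/
theorem LiouvilleData.IsLiouville.symplectization_stabilization_nonempty
    {E : Type*} [NormedAddCommGroup E] [NormedSpace ℝ E] [FiniteDimensional ℝ E]
    {M : Type*} [TopologicalSpace M] [T2Space M] [ChartedSpace E M] [IsManifold 𝓘(ℝ, E) ∞ M]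
    {D : LiouvilleData 𝓘(ℝ, E) M} (hD : D.IsLiouville) {n : ℕ} (hn : 1 ≤ n)
    {P U : Set (M × Cn n)} (h : (D.stabilization n).IsStarshaped P U) :
    ((D.stabilization n).symplectization U).Nonempty := by
  obtain ⟨P₀, U₀, h₀⟩ := hD.exists_starshaped
  obtain ⟨x⟩ := hD.connected.toNonempty
  refine ⟨(x, WithLp.toLp 2 fun _ => 1), fun hx => ?_⟩
  have h1 : (WithLp.toLp 2 fun _ => 1 : Cn n) = 0 :=
    ((hD.mem_core_stabilization_iff h₀ hn h).1 hx).2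
  exact one_ne_zero (congrArg (fun z : Cn n => z ⟨0, hn⟩) h1)

/-- All starshaped pairs and all parametrizations are allowed, so no choice of representative of the
ideal boundary enters. The map `b 1` is the inverse of `a 1` on the symplectization, as recorded in
`IsEquivariantFamily`. -/
theorem mainTheorem4
    {E : Type*} [NormedAddCommGroup E] [NormedSpace ℝ E] [FiniteDimensional ℝ E]
    {M : Type*} [TopologicalSpace M] [T2Space M] [ChartedSpace E M] [IsManifold 𝓘(ℝ, E) ∞ M]
    (D : LiouvilleData 𝓘(ℝ, E) M) (hD : D.IsLiouville) (n : ℕ) (hn : 2 ≤ n) :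
    (D.stabilization n).IsLiouville ∧
    ∀ P U : Set (M × Cn n), (D.stabilization n).IsStarshaped P U →
      (∀ {F : Type*} [NormedAddCommGroup F] [NormedSpace ℝ F] [FiniteDimensional ℝ F]
          {Q : Type*} [TopologicalSpace Q] [T2Space Q] [CompactSpace Q] [ChartedSpace F Q]
          [IsManifold 𝓘(ℝ, F) ∞ Q] (ι : Q → M × Cn n),
          LiouvilleData.IsParametrization 𝓘(ℝ, F) (𝓘(ℝ, E).prod 𝓘(ℝ, Cn n)) ι P →
            ¬ IsOrderable ((D.stabilization n).boundaryForm 𝓘(ℝ, F) ι)) ∧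
      ∃ a b : ℝ → M × Cn n → M × Cn n,
        (D.stabilization n).IsEquivariantFamily ((D.stabilization n).symplectization U)
          (Set.Icc (0 : ℝ) 1) a b ∧
        (∀ x ∈ (D.stabilization n).symplectization U, a 0 x = x) ∧
        (D.stabilization n).IsPositiveLoop ((D.stabilization n).symplectization U)
          (fun t x => rotE (-t) (rotF (3 * t) (a 1 (rotE t (b 1 x))))) ∧
        (D.stabilization n).IsContractibleLoop ((D.stabilization n).symplectization U)
          (fun t x => rotE (-t) (rotF (3 * t) (a 1 (rotE t (b 1 x))))) := by
  refine ⟨hD.stabilization (by omega), fun P U h => ?_⟩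
  obtain ⟨k, rfl⟩ : ∃ k, n = k + 1 := ⟨n - 1, by omega⟩
  obtain ⟨a, b, hab, ha0, hpos, hcon⟩ := hD.exists_positive_contractible_loop (by omega) h
  refine ⟨?_, a, b, hab, ha0, hpos, hcon⟩
  intro F _ _ _ Q _ _ _ _ _ ι hι
  exact (hD.stabilization (by omega)).not_isOrderable_boundaryForm h hι
    (hD.symplectization_stabilization_nonempty (by omega) h) hpos hcon

end
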